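/- **Conventions.** Let $n\ge 3$, $k\ge 1$ ($k=\infty$ allowed), let $\Omega\subset\mathbb R^2$ be open and convex, and let $A\in C^k(\Omega,\mathbb C^{n\times n})$. For a $2\times2$ matrix function $E=\begin{pmatrix}a&b\\c&d\end{pmatrix}$ put $\Delta=(a-d)^2+4bc$ and $F=(\operatorname{Re}\Delta,\operatorname{Im}\Delta)$; a point $\xi_0$ is a *generic cuspidal point* (GCP) of $E$ if $F(\xi_0)=0$ and $DF(\xi_0)$ is invertible. A point $\xi_0\in\Omega$ is a GCP of $A$ if there are a closed rectangle $R\subset\Omega$ with $\xi_0$ in its interior and an invertible $T\in C^k(R,\mathbb C^{n\times n})$ with $T^{-1}AT=\operatorname{diag}(E_1,E_2)$ on $R$, $E_1$ of size $2\times2$, such that for every $\xi\in R$ the spectra of $E_1(\xi)$ and $E_2(\xi)$ are disjoint and $E_2(\xi)$ has simple eigenvalues, and such that $\xi_0$ is a GCP of $E_1$. A *smooth Jordan curve* is a $C^1$ map $\gamma:\mathbb R\to\mathbb R^2$ with $\gamma(t+1)=\gamma(t)$ that is injective on $[0,1)$; it *encircles* $\xi_0$ if $\xi_0$ lies in a bounded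 connected component of $\mathbb R^2\setminus\gamma(\mathbb R)$. A *transported eigendecomposition* of a matrix function $B(t)$, $t\in\mathbb R$, is a factorization $B(t)=V(t)\Lambda(t)V(t)^{-1}$ with $V,\Lambda$ of class $C^k$, $\Lambda=\operatorname{diag}(\lambda_1,\dots,\lambda_n)$, such that $P=V^{-1}\dot V$ satisfies, for all $t$ and $j$, with $v_j$ the $j$-th column of $V$, $$\operatorname{Re}(v_j^*v_jP_{jj})=-\sum_{l\ne j}\operatorname{Re}(v_j^*v_lP_{lj}),\qquad \operatorname{Im}P_{jj}=0 .$$ (The first condition says that every $\|v_j(t)\|_2$ is constant in $t$.) **Theorem.** Let $\xi_0\in\Omega$ be a GCP of $A$, suppose that $A(\xi)$ has $n$ distinct eigenvalues for every $\xi\in\Omega\setminus\{\xi_0\}$, and let $\gamma$ be a smooth Jordan curve in $\Omega$ that encircles $\xi_0$. *Single loop.* Let $A(\gamma(t))=V(t)\Lambda(t)V(t)^{-1}$ be a transported eigendecomposition. Then the eigenvalues (and the columns of $V$ accordingly) can be labeled so that, for all $t\in\mathbb R$, (i) $\lambda_1(t+1)=\lambda_2(t)$ and $\lambda_2(t+1)=\lambda_1(t)$;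 (ii) $\lambda_j(t+1)=\lambda_j(t)$ for all $j\ge3$; (iii) if $\|v_1(0)\|_2=\|v_2(0)\|_2$ (for instance, if the eigenvectors are unit vectors), then there are constants $\alpha_1,\dots,\alpha_n\in\mathbb R$, independent of $t$, with $$V^{-1}(t)V(t+1)=\begin{pmatrix}0&e^{i\alpha_2}&&&\\e^{i\alpha_1}&0&&&\\&&e^{i\alpha_3}&&\\&&&\ddots&\\&&&&e^{i\alpha_n}\end{pmatrix},\qquad \sum_{j=1}^n\alpha_j=\pi \pmod{2\pi}.$$ *Shrinking loops.* For $s\in(0,1]$ let $\gamma_s(t)=\xi_0+s(\gamma(t)-\xi_0)$, let $A(\gamma_s(t))=V_s(t)\Lambda_s(t)V_s(t)^{-1}$ be a transported eigendecomposition, labeled so that (iii) holds for it, and let $\alpha_1(s),\dots,\alpha_n(s)$ be its phases as in (iii). Then, as $s\to0^+$, $$\alpha_j(s)=O(s)\pmod{2\pi}\quad\text{for } j\ge3 .$$ If moreover the initial vectors $v_1(0;s)$, $v_2(0;s)$ of the two swapped eigenvectors are chosen with relative phase $0$ modulo $\pi$ up to $O(\sqrt s)$, that is, $$\frac{\operatorname{Im}\big(v_1(0;s)^*v_2(0;s)\big)}{\|v_1(0;s)\|_2\,\|v_2(0;s)\|_2}=O(\sqrt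 s),$$ then $$\alpha_j(s)=\frac{\pi}{2}+O(\sqrt s)\pmod{\pi}\quad\text{for } j=1,2 .$$ -/

import Mathlib

open scoped Topology
open Asymptotics

/-- The parameter plane, with its Euclidean norm. -/
abbrev Plane : Type := EuclideanSpace ℝ (Fin 2)

/-- All eigenvalues of `M`, counted with algebraic multiplicity, are distinct. -/
def HasDistinctEigenvalues {n : ℕ} (M : Matrix (Fin n) (Fin n) ℂ) : Prop :=
  M.charpoly.roots.Nodup

/-- `A` is of class `C^k` on `S` (entry by entry). -/
def MatContDiffOn {n m : ℕ} (k : ℕ∞) (A : Plane → Matrix (Fin n) (Fin m) ℂ) (S : Set Plane) :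
    Prop :=
  ∀ i j, ContDiffOn ℝ k (fun ξ => A ξ i j) S

/-- `Δ = (a - d)² + 4bc` for the matrix with rows `(a, b)` and `(c, d)`. -/
def disc2 (M : Matrix (Fin 2) (Fin 2) ℂ) : ℂ :=
  (M 0 0 - M 1 1) ^ 2 + 4 * M 0 1 * M 1 0

/-- The real map `F = (Re Δ, Im Δ)` of a `2 × 2` matrix function. -/
noncomputable def discMap (E : Plane → Matrix (Fin 2) (Fin 2) ℂ) (ξ : Plane) : Plane :=
  !₂[(disc2 (E ξ)).re, (disc2 (E ξ)).im]

/-- Generic cuspidal point of a `2 × 2` matrix function: `F(ξ₀) = 0` and `DF(ξ₀)` is invertible. -/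
def IsGCPTwo (E : Plane → Matrix (Fin 2) (Fin 2) ℂ) (ξ₀ : Plane) : Prop :=
  discMap E ξ₀ = 0 ∧ (fderiv ℝ (discMap E) ξ₀).IsInvertible

/-- The closed rectangle with lower left corner `a` and upper right corner `b`. -/
def rectangle (a b : Plane) : Set Plane :=
  {ξ | ∀ i, ξ i ∈ Set.Icc (a i) (b i)}

/-- Generic cuspidal point of an `n × n` matrix function (`n > 2`): on a closed rectangle
`R ⊆ Ω` with `ξ₀` in its interior, a `C^k` invertible `T` block-diagonalizes `A` into a `2 × 2`
block `E₁` and a block `E₂`, with disjoint spectra, such that `ξ₀` is a generic cuspidal point of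
`E₁` and `E₂` has simple spectrum on `R`. -/
def IsGCP {n : ℕ} (k : ℕ∞) (A : Plane → Matrix (Fin n) (Fin n) ℂ) (Ω : Set Plane) (ξ₀ : Plane) :
    Prop :=
  ∃ a b : Plane, (∀ i, ξ₀ i ∈ Set.Ioo (a i) (b i)) ∧ rectangle a b ⊆ Ω ∧
    ∃ (m : ℕ) (e : Fin 2 ⊕ Fin m ≃ Fin n) (T : Plane → Matrix (Fin n) (Fin n) ℂ)
      (E₁ : Plane → Matrix (Fin 2) (Fin 2) ℂ) (E₂ : Plane → Matrix (Fin m) (Fin m) ℂ),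
      MatContDiffOn k T (rectangle a b) ∧
      (∀ ξ ∈ rectangle a b,
        IsUnit (T ξ) ∧
        A ξ * T ξ = T ξ * Matrix.reindex e e (Matrix.fromBlocks (E₁ ξ) 0 0 (E₂ ξ)) ∧
        Disjoint (spectrum ℂ (E₁ ξ)) (spectrum ℂ (E₂ ξ)) ∧
        HasDistinctEigenvalues (E₂ ξ)) ∧
      IsGCPTwo E₁ ξ₀

/-- A smooth (that is, `C¹`) parametrized Jordan curve of period `1`. -/
structure IsSmoothJordanCurve (γ : ℝ → Plane) : Prop where
  contDiff : ContDiff ℝ 1 γ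
  periodic : ∀ t, γ (t + 1) = γ t
  injOn : Set.InjOn γ (Set.Ico 0 1)

/-- The curve `γ` encircles `ξ₀`: the point is off the curve, and the connected component of the
complement of the curve that contains it is bounded. -/
def Encircles (γ : ℝ → Plane) (ξ₀ : Plane) : Prop :=
  ξ₀ ∉ Set.range γ ∧ Bornology.IsBounded (connectedComponentIn (Set.range γ)ᶜ ξ₀)

/-- The curve `γ_s = ξ₀ + s (γ - ξ₀)`. -/
noncomputable def shrink (ξ₀ : Plane) (γ : ℝ → Plane) (s t : ℝ) : Plane :=
  ξ₀ + s • (γ t - ξ₀)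

/-- The `j`-th column of `M`, as a vector of the Hermitian space `ℂⁿ`. -/
noncomputable def colVec {n : ℕ} (M : Matrix (Fin n) (Fin n) ℂ) (j : Fin n) :
    EuclideanSpace ℂ (Fin n) :=
  WithLp.toLp 2 (fun i => M i j)

/-- `P(t) = V(t)⁻¹ V'(t)`. -/
noncomputable def transportMatrix {n : ℕ} (V : ℝ → Matrix (Fin n) (Fin n) ℂ) (t : ℝ) :
    Matrix (Fin n) (Fin n) ℂ :=
  (V t)⁻¹ * Matrix.of (fun i j => deriv (fun τ => V τ i j) t)

/-- `B = V Λ V⁻¹` is a `C^k` eigendecomposition on `ℝ`, with `Λ` diagonal, normalized so that the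
columns of `V` have constant length (`realP`) and undergo parallel transport (`imgP`). -/
structure IsTransportedEigendecomposition {n : ℕ} (k : ℕ∞)
    (B V : ℝ → Matrix (Fin n) (Fin n) ℂ) (lam : ℝ → Fin n → ℂ) : Prop where
  contDiff_V : ∀ i j, ContDiff ℝ k (fun t => V t i j)
  contDiff_lam : ∀ j, ContDiff ℝ k (fun t => lam t j)
  isUnit : ∀ t, IsUnit (V t)
  decomp : ∀ t, B t = V t * Matrix.diagonal (lam t) * (V t)⁻¹
  realP : ∀ t j,
    (inner ℂ (colVec (V t) j) (colVec (V t) j) * transportMatrix V t j j).re =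
      -∑ l ∈ Finset.univ.erase j,
        (inner ℂ (colVec (V t) j) (colVec (V t) l) * transportMatrix V t l j).re
  imgP : ∀ t j, (transportMatrix V t j j).im = 0

/-- The matrix whose only nonzero entries are `exp(i α_p)` at `(q, p)`, `exp(i α_q)` at `(p, q)`,
and `exp(i α_j)` at `(j, j)` for `j ≠ p, q`. -/
noncomputable def swapPhaseMatrix {n : ℕ} (p q : Fin n) (α : Fin n → ℝ) :
    Matrix (Fin n) (Fin n) ℂ :=
  Matrix.of fun i j => if i = Equiv.swap p q j then Complex.exp (Complex.I * (α j : ℂ)) else 0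

/-! ### Odd winding number of a plane Jordan curve -/

section PlaneTopology

open Set Filter

/-! Near `ξ₀` the degenerating eigenvalues are half the trace of the 2×2 block plus or minus `r`,
where `r ^ 2 = Δ / 4`. Since `DF(ξ₀)` is invertible, `Δ` along the loop of size `s` is `s L(γ - ξ₀)
+ o(s)` with `L` a linear isomorphism. A Jordan curve winds an odd number of times about a point of
a bounded complementary component; this is used in the form that it has no periodic square root
there (`no_periodic_sqrt_of_encircles`). So `r` changes sign along a small loop and the pair is
exchanged (`exists_antiperiodic_sqrt`, `eventually_swap`), while the eigenvalues simple at `ξ₀`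
return. By convexity of `Ω` the small loop expands to `γ` without meeting `ξ₀`, and a continuous
labelling over this homotopy carries the permutation along (`exists_swap_of_encircles`).

For the phases, let `x` be any `C¹` eigenvector along the loop, `y` a left eigenvector, and `x = z
v_j`. Since `P_jj` is real, `Im (z'/z) = Im ((y ⬝ x') / (y ⬝ x))` (`exists_gauge`). With `x` a
column of `V` one period later the right side vanishes, so the return factor has constant argument;
its modulus is one because column lengths are constant. The logarithmic derivative of `det V` is `tr
P`, which is real, so `det V(1) / det V(0)` is positive; being `-exp(i Σ α_j)`, it forces `Σ α_j =
π`.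

On small loops, an eigenvalue simple at `ξ₀` has `y ⬝ x' = O(s)` and `y ⬝ x` bounded away from zero,
so its phase is `O(s)`. For the pair, take `x = x₀ + r x₁` with `y ⬝ x₁ = b` and `y ⬝ x = 2 b r`.
Then `Im (z'/z) = Im (r'/r) / 2 + O(√s)`: the argument of `z² / r` is nearly constant, and the sign
change of `r` makes `z` turn by a quarter (`exists_gauge_sq`). The end vectors `x₀ ± r x₁` differ by
`O(√s)`, so this quarter turn is `α` up to the relative phase of the two initial eigenvectors. When
that phase is nearly `0` modulo `π`, `cos α = O(√s)`. -/

lemma constant_of_exp_constant {X : Type*} [TopologicalSpace X] [PreconnectedSpace X]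
    {f : X → ℂ} (hf : Continuous f) {c : ℂ} (h : ∀ t, Complex.exp (f t) = c) (a b : X) :
    f a = f b := by
  refine Complex.isCoveringMap_exp.const_of_comp hf (fun x y => ?_) a b
  exact Subtype.ext (by simp [h])

lemma exists_continuous_log {X : Type*} [TopologicalSpace X] [SimplyConnectedSpace X]
    [LocallyPathConnectedSpace X] {F : X → ℂ} (hF : Continuous F) (h0 : ∀ x, F x ≠ 0) :
    ∃ L : X → ℂ, Continuous L ∧ ∀ x, Complex.exp (L x) = F x := by
  obtain ⟨a⟩ : Nonempty X := inferInstance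
  obtain ⟨L, ⟨-, hL⟩, -⟩ := Complex.isCoveringMapOn_exp.existsUnique_continuousMap_lifts
    ⟨F, hF⟩ (a₀ := a) (e₀ := Complex.log (F a)) (Complex.exp_log (h0 a)) (fun x => h0 x)
  exact ⟨L, L.continuous, fun x => congrFun hL x⟩

/-- `L (R e^{iθ}) - iθ` is a continuous logarithm of the constant `R`, hence constant in `θ`; but
its values at `0` and `2π` differ by `2πi`. -/
lemma no_continuous_log_on_circle {L : ℂ → ℂ} (hL : Continuous L) {R : ℝ} (hR : 0 < R)
    (h : ∀ z : ℂ, ‖z‖ = R → Complex.exp (L z) = z) : False := by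
  have hc : Continuous fun θ : ℝ =>
      L (R * Complex.exp (θ * Complex.I)) - θ * Complex.I := by fun_prop
  have key := constant_of_exp_constant hc (c := R) (fun θ => by
    rw [Complex.exp_sub, h _ (by simp [Complex.norm_exp, abs_of_pos hR])]
    field_simp) 0 (2 * Real.pi)
  simp [Complex.exp_two_pi_mul_I] at key
  simpa [Real.pi_ne_zero] using sub_eq_self.1 key.symm

lemma frontier_connectedComponentIn_subset {K : Set ℂ} (hK : IsClosed K) {p : ℂ} :
    frontier (connectedComponentIn Kᶜ p) ⊆ K := by
  intro z hz
  by_contra hzK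
  have hopen : IsOpen (connectedComponentIn Kᶜ p) := hK.isOpen_compl.connectedComponentIn
  have hzU : z ∉ connectedComponentIn Kᶜ p := by
    rw [hopen.frontier_eq] at hz; exact hz.2
  obtain ⟨ε, hε, hball⟩ := Metric.isOpen_iff.1 hK.isOpen_compl z hzK
  obtain ⟨w, hw, hwU⟩ := mem_closure_iff_nhds.1 (frontier_subset_closure hz) _
    (Metric.ball_mem_nhds z hε)
  apply hzU
  rw [connectedComponentIn_eq hwU]
  exact (convex_ball z ε).isPreconnected.subset_connectedComponentIn hw hball
    (Metric.mem_ball_self hε)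

/-- Borsuk's criterion: a compact set on which `z` has a continuous logarithm does not
separate `0` from infinity. -/
lemma not_isBounded_connectedComponentIn_of_log {K : Set ℂ} (hK : IsCompact K) (h0 : (0 : ℂ) ∉ K)
    {g : ℂ → ℂ} (hg : ContinuousOn g K) (hexp : ∀ z ∈ K, Complex.exp (g z) = z) :
    ¬ Bornology.IsBounded (connectedComponentIn Kᶜ 0) := by
  classical
  intro hb
  set U := connectedComponentIn Kᶜ (0 : ℂ)
  -- Tietze extends the logarithm to the plane. Replacing `z` by `exp (G z)` on the bounded
  -- component stays continuous, because the frontier lies in `K`, and removes the zero at the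
  -- origin. The resulting function has a global logarithm, although it equals `z` on a large
  -- circle.
  obtain ⟨G, hG⟩ := ContinuousMap.exists_restrict_eq hK.isClosed
    (⟨K.domRestrict g, continuousOn_iff_continuous_domRestrict.1 hg⟩ : C(K, ℂ))
  have hGK : ∀ z ∈ K, G z = g z := fun z hz => congrArg (fun f : C(K, ℂ) => f ⟨z, hz⟩) hG
  have hcont : Continuous fun z => if z ∈ U then Complex.exp (G z) else z := by
    refine Continuous.if (fun a ha => ?_) (by fun_prop) continuous_id
    have := frontier_connectedComponentIn_subset hK.isClosed ha
    rw [hGK a this, hexp a this]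
  obtain ⟨L, hL, hLF⟩ := exists_continuous_log hcont (fun z => by
    split_ifs with hz
    · exact Complex.exp_ne_zero _
    · rintro rfl
      exact hz (mem_connectedComponentIn h0))
  obtain ⟨R, hR, hUR⟩ := hb.subset_ball_lt 0 0
  refine no_continuous_log_on_circle hL hR (fun z hz => ?_)
  rw [hLF, if_neg]
  intro hzU
  simpa [hz] using hUR hzU

lemma sub_int_of_eq {Γ : ℝ → ℂ} (hp : Function.Periodic Γ 1) (hinj : InjOn Γ (Ico 0 1))
    {t u : ℝ} (h : Γ t = Γ u) : ∃ m : ℤ, t = u + m := by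
  have e : ∀ x : ℝ, Γ (Int.fract x) = Γ x := fun x => by
    rw [Int.fract]; simpa using hp.sub_zsmul_eq ⌊x⌋ (x := x)
  have := hinj ⟨Int.fract_nonneg t, Int.fract_lt_one t⟩ ⟨Int.fract_nonneg u, Int.fract_lt_one u⟩
    (by rw [e, e, h])
  obtain ⟨m, hm⟩ := Int.fract_eq_fract.1 this
  exact ⟨m, by rw [← hm]; ring⟩

lemma periodic_range_eq {Γ : ℝ → ℂ} (hp : Function.Periodic Γ 1) :
    range Γ = Γ '' Icc 0 1 := by
  have := hp.image_Icc (by norm_num) 0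
  rw [← this]; norm_num

/-- Injectivity modulo the period makes the logarithm a function of the point on the curve. It is
continuous there because `[0, 1]` maps onto the curve by a quotient map, so Borsuk's criterion
applies. -/
lemma not_isBounded_of_periodic_log {Γ : ℝ → ℂ} (hc : Continuous Γ)
    (hp : Function.Periodic Γ 1) (hinj : InjOn Γ (Ico 0 1)) {g : ℝ → ℂ} (hgc : Continuous g)
    (hgp : Function.Periodic g 1) (hexp : ∀ t, Complex.exp (g t) = Γ t) :
    ¬ Bornology.IsBounded (connectedComponentIn (range Γ)ᶜ 0) := by
  have hK : IsCompact (range Γ) := by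
    rw [periodic_range_eq hp]; exact isCompact_Icc.image hc
  have h0 : (0 : ℂ) ∉ range Γ := by
    rintro ⟨t, ht⟩; exact Complex.exp_ne_zero _ ((hexp t).trans ht)
  have hwd : ∀ t u, Γ t = Γ u → g t = g u := by
    intro t u h
    obtain ⟨m, rfl⟩ := sub_int_of_eq hp hinj h
    simpa using hgp.int_mul m u
  refine not_isBounded_connectedComponentIn_of_log hK h0 (g := fun z => g (Function.invFun Γ z))
    ?_ ?_
  · rw [continuousOn_iff_continuous_domRestrict]
    let q : Icc (0 : ℝ) 1 → range Γ := fun t => ⟨Γ t, mem_range_self _⟩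
    have hq : Continuous q := by fun_prop
    have hqs : Function.Surjective q := by
      rintro ⟨z, hz⟩
      have hz' := hz
      rw [periodic_range_eq hp] at hz'
      obtain ⟨t, ht, rfl⟩ := hz'
      exact ⟨⟨t, ht⟩, rfl⟩
    rw [(hq.isClosedMap.isQuotientMap hq hqs).continuous_iff]
    have : (range Γ).domRestrict (fun z => g (Function.invFun Γ z)) ∘ q = fun t : Icc (0 : ℝ) 1 => g t := by
      funext t
      exact hwd _ _ (Function.invFun_eq ⟨(t : ℝ), rfl⟩)
    rw [this]; fun_prop
  · rintro _ ⟨t, rfl⟩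
    rw [hexp, Function.invFun_eq (f := Γ) ⟨t, rfl⟩]

lemma log_one_add_continuous {X : Type*} [TopologicalSpace X] {f : X → ℂ} (hf : Continuous f)
    (h : ∀ x, ‖f x‖ < 1) : Continuous fun x => Complex.log (1 + f x) := by
  refine Continuous.clog (by fun_prop) fun x => ?_
  exact Complex.mem_slitPlane_of_norm_lt_one (h x)

/-- `h - p` has a continuous logarithm of period one. -/
def HasPeriodicLog (h : ℝ → ℂ) (p : ℂ) : Prop :=
  ∃ g : ℝ → ℂ, Continuous g ∧ Function.Periodic g 1 ∧ ∀ t, Complex.exp (g t) = h t - p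

/-- Factor `h - q = (h - p) (1 + (p - q) / (h - p))`; the second factor stays in the unit disc about
`1`, where the principal logarithm is continuous. -/
lemma HasPeriodicLog.of_near {h : ℝ → ℂ} (hc : Continuous h) (hp : Function.Periodic h 1)
    {p q : ℂ} (hlog : HasPeriodicLog h p) (hlt : ∀ t, ‖p - q‖ < ‖h t - p‖) :
    HasPeriodicLog h q := by
  obtain ⟨g, hg, hgp, hexp⟩ := hlog
  have hne : ∀ t, h t - p ≠ 0 := fun t => by rw [← hexp]; exact Complex.exp_ne_zero _
  have hn : ∀ t, ‖(p - q) / (h t - p)‖ < 1 := fun t => by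
    rw [norm_div, div_lt_one (norm_pos_iff.2 (hne t))]; exact hlt t
  refine ⟨fun t => g t + Complex.log (1 + (p - q) / (h t - p)), ?_, ?_, fun t => ?_⟩
  · exact hg.add (log_one_add_continuous (continuous_const.div (by fun_prop) hne) hn)
  · intro t; simp only [hgp t, hp t]
  · rw [Complex.exp_add, hexp, Complex.exp_log]
    · field_simp [hne t]; ring
    · exact Complex.slitPlane_ne_zero (Complex.mem_slitPlane_of_norm_lt_one (hn t))

lemma hasPeriodicLog_of_norm_lt {h : ℝ → ℂ} (hc : Continuous h) (hp : Function.Periodic h 1)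
    {p : ℂ} (hlt : ∀ t, ‖h t‖ < ‖p‖) : HasPeriodicLog h p := by
  have hp0 : p ≠ 0 := by
    rintro rfl; simpa using (norm_nonneg _).trans_lt (hlt 0)
  have hn : ∀ t, ‖-(h t / p)‖ < 1 := fun t => by
    rw [norm_neg, norm_div, div_lt_one (norm_pos_iff.2 hp0)]; exact hlt t
  refine ⟨fun t => Complex.log (-p) + Complex.log (1 + -(h t / p)), ?_, ?_, fun t => ?_⟩
  · exact continuous_const.add (log_one_add_continuous (by fun_prop) hn)
  · intro t; simp only [hp t]
  · rw [Complex.exp_add, Complex.exp_log (neg_ne_zero.2 hp0), Complex.exp_log]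
    · field_simp; ring
    · exact Complex.slitPlane_ne_zero (Complex.mem_slitPlane_of_norm_lt_one (hn t))

lemma exists_norm_bounds {h : ℝ → ℂ} (hc : Continuous h) (hp : Function.Periodic h 1) :
    (∃ t₀, ∀ t, ‖h t₀‖ ≤ ‖h t‖) ∧ ∃ t₁, ∀ t, ‖h t‖ ≤ ‖h t₁‖ := by
  have hr : ∀ t, ∃ u ∈ Icc (0 : ℝ) 1, h u = h t := fun t => by
    have : h t ∈ range h := mem_range_self t
    rw [periodic_range_eq hp] at this; exact this
  obtain ⟨a, -, ha⟩ := isCompact_Icc.exists_isMinOn (nonempty_Icc.2 zero_le_one)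
    (hc.norm.continuousOn (s := Icc (0 : ℝ) 1))
  obtain ⟨b, -, hb⟩ := isCompact_Icc.exists_isMaxOn (nonempty_Icc.2 zero_le_one)
    (hc.norm.continuousOn (s := Icc (0 : ℝ) 1))
  refine ⟨⟨a, fun t => ?_⟩, b, fun t => ?_⟩
  · obtain ⟨u, hu, e⟩ := hr t; rw [← e]; exact ha hu
  · obtain ⟨u, hu, e⟩ := hr t; rw [← e]; exact hb hu

/-- If `0` and infinity are joined by a connected set off the closed curve `h`, then `h` has a
continuous logarithm of period one. -/
lemma hasPeriodicLog_of_preconnected {h : ℝ → ℂ} (hc : Continuous h)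
    (hp : Function.Periodic h 1) {S : Set ℂ} (hS : IsPreconnected S) (hSK : ∀ t, h t ∉ S)
    {p q : ℂ} (hpS : p ∈ S) (hqS : q ∈ S) (hq : ∀ t, ‖h t‖ < ‖q‖) : HasPeriodicLog h p := by
  have hnear : ∀ p ∈ S, ∃ ε > 0, ∀ t, ε < ‖h t - p‖ := by
    intro p hpS
    obtain ⟨⟨t₀, ht₀⟩, -⟩ := exists_norm_bounds (h := fun t => h t - p) (by fun_prop)
      (fun t => by simp only [hp t])
    have hpos : 0 < ‖h t₀ - p‖ := norm_pos_iff.2 (sub_ne_zero.2 fun e => hSK t₀ (e ▸ hpS))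
    exact ⟨‖h t₀ - p‖ / 2, by positivity, fun t => by linarith [ht₀ t]⟩
  by_contra hpn
  -- Points of `S` with and without a periodic logarithm are interior to their own kind, so
  -- preconnectedness excludes having both. The radius is halved in the second case because
  -- `of_near` is applied from `y` back to `x` and needs the curve to be far from `y`.
  have hloc : ∀ x ∈ S, x ∈ interior {p | HasPeriodicLog h p} ∧ HasPeriodicLog h x ∨
      x ∈ interior {p | ¬ HasPeriodicLog h p} ∧ ¬ HasPeriodicLog h x := by
    intro x hx
    obtain ⟨ε, hε, hxε⟩ := hnear x hx
    by_cases hQ : HasPeriodicLog h x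
    · refine .inl ⟨mem_interior_iff_mem_nhds.2 ?_, hQ⟩
      filter_upwards [Metric.ball_mem_nhds x hε] with y hy
      refine hQ.of_near hc hp fun t => ?_
      rw [Metric.mem_ball, dist_comm, dist_eq_norm] at hy
      exact hy.trans (hxε t)
    · refine .inr ⟨mem_interior_iff_mem_nhds.2 ?_, hQ⟩
      filter_upwards [Metric.ball_mem_nhds x (half_pos hε)] with y hy hQy
      refine hQ (hQy.of_near hc hp fun t => ?_)
      rw [Metric.mem_ball, dist_eq_norm] at hy
      have : ‖h t - x‖ ≤ ‖h t - y‖ + ‖y - x‖ := by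
        simpa using norm_add_le (h t - y) (y - x)
      linarith [hxε t]
  have hqA : q ∈ interior {p | HasPeriodicLog h p} := by
    rcases hloc q hqS with h' | h'
    · exact h'.1
    · exact absurd (hasPeriodicLog_of_norm_lt hc hp hq) h'.2
  have hpB : p ∈ interior {p | ¬ HasPeriodicLog h p} := by
    rcases hloc p hpS with h' | h'
    · exact absurd h'.2 hpn
    · exact h'.1
  obtain ⟨x, -, hxA, hxB⟩ := hS (interior {p | HasPeriodicLog h p})
    (interior {p | ¬ HasPeriodicLog h p}) isOpen_interior isOpen_interior
    (fun x hx => (hloc x hx).imp And.left And.left) ⟨q, hqS, hqA⟩ ⟨p, hpS, hpB⟩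
  have hA : x ∈ {p | HasPeriodicLog h p} := interior_subset hxA
  have hB : x ∈ {p | ¬ HasPeriodicLog h p} := interior_subset hxB
  exact hB hA

/-- The winding number of a Jordan curve about a point of a bounded complementary component is
odd. -/
theorem no_periodic_sqrt_of_encircles {Γ : ℝ → ℂ} (hp : Function.Periodic Γ 1)
    (hinj : InjOn Γ (Ico 0 1)) (h0 : ∀ t, Γ t ≠ 0)
    (hb : Bornology.IsBounded (connectedComponentIn (range Γ)ᶜ 0))
    {h : ℝ → ℂ} (hc : Continuous h) (hhp : Function.Periodic h 1) (hsq : ∀ t, h t ^ 2 = Γ t) :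
    False := by
  have hne : ∀ t, h t ≠ 0 := fun t e => h0 t (by rw [← hsq, e]; ring)
  -- Squaring `h t = -h u` gives `Γ t = Γ u`, so `t - u` is an integer and `h t = h u` by
  -- periodicity, forcing `h u = 0`.
  have hanti : ∀ t u, h t ≠ -h u := by
    intro t u e
    have : Γ t = Γ u := by rw [← hsq, ← hsq, e]; ring
    obtain ⟨m, rfl⟩ := sub_int_of_eq hp hinj this
    have e' : h (u + m) = h u := by simpa using hhp.int_mul m u
    rw [e'] at e
    exact hne u (self_eq_neg.1 e)
  obtain ⟨⟨t₀, ht₀⟩, t₁, ht₁⟩ := exists_norm_bounds hc hhp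
  -- A connected path from `0` to infinity off the curve `h`: a segment to the point of `-h` nearest
  -- to `0`, the curve `-h` itself, and a ray outward from its farthest point. The extremality of
  -- `t₀` and `t₁` keeps the segment and the ray clear of `h`.
  let S₀ : Set ℂ := (fun x : ℝ => -(x * h t₀)) '' Icc 0 1
  let S₁ : Set ℂ := range fun t => -h t
  let S₂ : Set ℂ := (fun x : ℝ => -(x * h t₁)) '' Ici 1
  have hS : IsPreconnected (S₀ ∪ S₁ ∪ S₂) := by
    have c₀ : IsPreconnected S₀ := isPreconnected_Icc.image _ (by fun_prop)
    have c₁ : IsPreconnected S₁ := isPreconnected_range (by fun_prop)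
    have c₂ : IsPreconnected S₂ := isPreconnected_Ici.image _ (by fun_prop)
    refine IsPreconnected.union (-h t₁) (.inr ⟨t₁, rfl⟩) ⟨1, by simp, by simp⟩ ?_ c₂
    exact IsPreconnected.union (-h t₀) ⟨1, by simp, by simp⟩ ⟨t₀, rfl⟩ c₀ c₁
  have hoff : ∀ t, h t ∉ S₀ ∪ S₁ ∪ S₂ := by
    rintro t ((⟨x, ⟨hx0, hx1⟩, e⟩ | ⟨u, e⟩) | ⟨x, hx, e⟩)
    · rcases hx1.lt_or_eq with hx1 | rfl
      · have := ht₀ t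
        rw [← e, norm_neg, norm_mul, Complex.norm_real, Real.norm_of_nonneg hx0] at this
        nlinarith [norm_pos_iff.2 (hne t₀)]
      · exact hanti t t₀ (by rw [← e]; simp)
    · exact hanti t u e.symm
    · rcases (mem_Ici.1 hx).lt_or_eq with hx1 | rfl
      · have := ht₁ t
        rw [← e, norm_neg, norm_mul, Complex.norm_real, Real.norm_of_nonneg (by linarith)] at this
        nlinarith [norm_pos_iff.2 (hne t₁)]
      · exact hanti t t₁ (by rw [← e]; simp)
  obtain ⟨g, hg, hgp, hexp⟩ := hasPeriodicLog_of_preconnected hc hhp hS hoff (p := 0)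
    (q := -((2 : ℝ) * h t₁)) (.inl (.inl ⟨0, by simp, by simp⟩)) (.inr ⟨2, by simp, rfl⟩)
    (fun t => by
      rw [norm_neg, norm_mul, Complex.norm_real]
      have := norm_pos_iff.2 (hne t₁)
      norm_num
      linarith [ht₁ t])
  have hΓc : Continuous Γ := by
    have : Γ = fun t => h t ^ 2 := funext fun t => (hsq t).symm
    rw [this]; fun_prop
  refine not_isBounded_of_periodic_log hΓc hp hinj (g := fun t => 2 * g t) (by fun_prop)
    (fun t => by simp only [hgp t]) (fun t => ?_) hb
  rw [two_mul, Complex.exp_add, hexp, ← hsq]; ring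

end PlaneTopology

/-! ### Simple eigenvalues: labelling and `C¹` dependence -/

section Eigenvalues

open Set Filter Polynomial

variable {n : ℕ}

/-- `lam` lists the eigenvalues of `M` without repetition. -/
def IsEigenvalueLabelling {ι : Type*} (M : Matrix (Fin n) (Fin n) ℂ) (lam : ι → ℂ) : Prop :=
  Function.Injective lam ∧ ∀ μ, M.charpoly.IsRoot μ ↔ ∃ j, lam j = μ

lemma card_roots_charpoly (M : Matrix (Fin n) (Fin n) ℂ) : Multiset.card M.charpoly.roots = n := by
  rw [← (IsAlgClosed.splits M.charpoly).natDegree_eq_card_roots, M.charpoly_natDegree_eq_dim,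
    Fintype.card_fin]

lemma isEigenvalueLabelling_of_injective {ι : Type*} [Fintype ι] (hι : Fintype.card ι = n)
    {M : Matrix (Fin n) (Fin n) ℂ} {lam : ι → ℂ} (hinj : Function.Injective lam)
    (hroot : ∀ j, M.charpoly.IsRoot (lam j)) : IsEigenvalueLabelling M lam := by
  classical
  refine ⟨hinj, fun μ => ⟨fun h => ?_, fun ⟨j, hj⟩ => hj ▸ hroot j⟩⟩
  have hsub : Finset.univ.image lam ⊆ M.charpoly.roots.toFinset := by
    intro z hz
    obtain ⟨j, -, rfl⟩ := Finset.mem_image.1 hz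
    simpa [M.charpoly_monic.ne_zero] using hroot j
  have heq := Finset.eq_of_subset_of_card_le hsub (by
    rw [Finset.card_image_of_injective _ hinj, Finset.card_univ, hι]
    exact (Multiset.toFinset_card_le _).trans (card_roots_charpoly M).le)
  have : μ ∈ Finset.univ.image lam := by
    rw [heq]; simpa [M.charpoly_monic.ne_zero] using h
  simpa using this

lemma HasDistinctEigenvalues.exists_labelling {M : Matrix (Fin n) (Fin n) ℂ}
    (h : HasDistinctEigenvalues M) : ∃ lam : Fin n → ℂ, IsEigenvalueLabelling M lam := by
  classical
  have hc : M.charpoly.roots.toFinset.card = n := by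
    rw [Multiset.toFinset_card_of_nodup h, card_roots_charpoly]
  let e := (Finset.equivFinOfCardEq hc).symm
  refine ⟨fun j => e j, isEigenvalueLabelling_of_injective (by simp)
    (Subtype.val_injective.comp e.injective) fun j => ?_⟩
  exact ((mem_roots M.charpoly_monic.ne_zero).1 (Multiset.mem_toFinset.1 (e j).2))

lemma HasDistinctEigenvalues.derivative_eval_ne_zero {M : Matrix (Fin n) (Fin n) ℂ}
    (h : HasDistinctEigenvalues M) {μ : ℂ} (hμ : M.charpoly.IsRoot μ) :
    M.charpoly.derivative.eval μ ≠ 0 := by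
  intro h'
  have := (one_lt_rootMultiplicity_iff_isRoot M.charpoly_monic.ne_zero).2 ⟨hμ, h'⟩
  rw [← count_roots] at this
  exact absurd (Multiset.nodup_iff_count_le_one.1 h μ) (by omega)

lemma charpoly_of_decomp {M V : Matrix (Fin n) (Fin n) ℂ} {lam : Fin n → ℂ} (hV : IsUnit V)
    (hM : M = V * Matrix.diagonal lam * V⁻¹) : M.charpoly = ∏ i, (X - C (lam i)) := by
  obtain ⟨U, rfl⟩ := hV
  rw [hM, Matrix.charpoly_units_conj, Matrix.charpoly_diagonal]

lemma isEigenvalueLabelling_of_decomp {M V : Matrix (Fin n) (Fin n) ℂ} {lam : Fin n → ℂ}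
    (hV : IsUnit V) (hM : M = V * Matrix.diagonal lam * V⁻¹) (h : HasDistinctEigenvalues M) :
    IsEigenvalueLabelling M lam := by
  have hc := charpoly_of_decomp hV hM
  refine isEigenvalueLabelling_of_injective (by simp) ?_ fun j => ?_
  · have hr : (∏ i, (X - C (lam i))).roots = Finset.univ.val.map lam := by
      rw [Finset.prod, ← roots_multiset_prod_X_sub_C (Finset.univ.val.map lam), Multiset.map_map]
      rfl
    rw [HasDistinctEigenvalues, hc, hr] at h
    intro i j hij
    exact Multiset.inj_on_of_nodup_map h i (by simp) j (by simp) hij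
  · rw [hc, IsRoot, eval_prod]
    exact Finset.prod_eq_zero (Finset.mem_univ j) (by simp)

/-- A continuous path of eigenvalues keeps its label. -/
lemma exists_label_of_path {X ι : Type*} [TopologicalSpace X] [PreconnectedSpace X] [Nonempty X]
    [Finite ι] {lam : X → ι → ℂ} (hlam : ∀ j, Continuous fun x => lam x j)
    (hinj : ∀ x, Function.Injective (lam x)) {μ : X → ℂ} (hμ : Continuous μ)
    (h : ∀ x, ∃ j, lam x j = μ x) : ∃ j, ∀ x, lam x j = μ x := by
  choose f hf using h
  have hcl : ∀ j, IsClosed {x | lam x j = μ x} := fun j => isClosed_eq (hlam j) hμ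
  have heq : ∀ j, {x | lam x j = μ x} = f ⁻¹' {j} := fun j => by
    ext x
    exact ⟨fun hx => hinj x ((hf x).trans (Eq.symm hx)), fun hx => by
      have : f x = j := hx
      rw [← this]; exact hf x⟩
  have hloc : IsLocallyConstant f := by
    rw [IsLocallyConstant.iff_isOpen_fiber]
    intro j
    -- The finitely many fibres are closed and partition the space, so each is also open.
    have : f ⁻¹' {j} = (⋃ i ∈ ({j}ᶜ : Set ι), f ⁻¹' {i})ᶜ := by
      ext x
      simp only [mem_preimage, mem_singleton_iff, mem_compl_iff, mem_iUnion, not_exists]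
      exact ⟨fun h i hi e => hi (e.symm.trans h), fun h => by_contra fun hn => h _ hn rfl⟩
    rw [this, isOpen_compl_iff]
    exact (Set.toFinite _).isClosed_biUnion fun i _ => heq i ▸ hcl i
  obtain ⟨x₀⟩ : Nonempty X := inferInstance
  refine ⟨f x₀, fun x => ?_⟩
  rw [hloc.apply_eq_of_preconnectedSpace x₀ x]; exact hf x

section Local

variable {E : Type*} [NormedAddCommGroup E] [NormedSpace ℝ E]

lemma contDiffAt_det {ι : Type*} [Fintype ι] [DecidableEq ι] {B : E → Matrix ι ι ℂ} {x₀ : E}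
    (hB : ∀ i j, ContDiffAt ℝ 1 (fun x => B x i j) x₀) :
    ContDiffAt ℝ 1 (fun x => (B x).det) x₀ := by
  simp only [Matrix.det_apply']
  exact ContDiffAt.sum fun σ _ => contDiffAt_const.mul (contDiffAt_prod fun i _ => hB _ _)

lemma contDiffAt_adjugate {B : E → Matrix (Fin n) (Fin n) ℂ} {x₀ : E}
    (hB : ∀ i j, ContDiffAt ℝ 1 (fun x => B x i j) x₀) (i j : Fin n) :
    ContDiffAt ℝ 1 (fun x => (B x).adjugate i j) x₀ := by
  simp only [Matrix.adjugate_apply]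
  refine contDiffAt_det fun k l => ?_
  by_cases hk : k = j
  · subst hk; simpa using contDiffAt_const
  · simpa [Matrix.updateRow_apply, hk] using hB k l

lemma contDiffAt_inv_apply {B : E → Matrix (Fin n) (Fin n) ℂ} {x₀ : E}
    (hB : ∀ i j, ContDiffAt ℝ 1 (fun x => B x i j) x₀) (hu : IsUnit (B x₀)) (i j : Fin n) :
    ContDiffAt ℝ 1 (fun x => (B x)⁻¹ i j) x₀ := by
  have hdet : (B x₀).det ≠ 0 := ((Matrix.isUnit_iff_isUnit_det _).1 hu).ne_zero
  simp only [Matrix.inv_def, Ring.inverse_eq_inv, Matrix.smul_apply, smul_eq_mul]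
  exact ((contDiffAt_det hB).inv hdet).mul (contDiffAt_adjugate hB i j)

lemma contDiffAt_scalar_sub {B : E → Matrix (Fin n) (Fin n) ℂ} {μ : E → ℂ} {x₀ : E}
    (hB : ∀ i j, ContDiffAt ℝ 1 (fun x => B x i j) x₀) (hμ : ContDiffAt ℝ 1 μ x₀) (i j : Fin n) :
    ContDiffAt ℝ 1 (fun x => (Matrix.scalar (Fin n) (μ x) - B x) i j) x₀ := by
  by_cases h : i = j
  · subst h; simpa using hμ.sub (hB i i)
  · simpa [h] using (hB i j).neg

lemma contDiffAt_charpoly_eval {B : E → Matrix (Fin n) (Fin n) ℂ} {x₀ : E}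
    (hB : ∀ i j, ContDiffAt ℝ 1 (fun x => B x i j) x₀) (μ₀ : ℂ) :
    ContDiffAt ℝ 1 (fun v : E × ℂ => (B v.1).charpoly.eval v.2) (x₀, μ₀) := by
  simp only [Matrix.eval_charpoly]
  exact contDiffAt_det (contDiffAt_scalar_sub (fun i j =>
    ContDiffAt.comp (x₀, μ₀) (f := Prod.fst) (g := fun x => B x i j) (hB i j) contDiffAt_fst)
    contDiffAt_snd)

/-- A simple eigenvalue of a `C¹` matrix function extends to a `C¹` function, which locally is the
only eigenvalue in its vicinity. -/
theorem exists_local_eigenvalue [CompleteSpace E] {B : E → Matrix (Fin n) (Fin n) ℂ} {x₀ : E}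
    (hB : ∀ i j, ContDiffAt ℝ 1 (fun x => B x i j) x₀) {μ₀ : ℂ} (h0 : (B x₀).charpoly.IsRoot μ₀)
    (h1 : (B x₀).charpoly.derivative.eval μ₀ ≠ 0) :
    ∃ μ : E → ℂ, ContDiffAt ℝ 1 μ x₀ ∧ μ x₀ = μ₀ ∧
      ∀ᶠ v in 𝓝 (x₀, μ₀), (B v.1).charpoly.IsRoot v.2 ↔ μ v.1 = v.2 := by
  have hG := contDiffAt_charpoly_eval hB μ₀
  set G : E × ℂ → ℂ := fun v => (B v.1).charpoly.eval v.2 with hGdef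
  set c := (B x₀).charpoly.derivative.eval μ₀
  have hd : HasFDerivAt (fun z => G (x₀, z)) (fderiv ℝ G (x₀, μ₀) ∘L .inr ℝ E ℂ) μ₀ :=
    (hG.differentiableAt one_ne_zero).hasFDerivAt.comp μ₀ (hasFDerivAt_prodMk_right x₀ μ₀)
  have hd' : HasFDerivAt (fun z => G (x₀, z)) _ μ₀ :=
    ((B x₀).charpoly.hasDerivAt μ₀).hasFDerivAt.restrictScalars ℝ
  -- The partial derivative in the eigenvalue variable is multiplication by the derivative of the
  -- characteristic polynomial at `μ₀`, nonzero for a simple root. The implicit function theorem is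
  -- used over `ℝ`, since the parameters are real.
  have hinv : (fderiv ℝ G (x₀, μ₀) ∘L .inr ℝ E ℂ).IsInvertible := by
    rw [hd.unique hd']
    refine ⟨ContinuousLinearEquiv.equivOfInverse (c • .id ℝ ℂ) (c⁻¹ • .id ℝ ℂ)
      (fun z => ?_) (fun z => ?_), ?_⟩
    · simp [c, h1]
    · simp [c, h1]
    · ext; simp [c, mul_comm]
  have hv0 : G (x₀, μ₀) = 0 := h0
  refine ⟨hG.implicitFunction one_ne_zero hinv, hG.contDiffAt_implicitFunction one_ne_zero hinv,
    hG.implicitFunction_apply_self one_ne_zero hinv, ?_⟩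
  filter_upwards [hG.eventually_apply_eq_iff_implicitFunction one_ne_zero hinv] with v hv
  rw [← hv, hv0]; rfl

/-- For `z ≠ μ₀` the adjugate of `z - M` sends `v` to `χ(z) / (z - μ₀)` times `v`; let `z` tend to
`μ₀`. This shows that the adjugate does not vanish at a simple eigenvalue. -/
lemma adjugate_scalar_sub_mulVec {M : Matrix (Fin n) (Fin n) ℂ} {μ₀ : ℂ} {v : Fin n → ℂ}
    (hv : M.mulVec v = μ₀ • v) :
    (Matrix.scalar (Fin n) μ₀ - M).adjugate.mulVec v = M.charpoly.derivative.eval μ₀ • v := by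
  have hsub : ∀ z : ℂ, (Matrix.scalar (Fin n) z - M).mulVec v = (z - μ₀) • v := fun z => by
    rw [Matrix.sub_mulVec, hv, sub_smul, Matrix.scalar_apply, ← Matrix.smul_one_eq_diagonal,
      Matrix.smul_mulVec, Matrix.one_mulVec]
  have hid : ∀ z : ℂ, (z - μ₀) • (Matrix.scalar (Fin n) z - M).adjugate.mulVec v =
      M.charpoly.eval z • v := fun z => by
    rw [← Matrix.mulVec_smul, ← hsub, Matrix.mulVec_mulVec, Matrix.adjugate_mul,
      Matrix.smul_mulVec, Matrix.one_mulVec, Matrix.eval_charpoly]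
  by_cases hv0 : v = 0
  · simp [hv0]
  have hroot : M.charpoly.eval μ₀ = 0 := by
    have := hid μ₀
    rw [sub_self, zero_smul] at this
    exact (smul_eq_zero.1 this.symm).resolve_right hv0
  have hcont : Continuous fun z : ℂ => (Matrix.scalar (Fin n) z - M).adjugate.mulVec v := by
    have : Continuous fun z : ℂ => Matrix.scalar (Fin n) z - M := by
      simp only [Matrix.scalar_apply]; fun_prop
    exact this.matrix_adjugate.matrix_mulVec continuous_const
  refine tendsto_nhds_unique (hcont.continuousWithinAt (s := {μ₀}ᶜ) (x := μ₀)) ?_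
  have hs := (hasDerivAt_iff_tendsto_slope.1 (M.charpoly.hasDerivAt μ₀)).smul_const v
  refine hs.congr' ?_
  filter_upwards [self_mem_nhdsWithin] with z hz
  have hz' : z - μ₀ ≠ 0 := sub_ne_zero.2 hz
  rw [slope_def_field, hroot, sub_zero, div_eq_inv_mul, mul_smul, ← hid, smul_smul,
    inv_mul_cancel₀ hz', one_smul]

lemma exists_eigenvector {M : Matrix (Fin n) (Fin n) ℂ} {μ : ℂ} (h : M.charpoly.IsRoot μ) :
    ∃ v : Fin n → ℂ, v ≠ 0 ∧ M.mulVec v = μ • v := by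
  rw [IsRoot, Matrix.eval_charpoly] at h
  obtain ⟨v, hv, hv0⟩ := Matrix.exists_mulVec_eq_zero_iff.2 h
  refine ⟨v, hv, ?_⟩
  rw [Matrix.sub_mulVec, sub_eq_zero, Matrix.scalar_apply, ← Matrix.smul_one_eq_diagonal,
      Matrix.smul_mulVec, Matrix.one_mulVec] at hv0
  exact hv0.symm

lemma isRoot_of_eigenvector {M : Matrix (Fin n) (Fin n) ℂ} {μ : ℂ} {v : Fin n → ℂ} (hv : v ≠ 0)
    (h : M.mulVec v = μ • v) : M.charpoly.IsRoot μ := by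
  rw [IsRoot, Matrix.eval_charpoly]
  refine Matrix.exists_mulVec_eq_zero_iff.1 ⟨v, hv, ?_⟩
  rw [Matrix.sub_mulVec, sub_eq_zero, Matrix.scalar_apply, ← Matrix.smul_one_eq_diagonal,
      Matrix.smul_mulVec, Matrix.one_mulVec, h]

/-- Locally, the eigenvalue and the right and left eigenvectors of a simple eigenvalue of a `C¹`
matrix function can be chosen of class `C¹`. -/
theorem exists_local_eigenpair [CompleteSpace E] {B : E → Matrix (Fin n) (Fin n) ℂ} {x₀ : E}
    (hB : ∀ i j, ContDiffAt ℝ 1 (fun x => B x i j) x₀) {μ₀ : ℂ} (h0 : (B x₀).charpoly.IsRoot μ₀)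
    (h1 : (B x₀).charpoly.derivative.eval μ₀ ≠ 0) :
    ∃ (μ : E → ℂ) (u y : E → Fin n → ℂ), ContDiffAt ℝ 1 μ x₀ ∧ ContDiffAt ℝ 1 u x₀ ∧
      ContDiffAt ℝ 1 y x₀ ∧ μ x₀ = μ₀ ∧ y x₀ ⬝ᵥ u x₀ ≠ 0 ∧
      ∀ᶠ x in 𝓝 x₀, (B x).mulVec (u x) = μ x • u x ∧ (B x).vecMul (y x) = μ x • y x := by
  obtain ⟨μ, hμ, hμ0, hloc⟩ := exists_local_eigenvalue hB h0 h1
  obtain ⟨v, hv, hMv⟩ := exists_eigenvector h0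
  obtain ⟨i, hi⟩ := Function.ne_iff.1 hv
  -- At an eigenvalue `μ - B` annihilates its adjugate on both sides, so columns of `N` are right
  -- eigenvectors and rows are left ones. Row `i`, with `v i ≠ 0`, pairs with `N v` at `x₀` to
  -- `χ'(μ₀) ^ 2 * v i ≠ 0`.
  let N : E → Matrix (Fin n) (Fin n) ℂ := fun x => (Matrix.scalar (Fin n) (μ x) - B x).adjugate
  have hN : ∀ i j, ContDiffAt ℝ 1 (fun x => N x i j) x₀ :=
    contDiffAt_adjugate (contDiffAt_scalar_sub hB hμ)
  have hN0 : (N x₀).mulVec v = (B x₀).charpoly.derivative.eval μ₀ • v := by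
    simp only [N, hμ0]; exact adjugate_scalar_sub_mulVec hMv
  refine ⟨μ, fun x => (N x).mulVec v, fun x => (N x).row i, hμ, ?_, ?_, hμ0, ?_, ?_⟩
  · refine contDiffAt_pi.2 fun j => ?_
    simp only [Matrix.mulVec, dotProduct]
    exact ContDiffAt.sum fun k _ => (hN j k).mul contDiffAt_const
  · exact contDiffAt_pi.2 fun j => hN i j
  · have : (N x₀).row i ⬝ᵥ v = ((N x₀).mulVec v) i := rfl
    simp only [hN0, dotProduct_smul, this]
    simpa [h1] using hi
  · have ht : Tendsto (fun x => (x, μ x)) (𝓝 x₀) (𝓝 (x₀, μ₀)) := by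
      rw [← hμ0]; exact (continuousAt_id.prodMk hμ.continuousAt)
    filter_upwards [ht.eventually hloc] with x hx
    have hdet : (Matrix.scalar (Fin n) (μ x) - B x).det = 0 := by
      rw [← Matrix.eval_charpoly]; exact hx.2 rfl
    have hR : (Matrix.scalar (Fin n) (μ x) - B x) * N x = 0 := by
      rw [Matrix.mul_adjugate, hdet, zero_smul]
    have hL : N x * (Matrix.scalar (Fin n) (μ x) - B x) = 0 := by
      rw [Matrix.adjugate_mul, hdet, zero_smul]
    rw [sub_mul, sub_eq_zero, Matrix.scalar_apply, ← Matrix.smul_one_eq_diagonal,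
      Matrix.smul_mul, one_mul] at hR
    rw [mul_sub, sub_eq_zero, Matrix.scalar_apply, ← Matrix.smul_one_eq_diagonal,
      Matrix.mul_smul, mul_one] at hL
    refine ⟨?_, ?_⟩
    · rw [Matrix.mulVec_mulVec, ← hR, Matrix.smul_mulVec]
    · have : (N x).row i = Matrix.vecMul (Pi.single i 1) (N x) := by simp
      rw [this, Matrix.vecMul_vecMul, ← hL, Matrix.vecMul_smul]

end Local

end Eigenvalues

/-! ### The eigenvalue covering and global labellings -/

section Labelling

open Set Filter Polynomial

variable {n : ℕ}

lemma norm_eigenvalue_le {w : Fin n → Fin n → ℂ} {μ : ℂ}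
    (h : (Matrix.of w).charpoly.IsRoot μ) : ‖μ‖ ≤ n * ‖w‖ := by
  obtain ⟨v, hv, hMv⟩ := exists_eigenvector h
  have hpos : 0 < ‖v‖ := norm_pos_iff.2 hv
  refine le_of_mul_le_mul_right ?_ hpos
  rw [← norm_smul, ← hMv, pi_norm_le_iff_of_nonneg (by positivity)]
  intro i
  calc ‖(Matrix.of w).mulVec v i‖ = ‖∑ j, w i j * v j‖ := rfl
    _ ≤ ∑ j, ‖w i j * v j‖ := norm_sum_le _ _
    _ ≤ ∑ _j : Fin n, ‖w‖ * ‖v‖ := Finset.sum_le_sum fun j _ => by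
        rw [norm_mul]
        gcongr
        · exact (norm_le_pi_norm (w i) j).trans (norm_le_pi_norm w i)
        · exact norm_le_pi_norm v j
    _ = n * ‖w‖ * ‖v‖ := by simp [mul_assoc]

/-- The pairs of a matrix and one of its eigenvalues. -/
abbrev EigenvaluePair (n : ℕ) : Type :=
  {v : (Fin n → Fin n → ℂ) × ℂ // (Matrix.of v.1).charpoly.IsRoot v.2}

lemma continuous_charpoly_eval :
    Continuous fun v : (Fin n → Fin n → ℂ) × ℂ => (Matrix.of v.1).charpoly.eval v.2 := by
  rw [continuous_iff_continuousAt]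
  rintro ⟨w, μ⟩
  exact (contDiffAt_charpoly_eval (B := fun w : Fin n → Fin n → ℂ => Matrix.of w)
    (fun i j => by
      simp only [Matrix.of_apply]; exact (contDiff_apply_apply ℝ ℂ i j).contDiffAt) μ).continuousAt

/-- The projection is proper: over a compact set of matrices the eigenvalues are bounded, and the
incidence relation is closed. -/
lemma isClosedMap_eigenvaluePair :
    IsClosedMap fun v : EigenvaluePair n => v.1.1 := by
  have hcl : IsClosed {v : (Fin n → Fin n → ℂ) × ℂ | (Matrix.of v.1).charpoly.IsRoot v.2} :=
    isClosed_eq continuous_charpoly_eval continuous_const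
  refine IsProperMap.isClosedMap (isProperMap_iff_isCompact_preimage.2 ⟨by fun_prop, ?_⟩)
  intro K hK
  obtain ⟨C, hC⟩ := hK.isBounded.exists_norm_le
  have hcomp := hcl.isClosedEmbedding_subtypeVal.isCompact_preimage
    (hK.prod (isCompact_closedBall (0 : ℂ) (n * C)))
  refine (congrArg IsCompact (Set.ext fun v => ?_)).mpr hcomp
  simp only [mem_preimage, mem_prod, mem_closedBall_zero_iff]
  refine ⟨fun h => ⟨h, (norm_eigenvalue_le v.2).trans ?_⟩, And.left⟩
  gcongr
  exact hC _ h

/-- Over matrices with simple spectrum the projection is a local homeomorphism by the implicit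
function theorem; being closed with finite fibres, it is a covering there. -/
lemma isCoveringMapOn_eigenvaluePair :
    IsCoveringMapOn (fun v : EigenvaluePair n => v.1.1)
      {w | HasDistinctEigenvalues (Matrix.of w)} := by
  refine isClosedMap_eigenvaluePair.isCoveringMapOn_of_isLocalHomeomorphOn (fun w _ => ?_) ?_
  · refine Set.Finite.of_finite_image (f := fun v : EigenvaluePair n => v.1.2) ?_ ?_
    · refine Set.Finite.subset (Matrix.of w).charpoly.roots.toFinset.finite_toSet ?_
      rintro _ ⟨v, rfl, rfl⟩
      have := v.2
      simpa [(Matrix.of v.1.1).charpoly_monic.ne_zero] using this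
    · rintro v hv v' hv' h
      exact Subtype.ext (Prod.ext (Eq.trans hv (Eq.symm hv')) h)
  · refine IsLocalHomeomorphOn.mk _ _ ?_
    rintro ⟨⟨w₀, μ₀⟩, hv⟩ (hw : HasDistinctEigenvalues (Matrix.of w₀))
    obtain ⟨φ, hφ, hφ0, hloc⟩ := exists_local_eigenvalue
      (B := fun w : Fin n → Fin n → ℂ => Matrix.of w) (x₀ := w₀)
      (fun i j => by
        simp only [Matrix.of_apply]; exact (contDiff_apply_apply ℝ ℂ i j).contDiffAt) hv
      (hw.derivative_eval_ne_zero hv)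
    have hcev : ∀ᶠ w in 𝓝 w₀, ContinuousAt φ w := by
      filter_upwards [hφ.eventually (by simp)] with w hw using hw.continuousAt
    obtain ⟨U, hU, V, hV, hUV⟩ := mem_nhds_prod_iff.1 hloc
    obtain ⟨V', hV'V, hV'o, hμV'⟩ := mem_nhds_iff.1 hV
    have hcV : ∀ᶠ w in 𝓝 w₀, φ w ∈ V' :=
      hφ.continuousAt.eventually_mem (by rw [hφ0]; exact hV'o.mem_nhds hμV')
    obtain ⟨U', hU'U, hU'o, hwU'⟩ := mem_nhds_iff.1 (inter_mem hU (inter_mem hcev hcV))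
    have hiff : ∀ w ∈ U', ∀ μ ∈ V', (Matrix.of w).charpoly.IsRoot μ ↔ φ w = μ :=
      fun w hw μ hμ => by
        have := hUV (show (w, μ) ∈ U ×ˢ V from ⟨(hU'U hw).1, hV'V hμ⟩)
        rw [mem_ofPred_eq] at this
        exact this
    have hmem : ∀ w ∈ U', (Matrix.of w).charpoly.IsRoot (φ w) :=
      fun w hw => (hiff w hw _ (hU'U hw).2.2).2 rfl
    have hφc : ContinuousOn φ U' := fun w hw => (hU'U hw).2.1.continuousWithinAt
    obtain ⟨g, hg⟩ : ∃ g : (Fin n → Fin n → ℂ) → EigenvaluePair n,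
        ∀ w ∈ U', (g w).1 = (w, φ w) := by
      classical
      exact ⟨fun w => if h : w ∈ U' then ⟨(w, φ w), hmem w h⟩ else ⟨(w₀, μ₀), hv⟩,
        fun w hw => by simp only [dif_pos hw]⟩
    have hgc : ContinuousOn g U' := by
      rw [Topology.IsEmbedding.subtypeVal.isInducing.continuousOn_iff]
      exact (continuousOn_id.prodMk hφc).congr hg
    have hg1 : ∀ w ∈ U', (g w).1.1 = w := fun w hw => by rw [hg w hw]
    let e : PartialEquiv (EigenvaluePair n) (Fin n → Fin n → ℂ) :=
      { toFun := fun v => v.1.1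
        invFun := g
        source := {v | v.1.1 ∈ U' ∧ v.1.2 ∈ V'}
        target := U'
        map_source' := fun v hv => hv.1
        map_target' := fun w hw => by
          rw [mem_ofPred_eq, hg w hw]; exact ⟨hw, (hU'U hw).2.2⟩
        left_inv' := fun v hv => by
          refine Subtype.ext ((hg _ hv.1).trans (Prod.ext rfl ((hiff _ hv.1 _ hv.2).1 v.2)))
        right_inv' := hg1 }
    have hso : IsOpen e.source :=
      (hU'o.preimage (continuous_fst.comp continuous_subtype_val)).inter
        (hV'o.preimage (continuous_snd.comp continuous_subtype_val))
    have hec : ContinuousOn e e.source :=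
      (continuous_fst.comp continuous_subtype_val).continuousOn
    exact ⟨{ e with
        open_source := hso
        open_target := hU'o
        continuousOn_toFun := hec
        continuousOn_invFun := hgc }, ⟨hwU', hμV'⟩, fun _ _ => rfl⟩

/-- Over a simply connected space, the eigenvalues of a continuous family of matrices with simple
spectra can be labelled continuously. -/
theorem exists_continuous_labelling {X : Type*} [TopologicalSpace X] [SimplyConnectedSpace X]
    [LocallyPathConnectedSpace X] {B : X → Matrix (Fin n) (Fin n) ℂ}
    (hB : ∀ i j, Continuous fun x => B x i j) (hd : ∀ x, HasDistinctEigenvalues (B x)) :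
    ∃ lam : X → Fin n → ℂ, (∀ j, Continuous fun x => lam x j) ∧
      ∀ x, IsEigenvalueLabelling (B x) (lam x) := by
  obtain ⟨a⟩ : Nonempty X := inferInstance
  obtain ⟨l, hinj, hl⟩ := (hd a).exists_labelling
  have hBc : Continuous fun x i j => B x i j := by fun_prop
  have hlift : ∀ j, ∃ F : X → ℂ, Continuous F ∧ F a = l j ∧ ∀ x, (B x).charpoly.IsRoot (F x) := by
    intro j
    obtain ⟨F, ⟨hF0, hF⟩, -⟩ := isCoveringMapOn_eigenvaluePair.existsUnique_continuousMap_lifts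
      (⟨_, hBc⟩ : C(X, Fin n → Fin n → ℂ)) (a₀ := a)
      (e₀ := ⟨(fun i k => B a i k, l j), (hl _).2 ⟨j, rfl⟩⟩) rfl (fun x => hd x)
    refine ⟨fun x => (F x).1.2, by fun_prop, by simp only [hF0], fun x => ?_⟩
    have h1 : (F x).1.1 = fun i k => B x i k := congrFun hF x
    have h2 := (F x).2
    rw [h1] at h2
    exact h2
  choose F hFc hFa hF using hlift
  have hinj' : ∀ x, Function.Injective fun j => F j x := by
    intro x i j hij
    by_contra hne
    -- Lifts that meet at `x` coincide everywhere by uniqueness, in particular at `a`, where they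
    -- start at distinct eigenvalues.
    have hval : ∀ y, F i y = F j y := by
      have hFi : Continuous fun y => (⟨(fun k m => B y k m, F i y), hF i y⟩ : EigenvaluePair n) :=
        Continuous.subtype_mk (by fun_prop) _
      have hFj : Continuous fun y => (⟨(fun k m => B y k m, F j y), hF j y⟩ : EigenvaluePair n) :=
        Continuous.subtype_mk (by fun_prop) _
      obtain ⟨G, -, hG⟩ := isCoveringMapOn_eigenvaluePair.existsUnique_continuousMap_lifts
        (⟨_, hBc⟩ : C(X, Fin n → Fin n → ℂ)) (a₀ := x)
        (e₀ := ⟨(fun k m => B x k m, F i x), hF i x⟩) rfl (fun x => hd x)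
      have e1 := hG ⟨_, hFi⟩ ⟨rfl, rfl⟩
      have e2 := hG ⟨_, hFj⟩ ⟨Subtype.ext (Prod.ext rfl (Eq.symm hij)), rfl⟩
      intro y
      have := congrArg (fun f : C(X, EigenvaluePair n) => (f y).1.2) (e1.trans e2.symm)
      exact this
    exact hne (hinj (by rw [← hFa, ← hFa, hval]))
  exact ⟨fun x j => F j x, hFc, fun x =>
    isEigenvalueLabelling_of_injective (by simp) (hinj' x) fun j => hF j x⟩

end Labelling

/-! ### Parallel transport and change of gauge -/

section Transport

open Set Filter Matrix

variable {n : ℕ}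

lemma contDiff_logDeriv_integral {G : ℝ → ℂ} (hG : ContDiff ℝ 1 G) (h0 : ∀ t, G t ≠ 0) :
    ∃ g : ℝ → ℂ, ContDiff ℝ 1 g ∧ (∀ t, deriv g t = deriv G t / G t) ∧ g 0 = 0 ∧
      ∀ t, G t = G 0 * Complex.exp (g t) := by
  have hc : Continuous fun t => deriv G t / G t :=
    (hG.continuous_deriv le_rfl).div hG.continuous h0
  have hd : ∀ t, HasDerivAt (fun t => ∫ τ in (0 : ℝ)..t, deriv G τ / G τ) (deriv G t / G t) t :=
    fun t => hc.integral_hasStrictDerivAt 0 t |>.hasDerivAt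
  have hG' : ∀ t, HasDerivAt G (deriv G t) t :=
    fun t => (hG.differentiable one_ne_zero t).hasDerivAt
  refine ⟨_, ?_, fun t => (hd t).deriv, by simp, fun t => ?_⟩
  · refine contDiff_one_iff_deriv.2 ⟨fun t => (hd t).differentiableAt, ?_⟩
    rw [show deriv (fun t => ∫ τ in (0 : ℝ)..t, deriv G τ / G τ) = fun t => deriv G t / G t from
      funext fun t => (hd t).deriv]
    exact hc
  · have hconst : ∀ t, HasDerivAt
        (fun t => G t * Complex.exp (-∫ τ in (0 : ℝ)..t, deriv G τ / G τ)) 0 t := by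
      intro t
      convert! (hG' t).mul (hd t).neg.cexp using 1
      field_simp [h0 t]
      ring
    have := is_const_of_deriv_eq_zero (fun t => (hconst t).differentiableAt)
      (fun t => (hconst t).deriv) t 0
    simp only [intervalIntegral.integral_same, neg_zero, Complex.exp_zero, mul_one] at this
    rw [← this, mul_assoc, ← Complex.exp_add, neg_add_cancel, Complex.exp_zero, mul_one]

/-- If the logarithmic derivative has a small imaginary part, the phase moves little. -/
lemma exists_phase_of_im_logDeriv_le {G : ℝ → ℂ} (hG : ContDiff ℝ 1 G) (h0 : ∀ t, G t ≠ 0)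
    {ε t : ℝ} (hε : ∀ τ ∈ uIcc 0 t, |(deriv G τ / G τ).im| ≤ ε) :
    ∃ R β : ℝ, 0 < R ∧ |β| ≤ ε * |t| ∧ G t = G 0 * (R * Complex.exp (Complex.I * β)) := by
  obtain ⟨g, hg, hgd, hg0, hexp⟩ := contDiff_logDeriv_integral hG h0
  refine ⟨Real.exp (g t).re, (g t).im, Real.exp_pos _, ?_, ?_⟩
  · have hd : ∀ τ ∈ uIcc 0 t, HasDerivWithinAt (fun τ => (g τ).im) (deriv g τ).im (uIcc 0 t) τ :=
      fun τ _ => (Complex.imCLM.hasFDerivAt.comp_hasDerivAt τ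
        (hg.differentiable one_ne_zero τ).hasDerivAt).hasDerivWithinAt
    have := (convex_uIcc 0 t).norm_image_sub_le_of_norm_hasDerivWithin_le hd
      (fun τ hτ => by rw [hgd]; exact hε τ hτ) left_mem_uIcc right_mem_uIcc
    simpa [hg0] using this
  · rw [hexp t, Complex.ofReal_exp, ← Complex.exp_add]
    congr 2
    conv_lhs => rw [← Complex.re_add_im (g t)]
    ring

lemma contDiff_det {ι : Type*} [Fintype ι] [DecidableEq ι] {W : ℝ → Matrix ι ι ℂ}
    (hW : ∀ i j, ContDiff ℝ 1 fun t => W t i j) : ContDiff ℝ 1 fun t => (W t).det :=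
  contDiff_iff_contDiffAt.2 fun _ => contDiffAt_det fun i j => (hW i j).contDiffAt

lemma contDiff_inv_apply {W : ℝ → Matrix (Fin n) (Fin n) ℂ}
    (hW : ∀ i j, ContDiff ℝ 1 fun t => W t i j) (hu : ∀ t, IsUnit (W t)) (i j : Fin n) :
    ContDiff ℝ 1 fun t => (W t)⁻¹ i j :=
  contDiff_iff_contDiffAt.2 fun t => contDiffAt_inv_apply (fun i j => (hW i j).contDiffAt) (hu t) i j

/-- The entrywise derivative of a curve of matrices. -/
noncomputable def matDeriv (V : ℝ → Matrix (Fin n) (Fin n) ℂ) (t : ℝ) :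
    Matrix (Fin n) (Fin n) ℂ :=
  Matrix.of fun i j => deriv (fun τ => V τ i j) t

lemma mul_transportMatrix {V : ℝ → Matrix (Fin n) (Fin n) ℂ} {t : ℝ} (hu : IsUnit (V t)) :
    V t * transportMatrix V t = matDeriv V t := by
  rw [transportMatrix, ← mul_assoc, mul_nonsing_inv _ ((isUnit_iff_isUnit_det _).1 hu), one_mul]
  rfl

lemma deriv_eq_sum_transport {V : ℝ → Matrix (Fin n) (Fin n) ℂ} {t : ℝ} (hu : IsUnit (V t))
    (i j : Fin n) :
    deriv (fun τ => V τ i j) t = ∑ l, V t i l * transportMatrix V t l j := by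
  rw [← mul_apply, mul_transportMatrix hu]; rfl

/-- Differentiating one column at a time replaces column `j` by `Σ P_lj v_l`, of which only the term
`l = j` contributes to the determinant. The transpose appears because the multilinear determinant
takes rows. -/
lemma logDeriv_det {V : ℝ → Matrix (Fin n) (Fin n) ℂ}
    (hV : ∀ i j, ContDiff ℝ 1 fun t => V t i j) {t : ℝ} (hu : IsUnit (V t)) :
    deriv (fun τ => (V τ).det) t / (V t).det = ∑ j, transportMatrix V t j j := by
  let f : ContinuousMultilinearMap ℝ (fun _ : Fin n => Fin n → ℂ) ℂ :=
    { (detRowAlternating (R := ℂ) (n := Fin n)).toMultilinearMap.restrictScalars ℝ with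
      cont := by
        change Continuous fun M : Fin n → Fin n → ℂ => (Matrix.of M).det
        exact Continuous.matrix_det (by fun_prop) }
  have hf : ∀ M : Fin n → Fin n → ℂ, f M = (Matrix.of M).det := fun _ => rfl
  have hrow : HasDerivAt (fun τ j i => V τ i j) (fun j i => deriv (fun τ => V τ i j) t) t :=
    hasDerivAt_pi.2 fun j => hasDerivAt_pi.2 fun i =>
      ((hV i j).differentiable one_ne_zero t).hasDerivAt
  have hd := (f.hasFDerivAt _).comp_hasDerivAt t hrow
  have heq : (f ∘ fun τ j i => V τ i j) = fun τ => (V τ).det := by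
    funext τ; simp only [Function.comp_apply, hf]; exact det_transpose (V τ)
  rw [heq] at hd
  have hdet : (V t).det ≠ 0 := ((isUnit_iff_isUnit_det _).1 hu).ne_zero
  rw [hd.deriv, div_eq_iff hdet, ContinuousMultilinearMap.linearDeriv_apply, Finset.sum_mul]
  refine Finset.sum_congr rfl fun j _ => ?_
  rw [hf]
  have : (fun i => deriv (fun τ => V τ i j) t) =
      ∑ l, transportMatrix V t l j • (V t)ᵀ l := by
    funext i
    rw [deriv_eq_sum_transport hu, Finset.sum_apply]
    exact Finset.sum_congr rfl fun l _ => mul_comm _ _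
  rw [this, ← det_transpose (V t)]
  exact det_updateRow_sum (V t)ᵀ j fun l => transportMatrix V t l j

variable {k : ℕ∞} {B V : ℝ → Matrix (Fin n) (Fin n) ℂ} {lam : ℝ → Fin n → ℂ}

namespace IsTransportedEigendecomposition

lemma contDiff_V_one (h : IsTransportedEigendecomposition k B V lam) (hk : 1 ≤ k) (i j : Fin n) :
    ContDiff ℝ 1 fun t => V t i j :=
  (h.contDiff_V i j).of_le (by exact_mod_cast hk)

/-- From `v_j' = Σ P_lj v_l`, the condition `realP` says exactly that `Re ⟨v_j, v_j'⟩ = 0`. -/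
lemma norm_colVec_eq (h : IsTransportedEigendecomposition k B V lam) (hk : 1 ≤ k) (j : Fin n)
    (s t : ℝ) : ‖colVec (V s) j‖ = ‖colVec (V t) j‖ := by
  let v' : ℝ → EuclideanSpace ℂ (Fin n) :=
    fun t => WithLp.toLp 2 fun i => deriv (fun τ => V τ i j) t
  have hd : ∀ t, HasDerivAt (fun τ => colVec (V τ) j) (v' t) t := by
    intro t
    have : HasDerivAt (fun τ i => V τ i j) (fun i => deriv (fun τ => V τ i j) t) t :=
      hasDerivAt_pi.2 fun i => ((h.contDiff_V_one hk i j).differentiable one_ne_zero t).hasDerivAt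
    exact ((PiLp.continuousLinearEquiv 2 ℝ fun _ : Fin n => ℂ).symm.hasFDerivAt.comp_hasDerivAt t
      this)
  have hsum : ∀ t, v' t = ∑ l, transportMatrix V t l j • colVec (V t) l := by
    intro t
    ext i
    simp only [v', deriv_eq_sum_transport (h.isUnit t), colVec, WithLp.ofLp_sum, WithLp.ofLp_smul,
      Finset.sum_apply, Pi.smul_apply, smul_eq_mul, mul_comm]
  have hre : ∀ t, (inner ℂ (colVec (V t) j) (v' t)).re = 0 := by
    intro t
    rw [hsum, inner_sum, Complex.re_sum, ← Finset.add_sum_erase _ _ (Finset.mem_univ j)]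
    have h1 := h.realP t j
    simp only [inner_smul_right]
    simp only [mul_comm (transportMatrix V t _ _)]
    linarith
  have hnorm : ∀ t, HasDerivAt (fun τ => ‖colVec (V τ) j‖ ^ 2) 0 t := by
    intro t
    have h1 := ((hd t).inner ℂ (hd t))
    have h2 := Complex.reCLM.hasFDerivAt.comp_hasDerivAt t h1
    convert! h2 using 1
    · funext τ
      simp [inner_self_eq_norm_sq_to_K, ← Complex.ofReal_pow]
    · have h3 : (inner ℂ (v' t) (colVec (V t) j)).re = 0 := by
        rw [← inner_conj_symm, Complex.conj_re]; exact hre t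
      simp [hre t, h3]
  have := is_const_of_deriv_eq_zero (fun t => (hnorm t).differentiableAt)
    (fun t => (hnorm t).deriv) s t
  exact (sq_eq_sq₀ (norm_nonneg _) (norm_nonneg _)).1 this

lemma eigenvector_eq_smul (h : IsTransportedEigendecomposition k B V lam) {t : ℝ}
    (hinj : Function.Injective (lam t)) {j : Fin n} {x : Fin n → ℂ}
    (hx : (B t).mulVec x = lam t j • x) : x = ((V t)⁻¹ *ᵥ x) j • fun i => V t i j := by
  have hu := (isUnit_iff_isUnit_det _).1 (h.isUnit t)
  have hc : ∀ i, i ≠ j → ((V t)⁻¹ *ᵥ x) i = 0 := by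
    intro i hi
    have h1 : (V t)⁻¹ *ᵥ (B t *ᵥ x) = diagonal (lam t) *ᵥ ((V t)⁻¹ *ᵥ x) := by
      rw [h.decomp t, mulVec_mulVec, mulVec_mulVec, ← mul_assoc, ← mul_assoc,
        nonsing_inv_mul _ hu, one_mul]
    rw [hx, mulVec_smul] at h1
    have h2 := congrFun h1 i
    rw [mulVec_diagonal, Pi.smul_apply, smul_eq_mul] at h2
    have h3 : (lam t i - lam t j) * ((V t)⁻¹ *ᵥ x) i = 0 := by linear_combination -h2
    exact (mul_eq_zero.1 h3).resolve_left (sub_ne_zero.2 fun e => hi (hinj e))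
  have h4 : x = V t *ᵥ ((V t)⁻¹ *ᵥ x) := by
    rw [mulVec_mulVec, mul_nonsing_inv _ hu, one_mulVec]
  conv_lhs => rw [h4]
  funext i
  rw [mulVec, dotProduct, Finset.sum_eq_single j (fun l _ hl => by rw [hc l hl, mul_zero]) (by simp)]
  simp [mul_comm]

lemma left_eigenvector_eq_smul (h : IsTransportedEigendecomposition k B V lam) {t : ℝ}
    (hinj : Function.Injective (lam t)) {j : Fin n} {y : Fin n → ℂ}
    (hy : (B t).vecMul y = lam t j • y) : y = (y ᵥ* V t) j • (V t)⁻¹ j := by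
  have hu := (isUnit_iff_isUnit_det _).1 (h.isUnit t)
  have hc : ∀ i, i ≠ j → (y ᵥ* V t) i = 0 := by
    intro i hi
    have h1 : (y ᵥ* B t) ᵥ* V t = (y ᵥ* V t) ᵥ* diagonal (lam t) := by
      rw [h.decomp t, vecMul_vecMul, vecMul_vecMul, mul_assoc, nonsing_inv_mul _ hu, mul_one]
    rw [hy, smul_vecMul] at h1
    have h2 := congrFun h1 i
    rw [vecMul_diagonal, Pi.smul_apply, smul_eq_mul] at h2
    have h3 : (lam t i - lam t j) * (y ᵥ* V t) i = 0 := by linear_combination -h2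
    exact (mul_eq_zero.1 h3).resolve_left (sub_ne_zero.2 fun e => hi (hinj e))
  have h4 : y = (y ᵥ* V t) ᵥ* (V t)⁻¹ := by
    rw [vecMul_vecMul, mul_nonsing_inv _ hu, vecMul_one]
  conv_lhs => rw [h4]
  funext i
  rw [vecMul, dotProduct, Finset.sum_eq_single j (fun l _ hl => by rw [hc l hl, zero_mul]) (by simp)]
  simp

/-- Comparison of a `C¹` eigenvector path `x` with the transported eigenvector. -/
theorem exists_gauge (h : IsTransportedEigendecomposition k B V lam) (hk : 1 ≤ k)
    (hinj : ∀ t, Function.Injective (lam t)) {j : Fin n} {x y : ℝ → Fin n → ℂ}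
    (hx : ContDiff ℝ 1 x) (hx0 : ∀ t, x t ≠ 0) (hy0 : ∀ t, y t ≠ 0)
    (hBx : ∀ t, (B t).mulVec (x t) = lam t j • x t)
    (hBy : ∀ t, (B t).vecMul (y t) = lam t j • y t) :
    ∃ z : ℝ → ℂ, ContDiff ℝ 1 z ∧ (∀ t, z t ≠ 0) ∧ (∀ t, x t = z t • fun i => V t i j) ∧
      (∀ t, y t ⬝ᵥ x t ≠ 0) ∧
      ∀ t, (deriv z t / z t).im = ((y t ⬝ᵥ deriv x t) / (y t ⬝ᵥ x t)).im := by
  have hV := h.contDiff_V_one hk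
  let z : ℝ → ℂ := fun t => ((V t)⁻¹ *ᵥ x t) j
  have hxz : ∀ t, x t = z t • fun i => V t i j := fun t => h.eigenvector_eq_smul (hinj t) (hBx t)
  have hz0 : ∀ t, z t ≠ 0 := fun t e => hx0 t (by rw [hxz, e, zero_smul])
  have hxi := contDiff_pi.1 hx
  have hz : ContDiff ℝ 1 z := by
    simp only [z, mulVec, dotProduct]
    exact ContDiff.sum fun i _ => (contDiff_inv_apply hV h.isUnit j i).mul (hxi i)
  have hyη : ∀ t, y t = (y t ᵥ* V t) j • (V t)⁻¹ j :=
    fun t => h.left_eigenvector_eq_smul (hinj t) (hBy t)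
  have hη0 : ∀ t, (y t ᵥ* V t) j ≠ 0 := fun t e => hy0 t (by rw [hyη, e, zero_smul])
  have hyv : ∀ t, (y t ⬝ᵥ fun i => V t i j) = (y t ᵥ* V t) j := fun t => rfl
  have hyx : ∀ t, y t ⬝ᵥ x t = z t * (y t ᵥ* V t) j := fun t => by
    rw [hxz, dotProduct_smul, hyv, smul_eq_mul]
  refine ⟨z, hz, hz0, hxz, fun t => by rw [hyx]; exact mul_ne_zero (hz0 t) (hη0 t), fun t => ?_⟩
  have hderiv : deriv x t = (deriv z t • fun i => V t i j) +
      z t • fun i => deriv (fun τ => V τ i j) t := by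
    have hd : HasDerivAt (fun τ => z τ • fun i => V τ i j) _ t :=
      (hz.differentiable one_ne_zero t).hasDerivAt.smul
        (hasDerivAt_pi.2 fun i => ((hV i j).differentiable one_ne_zero t).hasDerivAt)
    rw [show x = fun τ => z τ • fun i => V τ i j from funext hxz, hd.deriv, add_comm]
  -- `y` is a multiple of row `j` of `V⁻¹`, which pairs with the derivative of column `j` to `P_jj`.
  -- Dividing by `y ⬝ x` cancels the multiple, so `y` need not be differentiable.
  have hyv' : (y t ⬝ᵥ fun i => deriv (fun τ => V τ i j) t) =
      (y t ᵥ* V t) j * transportMatrix V t j j := by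
    conv_lhs => rw [hyη t]
    rw [smul_dotProduct, smul_eq_mul]
    rfl
  rw [hderiv, dotProduct_add, dotProduct_smul, dotProduct_smul, hyv, hyv', hyx]
  have h1 : (deriv z t • (y t ᵥ* V t) j + z t • ((y t ᵥ* V t) j * transportMatrix V t j j)) /
      (z t * (y t ᵥ* V t) j) = deriv z t / z t + transportMatrix V t j j := by
    have := hz0 t
    have := hη0 t
    simp only [smul_eq_mul]
    field_simp
  rw [h1, Complex.add_im, h.imgP, add_zero]

lemma mulVec_col (h : IsTransportedEigendecomposition k B V lam) (t : ℝ) (j : Fin n) :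
    (B t).mulVec (fun i => V t i j) = lam t j • fun i => V t i j := by
  have hu := (isUnit_iff_isUnit_det _).1 (h.isUnit t)
  have h1 : B t * V t = V t * diagonal (lam t) := by
    rw [h.decomp t, mul_assoc, nonsing_inv_mul _ hu, mul_one]
  funext i
  have := congrFun (congrFun h1 i) j
  rw [mul_diagonal, mul_comm] at this
  exact this

lemma vecMul_row (h : IsTransportedEigendecomposition k B V lam) (t : ℝ) (j : Fin n) :
    (B t).vecMul ((V t)⁻¹ j) = lam t j • (V t)⁻¹ j := by
  have hu := (isUnit_iff_isUnit_det _).1 (h.isUnit t)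
  have h1 : (V t)⁻¹ * B t = diagonal (lam t) * (V t)⁻¹ := by
    rw [h.decomp t, ← mul_assoc, ← mul_assoc, nonsing_inv_mul _ hu, one_mul]
  funext i
  have := congrFun (congrFun h1 j) i
  rw [diagonal_mul] at this
  exact this

lemma col_ne_zero (h : IsTransportedEigendecomposition k B V lam) (t : ℝ) (j : Fin n) :
    (fun i => V t i j) ≠ 0 := by
  have hu := (isUnit_iff_isUnit_det _).1 (h.isUnit t)
  intro e
  have := congrFun (congrFun (nonsing_inv_mul _ hu) j) j
  rw [mul_apply] at this
  simp [congrFun e] at this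

lemma row_ne_zero (h : IsTransportedEigendecomposition k B V lam) (t : ℝ) (j : Fin n) :
    (V t)⁻¹ j ≠ 0 := by
  have hu := (isUnit_iff_isUnit_det _).1 (h.isUnit t)
  intro e
  have := congrFun (congrFun (nonsing_inv_mul _ hu) j) j
  rw [mul_apply] at this
  simp [congrFun e] at this

lemma colVec_norm_pos (h : IsTransportedEigendecomposition k B V lam) (t : ℝ) (j : Fin n) :
    0 < ‖colVec (V t) j‖ :=
  norm_pos_iff.2 fun e => h.col_ne_zero t j (congrArg WithLp.ofLp e)

end IsTransportedEigendecomposition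

end Transport

/-! ### Constant phases along a closed loop and their sum -/

section Phases

open Set Filter Matrix

variable {n : ℕ}

lemma inv_mul_eq_swapPhaseMatrix_iff {V W : Matrix (Fin n) (Fin n) ℂ} (hV : IsUnit V)
    {p q : Fin n} {α : Fin n → ℝ} :
    V⁻¹ * W = swapPhaseMatrix p q α ↔
      ∀ j, (fun i => W i j) =
        Complex.exp (Complex.I * (α j : ℂ)) • fun i => V i (Equiv.swap p q j) := by
  have hu := (isUnit_iff_isUnit_det _).1 hV
  have hmul : ∀ i j, (V * swapPhaseMatrix p q α) i j =
      Complex.exp (Complex.I * (α j : ℂ)) * V i (Equiv.swap p q j) := by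
    intro i j
    simp [mul_apply, swapPhaseMatrix, mul_comm]
  have h1 : V⁻¹ * W = swapPhaseMatrix p q α ↔ W = V * swapPhaseMatrix p q α := by
    constructor
    · rintro h
      rw [← h, ← mul_assoc, mul_nonsing_inv _ hu, one_mul]
    · rintro rfl
      rw [← mul_assoc, nonsing_inv_mul _ hu, one_mul]
  rw [h1]
  constructor
  · rintro rfl j
    funext i
    exact hmul i j
  · intro h
    ext i j
    rw [hmul]
    exact congrFun (h j) i

lemma det_swapPhaseMatrix {p q : Fin n} (hpq : p ≠ q) (α : Fin n → ℝ) :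
    (swapPhaseMatrix p q α).det = -Complex.exp (Complex.I * ((∑ j, α j : ℝ) : ℂ)) := by
  have h1 : swapPhaseMatrix p q α =
      (diagonal fun j => Complex.exp (Complex.I * (α j : ℂ))).submatrix (Equiv.swap p q) id := by
    ext i j
    by_cases h : i = Equiv.swap p q j
    · subst h
      simp [swapPhaseMatrix]
    · have h' : Equiv.swap p q i ≠ j := fun e => h (by rw [← e, Equiv.swap_apply_self])
      simp [swapPhaseMatrix, h, h']
  rw [h1, det_permute, Equiv.Perm.sign_swap hpq, det_diagonal, ← Complex.exp_sum]
  simp [Finset.mul_sum]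

lemma exists_real_exp_of_norm_eq_one {z : ℂ} (h : ‖z‖ = 1) :
    ∃ a : ℝ, z = Complex.exp (Complex.I * a) := by
  refine ⟨z.arg, ?_⟩
  conv_lhs => rw [← Complex.norm_mul_exp_arg_mul_I z, h, Complex.ofReal_one, one_mul, mul_comm]

lemma norm_colVec_of_col_eq_smul {V W : Matrix (Fin n) (Fin n) ℂ} {j l : Fin n} {c : ℂ}
    (h : (fun i => W i j) = c • fun i => V i l) : ‖colVec W j‖ = ‖c‖ * ‖colVec V l‖ := by
  have : colVec W j = c • colVec V l := congrArg (WithLp.toLp 2) h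
  rw [this, norm_smul]

variable {k : ℕ∞} {B V : ℝ → Matrix (Fin n) (Fin n) ℂ} {lam : ℝ → Fin n → ℂ}

namespace IsTransportedEigendecomposition

/-- Along a closed loop, the transported eigenvectors return up to constant factors. -/
lemma exists_constant_phase (h : IsTransportedEigendecomposition k B V lam) (hk : 1 ≤ k)
    (hinj : ∀ t, Function.Injective (lam t)) (hB : ∀ t, B (t + 1) = B t) {j l : Fin n}
    (hlam : ∀ t, lam (t + 1) j = lam t l) (hnorm : ‖colVec (V 0) j‖ = ‖colVec (V 0) l‖) :
    ∃ a : ℝ, ∀ t, (fun i => V (t + 1) i j) =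
      Complex.exp (Complex.I * (a : ℂ)) • fun i => V t i l := by
  have hV := h.contDiff_V_one hk
  -- Take the column and the inverse row one period later as eigenvectors: their pairing is `1` and
  -- the pairing with the derivative is `P_jj(t + 1)`, which is real, so `z` has constant argument.
  obtain ⟨z, hz, hz0, hxz, -, him⟩ := h.exists_gauge hk hinj (j := l)
    (x := fun t i => V (t + 1) i j) (y := fun t => (V (t + 1))⁻¹ j)
    (contDiff_pi.2 fun i => (hV i j).comp (contDiff_id.add contDiff_const))
    (fun t => h.col_ne_zero (t + 1) j) (fun t => h.row_ne_zero (t + 1) j)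
    (fun t => by rw [← hB, ← hlam]; exact h.mulVec_col (t + 1) j)
    (fun t => by rw [← hB, ← hlam]; exact h.vecMul_row (t + 1) j)
  have hz1 : ∀ t, ‖z t‖ = 1 := by
    intro t
    have h1 := norm_colVec_of_col_eq_smul (hxz t)
    rw [h.norm_colVec_eq hk j (t + 1) 0, h.norm_colVec_eq hk l t 0, hnorm] at h1
    exact (mul_right_cancel₀ (h.colVec_norm_pos 0 l).ne' ((one_mul _).trans h1)).symm
  have him0 : ∀ t, (deriv z t / z t).im = 0 := by
    intro t
    have hu := (isUnit_iff_isUnit_det _).1 (h.isUnit (t + 1))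
    have h1 : ((V (t + 1))⁻¹ j ⬝ᵥ fun i => V (t + 1) i j) = 1 := by
      have := congrFun (congrFun (nonsing_inv_mul _ hu) j) j
      rw [one_apply_eq] at this
      exact this
    have h2 : deriv (fun t i => V (t + 1) i j) t =
        fun i => deriv (fun τ => V τ i j) (t + 1) := by
      refine HasDerivAt.deriv (hasDerivAt_pi.2 fun i => ?_)
      exact HasDerivAt.comp_add_const t 1 ((hV i j).differentiable one_ne_zero (t + 1)).hasDerivAt
    rw [him, h1, h2, div_one]
    exact h.imgP (t + 1) j
  have hconst : ∀ t, z t = z 0 := by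
    intro t
    obtain ⟨R, β, hR, hβ, e⟩ := exists_phase_of_im_logDeriv_le hz hz0 (ε := 0) (t := t)
      (fun τ _ => by rw [him0, abs_zero])
    rw [zero_mul] at hβ
    have hβ0 : β = 0 := abs_nonpos_iff.1 hβ
    have h2 := congrArg norm e
    rw [hβ0, hz1, norm_mul, hz1] at h2
    simp [abs_of_pos hR] at h2
    rw [e, hβ0, ← h2]
    simp
  obtain ⟨a, ha⟩ := exists_real_exp_of_norm_eq_one (hz1 0)
  exact ⟨a, fun t => by rw [← ha, ← hconst t]; exact hxz t⟩

/-- The logarithmic derivative of `det V` is `tr P`, which is real, so `det V(1) / det V(0)` is a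
positive number. It is also the determinant of the swap matrix, `-exp (i Σ α_j)`, hence equals `1`.
-/
lemma sum_phases (h : IsTransportedEigendecomposition k B V lam) (hk : 1 ≤ k) {p q : Fin n}
    (hpq : p ≠ q) {α : Fin n → ℝ} (hα : (V 0)⁻¹ * V (0 + 1) = swapPhaseMatrix p q α) :
    ∃ m : ℤ, ∑ j, α j = Real.pi + m * (2 * Real.pi) := by
  have hV := h.contDiff_V_one hk
  have hdet : ∀ t, (V t).det ≠ 0 := fun t => ((isUnit_iff_isUnit_det _).1 (h.isUnit t)).ne_zero
  obtain ⟨R, β, hR, hβ, e⟩ := exists_phase_of_im_logDeriv_le (contDiff_det hV) hdet (ε := 0)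
    (t := 1) (fun τ _ => by
      rw [logDeriv_det hV (h.isUnit τ), Complex.im_sum]
      simp [h.imgP])
  rw [zero_mul] at hβ
  have hβ0 : β = 0 := abs_nonpos_iff.1 hβ
  have hu := (isUnit_iff_isUnit_det _).1 (h.isUnit 0)
  have h1 : V 1 = V 0 * swapPhaseMatrix p q α := by
    rw [← hα, ← mul_assoc, mul_nonsing_inv _ hu, one_mul, zero_add]
  rw [h1, det_mul] at e
  have h2 := mul_left_cancel₀ (hdet 0) e
  rw [hβ0, det_swapPhaseMatrix hpq] at h2
  have hR1 : R = 1 := by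
    have := congrArg norm h2
    rw [norm_neg, mul_comm Complex.I, Complex.norm_exp_ofReal_mul_I] at this
    simpa [abs_of_pos hR] using this.symm
  rw [hR1] at h2
  have h3 : Complex.exp (Complex.I * ((∑ j, α j : ℝ) : ℂ)) =
      Complex.exp (Real.pi * Complex.I) := by
    rw [Complex.exp_pi_mul_I, ← neg_eq_iff_eq_neg, h2]; simp
  obtain ⟨m, hm⟩ := Complex.exp_eq_exp_iff_exists_int.1 h3
  refine ⟨m, ?_⟩
  have h4 : Complex.I * ((∑ j, α j : ℝ) : ℂ) =
      Complex.I * ((Real.pi + m * (2 * Real.pi) : ℝ) : ℂ) := by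
    rw [hm]; push_cast; ring
  exact_mod_cast mul_left_cancel₀ Complex.I_ne_zero h4

theorem exists_phases (h : IsTransportedEigendecomposition k B V lam) (hk : 1 ≤ k)
    (hinj : ∀ t, Function.Injective (lam t)) (hB : ∀ t, B (t + 1) = B t) {p q : Fin n}
    (hpq : p ≠ q) (hlam : ∀ t j, lam (t + 1) j = lam t (Equiv.swap p q j))
    (hnorm : ‖colVec (V 0) p‖ = ‖colVec (V 0) q‖) :
    ∃ α : Fin n → ℝ, (∀ t, (V t)⁻¹ * V (t + 1) = swapPhaseMatrix p q α) ∧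
      ∃ m : ℤ, ∑ j, α j = Real.pi + m * (2 * Real.pi) := by
  have hn : ∀ j, ‖colVec (V 0) j‖ = ‖colVec (V 0) (Equiv.swap p q j)‖ := by
    intro j
    by_cases hjp : j = p
    · rw [hjp, Equiv.swap_apply_left, hnorm]
    by_cases hjq : j = q
    · rw [hjq, Equiv.swap_apply_right, hnorm]
    rw [Equiv.swap_apply_of_ne_of_ne hjp hjq]
  choose α hα using fun j => h.exists_constant_phase hk hinj hB (fun t => hlam t j) (hn j)
  have hS : ∀ t, (V t)⁻¹ * V (t + 1) = swapPhaseMatrix p q α :=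
    fun t => (inv_mul_eq_swapPhaseMatrix_iff (h.isUnit t)).2 fun j => hα j t
  exact ⟨α, hS, h.sum_phases hk hpq (hS 0)⟩

end IsTransportedEigendecomposition

end Phases

/-! ### Block splitting near a generic cuspidal point -/

section CuspFrame

open Set Filter Matrix

variable {n : ℕ}

/-- A `C¹` splitting of `A` near a generic cuspidal point `ξ₀`: `T` and `S` are right and left
frames of the degenerating pair of eigenvalues, `E` is the corresponding `2 × 2` block with
nonzero upper right entry, and `l` lists the other eigenvalues at `ξ₀`. -/
structure IsCuspFrame (A : Plane → Matrix (Fin n) (Fin n) ℂ) (ξ₀ : Plane) {m : ℕ}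
    (T : Plane → Matrix (Fin n) (Fin 2) ℂ) (S : Plane → Matrix (Fin 2) (Fin n) ℂ)
    (E : Plane → Matrix (Fin 2) (Fin 2) ℂ) (L : Plane ≃L[ℝ] ℂ) (l : Fin m → ℂ) : Prop where
  card_eq : 2 + m = n
  contDiffAt_A : ∀ i j, ContDiffAt ℝ 1 (fun ξ => A ξ i j) ξ₀
  contDiffAt_T : ∀ i j, ContDiffAt ℝ 1 (fun ξ => T ξ i j) ξ₀
  contDiffAt_S : ∀ i j, ContDiffAt ℝ 1 (fun ξ => S ξ i j) ξ₀
  contDiffAt_E : ∀ i j, ContDiffAt ℝ 1 (fun ξ => E ξ i j) ξ₀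
  split : ∀ᶠ ξ in 𝓝 ξ₀, S ξ * T ξ = 1 ∧ A ξ * T ξ = T ξ * E ξ ∧ S ξ * A ξ = E ξ * S ξ
  upper_ne_zero : E ξ₀ 0 1 ≠ 0
  disc_eq_zero : disc2 (E ξ₀) = 0
  hasFDerivAt : HasFDerivAt (fun ξ => disc2 (E ξ)) (L : Plane →L[ℝ] ℂ) ξ₀
  injective : Function.Injective l
  isRoot : ∀ i, (A ξ₀).charpoly.IsRoot (l i)
  derivative_ne_zero : ∀ i, (A ξ₀).charpoly.derivative.eval (l i) ≠ 0
  ne_trace : ∀ i, l i ≠ (E ξ₀ 0 0 + E ξ₀ 1 1) / 2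

lemma rectangle_mem_nhds {a b ξ₀ : Plane} (h : ∀ i, ξ₀ i ∈ Ioo (a i) (b i)) :
    rectangle a b ∈ 𝓝 ξ₀ := by
  have : ∀ i, ∀ᶠ ξ : Plane in 𝓝 ξ₀, ξ i ∈ Icc (a i) (b i) := fun i => by
    have hc : ContinuousAt (fun ξ : Plane => ξ i) ξ₀ := by fun_prop
    exact hc.eventually_mem (Icc_mem_nhds (h i).1 (h i).2)
  exact eventually_all.2 this

lemma MatContDiffOn.contDiffAt {m : ℕ} {k : ℕ∞} (hk : 1 ≤ k)
    {A : Plane → Matrix (Fin n) (Fin m) ℂ} {s : Set Plane} (hA : MatContDiffOn k A s) {ξ : Plane}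
    (hs : s ∈ 𝓝 ξ) (i : Fin n) (j : Fin m) : ContDiffAt ℝ 1 (fun ξ => A ξ i j) ξ :=
  ((hA i j).contDiffAt hs).of_le (by exact_mod_cast hk)

lemma contDiffAt_mul_apply {E : Type*} [NormedAddCommGroup E] [NormedSpace ℝ E] {ι κ τ : Type*}
    [Fintype κ] {M : E → Matrix ι κ ℂ} {N : E → Matrix κ τ ℂ} {x : E}
    (hM : ∀ i j, ContDiffAt ℝ 1 (fun ξ => M ξ i j) x)
    (hN : ∀ i j, ContDiffAt ℝ 1 (fun ξ => N ξ i j) x) (i : ι) (j : τ) :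
    ContDiffAt ℝ 1 (fun ξ => (M ξ * N ξ) i j) x := by
  simp only [mul_apply]
  exact ContDiffAt.sum fun l _ => (hM i l).mul (hN l j)

/-- The plane, as the complex plane. -/
noncomputable def planeEquivComplex : Plane ≃L[ℝ] ℂ :=
  Complex.orthonormalBasisOneI.repr.symm.toContinuousLinearEquiv

lemma planeEquivComplex_discMap (E : Plane → Matrix (Fin 2) (Fin 2) ℂ) (ξ : Plane) :
    planeEquivComplex (discMap E ξ) = disc2 (E ξ) := by
  have : planeEquivComplex (discMap E ξ) =
      Complex.orthonormalBasisOneI.repr.symm (discMap E ξ) := rfl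
  rw [this, ← Complex.orthonormalBasisOneI.sum_repr_symm]
  simp only [Fin.sum_univ_two, Complex.coe_orthonormalBasisOneI, discMap]
  apply Complex.ext <;> simp

lemma IsGCPTwo.hasFDerivAt {E : Plane → Matrix (Fin 2) (Fin 2) ℂ} {ξ₀ : Plane}
    (h : IsGCPTwo E ξ₀) : disc2 (E ξ₀) = 0 ∧ ∃ L : Plane ≃L[ℝ] ℂ,
      HasFDerivAt (fun ξ => disc2 (E ξ)) (L : Plane →L[ℝ] ℂ) ξ₀ := by
  obtain ⟨h0, M, hM⟩ := h
  refine ⟨by rw [← planeEquivComplex_discMap, h0, map_zero], M.trans planeEquivComplex, ?_⟩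
  -- Without differentiability `fderiv` takes its default value `0`, which is not injective on the
  -- plane.
  have hd : DifferentiableAt ℝ (discMap E) ξ₀ := by
    by_contra hnd
    rw [fderiv_zero_of_not_differentiableAt hnd] at hM
    obtain ⟨x, hx⟩ := exists_ne (0 : Plane)
    exact hx (M.injective (by
      rw [map_zero]
      exact congrArg (fun f : Plane →L[ℝ] Plane => f x) hM))
  have h1 := hd.hasFDerivAt
  rw [← hM] at h1
  have h2 := planeEquivComplex.hasFDerivAt.comp ξ₀ h1
  have h3 : (planeEquivComplex ∘ discMap E) = fun ξ => disc2 (E ξ) :=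
    funext fun ξ => planeEquivComplex_discMap E ξ
  rw [h3] at h2
  exact h2

lemma eval_charpoly_two (M : Matrix (Fin 2) (Fin 2) ℂ) (z : ℂ) :
    M.charpoly.eval z = (z - (M 0 0 + M 1 1) / 2) ^ 2 - disc2 M / 4 := by
  rw [eval_charpoly, det_fin_two]
  simp [disc2]
  ring

/-- If `b = c = 0` at `ξ₀`, then `Δ = 0` forces `a = d`, so every term of `dΔ = 2 (a - d) d(a - d) +
4 (b dc + c db)` vanishes there, against invertibility. -/
lemma upper_or_lower_ne_zero {E : Plane → Matrix (Fin 2) (Fin 2) ℂ} {ξ₀ : Plane}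
    (hE : ∀ i j, ContDiffAt ℝ 1 (fun ξ => E ξ i j) ξ₀) (h0 : disc2 (E ξ₀) = 0)
    {L : Plane ≃L[ℝ] ℂ} (hL : HasFDerivAt (fun ξ => disc2 (E ξ)) (L : Plane →L[ℝ] ℂ) ξ₀) :
    E ξ₀ 0 1 ≠ 0 ∨ E ξ₀ 1 0 ≠ 0 := by
  by_contra! hcon
  obtain ⟨hb, hc⟩ := hcon
  have had : E ξ₀ 0 0 - E ξ₀ 1 1 = 0 := by
    simpa [disc2, hb, hc] using h0
  have hd := fun i j => ((hE i j).differentiableAt one_ne_zero).hasFDerivAt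
  have h1 := (((hd 0 0).sub (hd 1 1)).pow 2).add (((hd 0 1).const_mul 4).mul (hd 1 0))
  have h2 := hL.unique h1
  obtain ⟨x, hx⟩ := exists_ne (0 : Plane)
  refine hx (L.injective ?_)
  rw [map_zero]
  have h3 := congrArg (fun f : Plane →L[ℝ] ℂ => f x) h2
  simpa [had, hb, hc] using h3

lemma IsGCP.exists_cuspFrame {k : ℕ∞} (hk : 1 ≤ k) {A : Plane → Matrix (Fin n) (Fin n) ℂ}
    {Ω : Set Plane} {ξ₀ : Plane} (hΩ : IsOpen Ω) (hξ₀ : ξ₀ ∈ Ω) (hA : MatContDiffOn k A Ω)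
    (h : IsGCP k A Ω ξ₀) :
    ∃ (m : ℕ) (T : Plane → Matrix (Fin n) (Fin 2) ℂ) (S : Plane → Matrix (Fin 2) (Fin n) ℂ)
      (E : Plane → Matrix (Fin 2) (Fin 2) ℂ) (L : Plane ≃L[ℝ] ℂ) (l : Fin m → ℂ),
      IsCuspFrame A ξ₀ T S E L l := by
  obtain ⟨a, b, hab, -, m, e, T', E₁, E₂, hT', hR, hgcp⟩ := h
  have hnhds := rectangle_mem_nhds hab
  obtain ⟨hdisc, L, hL⟩ := hgcp.hasFDerivAt
  have hA1 : ∀ i j, ContDiffAt ℝ 1 (fun ξ => A ξ i j) ξ₀ := hA.contDiffAt hk (hΩ.mem_nhds hξ₀)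
  have hT1 : ∀ i j, ContDiffAt ℝ 1 (fun ξ => T' ξ i j) ξ₀ := hT'.contDiffAt hk hnhds
  have hmem := mem_of_mem_nhds hnhds
  have hI1 := contDiffAt_inv_apply hT1 (hR ξ₀ hmem).1
  set T : Plane → Matrix (Fin n) (Fin 2) ℂ := fun ξ => (T' ξ).submatrix id fun c => e (.inl c)
    with hTdef
  set S : Plane → Matrix (Fin 2) (Fin n) ℂ := fun ξ => (T' ξ)⁻¹.submatrix (fun c => e (.inl c)) id
    with hSdef
  have hsplit : ∀ ξ ∈ rectangle a b,
      S ξ * T ξ = 1 ∧ A ξ * T ξ = T ξ * E₁ ξ ∧ S ξ * A ξ = E₁ ξ * S ξ := by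
    intro ξ hξ
    obtain ⟨hu, hAT, -, -⟩ := hR ξ hξ
    have hu' := (isUnit_iff_isUnit_det _).1 hu
    have hTA : (T' ξ)⁻¹ * A ξ = reindex e e (fromBlocks (E₁ ξ) 0 0 (E₂ ξ)) * (T' ξ)⁻¹ := by
      calc (T' ξ)⁻¹ * A ξ = (T' ξ)⁻¹ * (A ξ * T' ξ) * (T' ξ)⁻¹ := by
            rw [mul_assoc, mul_assoc, mul_nonsing_inv _ hu', mul_one]
        _ = _ := by rw [hAT, ← mul_assoc, nonsing_inv_mul _ hu', one_mul]
    refine ⟨?_, ?_, ?_⟩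
    · ext c d
      have := congrFun (congrFun (nonsing_inv_mul _ hu') (e (.inl c))) (e (.inl d))
      rw [one_apply] at this
      rw [one_apply, show (S ξ * T ξ) c d = _ from this]
      simp
    · ext i c
      have := congrFun (congrFun hAT i) (e (.inl c))
      rw [show (A ξ * T ξ) i c = (A ξ * T' ξ) i (e (.inl c)) from rfl, this, mul_apply,
        ← e.sum_comp, Fintype.sum_sum_type]
      simp [mul_apply, T]
    · ext c i
      have := congrFun (congrFun hTA (e (.inl c))) i
      rw [show (S ξ * A ξ) c i = ((T' ξ)⁻¹ * A ξ) (e (.inl c)) i from rfl, this, mul_apply,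
        ← e.sum_comp, Fintype.sum_sum_type]
      simp [mul_apply, S]
  have hTc : ∀ i j, ContDiffAt ℝ 1 (fun ξ => T ξ i j) ξ₀ := fun i j => hT1 i _
  have hSc : ∀ i j, ContDiffAt ℝ 1 (fun ξ => S ξ i j) ξ₀ := fun i j => hI1 _ j
  -- No regularity of the block is assumed; it is inherited through `E₁ = S A T`.
  have hEc : ∀ i j, ContDiffAt ℝ 1 (fun ξ => E₁ ξ i j) ξ₀ := by
    intro i j
    refine (contDiffAt_mul_apply hSc (contDiffAt_mul_apply hA1 hTc) i j).congr_of_eventuallyEq ?_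
    filter_upwards [hnhds] with ξ hξ
    obtain ⟨h1, h2, -⟩ := hsplit ξ hξ
    rw [h2, ← Matrix.mul_assoc, h1, one_mul]
  have hchar : (A ξ₀).charpoly = (E₁ ξ₀).charpoly * (E₂ ξ₀).charpoly := by
    obtain ⟨⟨U, hU⟩, hAT, -, -⟩ := hR ξ₀ hmem
    rw [← hU] at hAT
    rw [← charpoly_fromBlocks_zero₁₂ (M₂₁ := 0), ← charpoly_reindex e, 
      ← charpoly_units_conj U (reindex e e _), ← hAT, mul_assoc, mul_nonsing_inv _ ((isUnit_iff_isUnit_det _).1 U.isUnit), mul_one]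
  obtain ⟨-, -, hdisj, hdist⟩ := hR ξ₀ hmem
  obtain ⟨l, hlinj, hl⟩ := hdist.exists_labelling
  have hl2 : ∀ i, (E₂ ξ₀).charpoly.eval (l i) = 0 := fun i => (hl _).2 ⟨i, rfl⟩
  have hl1 : ∀ i, (E₁ ξ₀).charpoly.eval (l i) ≠ 0 := by
    intro i hi
    exact Set.disjoint_left.1 hdisj (mem_spectrum_iff_isRoot_charpoly.2 hi)
      (mem_spectrum_iff_isRoot_charpoly.2 (hl2 i))
  have hroot : ∀ i, (A ξ₀).charpoly.IsRoot (l i) := fun i => by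
    rw [hchar, Polynomial.IsRoot, Polynomial.eval_mul, hl2, mul_zero]
  have hder : ∀ i, (A ξ₀).charpoly.derivative.eval (l i) ≠ 0 := fun i => by
    rw [hchar, Polynomial.derivative_mul, Polynomial.eval_add, Polynomial.eval_mul,
      Polynomial.eval_mul, hl2, mul_zero, zero_add]
    exact mul_ne_zero (hl1 i) (hdist.derivative_eval_ne_zero (hl2 i))
  have hne : ∀ i, l i ≠ (E₁ ξ₀ 0 0 + E₁ ξ₀ 1 1) / 2 := fun i hi => hl1 i (by
    rw [eval_charpoly_two, hdisc, hi]; ring)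
  have hcard : 2 + m = n := by simpa using Fintype.card_congr e
  rcases upper_or_lower_ne_zero hEc hdisc hL with hb | hc
  · exact ⟨m, T, S, E₁, L, l, hcard, hA1, hTc, hSc, hEc, by filter_upwards [hnhds] using hsplit,
      hb, hdisc, hL, hlinj, hroot, hder, hne⟩
  -- If only the lower left entry is known to be nonzero, exchanging the two basis vectors moves it
  -- to the upper right and preserves the discriminant.
  · let w : Equiv.Perm (Fin 2) := Equiv.swap 0 1
    have hd : ∀ ξ, disc2 ((E₁ ξ).submatrix w w) = disc2 (E₁ ξ) := fun ξ => by
      simp [disc2, w]; ring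
    refine ⟨m, fun ξ => (T ξ).submatrix id w, fun ξ => (S ξ).submatrix w id,
      fun ξ => (E₁ ξ).submatrix w w, L, l, hcard, hA1, fun i j => hTc i _, fun i j => hSc _ j,
      fun i j => hEc _ _, ?_, by simpa [w] using hc, by rw [hd, hdisc], by simpa only [hd] using hL,
      hlinj, hroot, hder, fun i => ?_⟩
    · filter_upwards [hnhds] with ξ hξ
      obtain ⟨h1, h2, h3⟩ := hsplit ξ hξ
      refine ⟨?_, ?_, ?_⟩
      · have := congrArg (fun M => M.submatrix w w) h1
        simpa [submatrix_mul_equiv, ← submatrix_mul _ _ w id w Function.bijective_id] using this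
      · have := congrArg (fun M => M.submatrix id w) h2
        simpa [submatrix_mul _ _ id id w Function.bijective_id,
          submatrix_mul _ _ id w w w.bijective] using this
      · have := congrArg (fun M => M.submatrix w id) h3
        simpa [submatrix_mul _ _ w id id Function.bijective_id,
          submatrix_mul _ _ w w id w.bijective] using this
    · have := hne i
      rw [add_comm] at this
      simpa [w] using this

end CuspFrame

/-! ### Small loops and the square root of the discriminant -/

section SmallLoops

open Set Filter

variable {n : ℕ} {γ : ℝ → Plane} {ξ₀ : Plane}

namespace IsSmoothJordanCurve

lemma exists_bound (hγ : IsSmoothJordanCurve γ) (ξ₀ : Plane) :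
    ∃ M > 0, (∀ t, ‖γ t - ξ₀‖ ≤ M) ∧ ∀ t ∈ Icc (0 : ℝ) 1, ‖deriv γ t‖ ≤ M := by
  have hc := hγ.contDiff.continuous
  obtain ⟨M₁, hM₁⟩ := (isCompact_Icc (a := (0 : ℝ)) (b := 1)).exists_bound_of_continuousOn
    (f := fun t => γ t - ξ₀) (by fun_prop)
  obtain ⟨M₂, hM₂⟩ := (isCompact_Icc (a := (0 : ℝ)) (b := 1)).exists_bound_of_continuousOn
    (hγ.contDiff.continuous_deriv le_rfl).continuousOn
  refine ⟨max 1 (max M₁ M₂), by positivity, fun t => ?_, fun t ht =>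
    (hM₂ t ht).trans ((le_max_right _ _).trans (le_max_right _ _))⟩
  have hp : Function.Periodic γ 1 := hγ.periodic
  have h1 : γ (Int.fract t) = γ t := by rw [Int.fract]; simpa using hp.sub_zsmul_eq ⌊t⌋ (x := t)
  rw [← h1]
  exact (hM₁ _ ⟨Int.fract_nonneg t, (Int.fract_lt_one t).le⟩).trans
    ((le_max_left _ _).trans (le_max_right _ _))

lemma contDiff_shrink (hγ : IsSmoothJordanCurve γ) (ξ₀ : Plane) (s : ℝ) :
    ContDiff ℝ 1 (shrink ξ₀ γ s) :=
  contDiff_const.add ((hγ.contDiff.sub contDiff_const).const_smul s)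

lemma hasDerivAt_shrink (hγ : IsSmoothJordanCurve γ) (ξ₀ : Plane) (s t : ℝ) :
    HasDerivAt (shrink ξ₀ γ s) (s • deriv γ t) t :=
  (((hγ.contDiff.differentiable one_ne_zero t).hasDerivAt.sub_const ξ₀).const_smul s).const_add ξ₀

lemma shrink_add_one (hγ : IsSmoothJordanCurve γ) (ξ₀ : Plane) (s t : ℝ) :
    shrink ξ₀ γ s (t + 1) = shrink ξ₀ γ s t := by
  simp only [shrink, hγ.periodic]

lemma eventually_shrink (hγ : IsSmoothJordanCurve γ) {P : Plane → Prop}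
    (hP : ∀ᶠ ξ in 𝓝 ξ₀, P ξ) : ∀ᶠ s in 𝓝[>] (0 : ℝ), ∀ t, P (shrink ξ₀ γ s t) := by
  obtain ⟨M, hM, hb, -⟩ := hγ.exists_bound ξ₀
  obtain ⟨ε, hε, hball⟩ := Metric.eventually_nhds_iff_ball.1 hP
  filter_upwards [Ioo_mem_nhdsGT (div_pos hε hM)] with s hs t
  refine hball _ ?_
  rw [Metric.mem_ball, dist_eq_norm, shrink, add_sub_cancel_left, norm_smul,
    Real.norm_of_nonneg hs.1.le]
  calc s * ‖γ t - ξ₀‖ ≤ s * M := mul_le_mul_of_nonneg_left (hb t) hs.1.le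
    _ < ε := (lt_div_iff₀ hM).1 hs.2

/-- A loop of size `s` also has speed `O(s)`. The derivative estimate feeds the phase bounds and is
needed over one period only. -/
lemma exists_comp_shrink_bound (hγ : IsSmoothJordanCurve γ) {F : Type*} [NormedAddCommGroup F]
    [NormedSpace ℝ F] {f : Plane → F} (hf : ContDiffAt ℝ 1 f ξ₀) :
    ∃ C > 0, ∀ᶠ s in 𝓝[>] (0 : ℝ), ContDiff ℝ 1 (fun t => f (shrink ξ₀ γ s t)) ∧
      (∀ t, ‖f (shrink ξ₀ γ s t) - f ξ₀‖ ≤ C * s) ∧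
      ∀ t ∈ Icc (0 : ℝ) 1, ‖deriv (fun t => f (shrink ξ₀ γ s t)) t‖ ≤ C * s := by
  obtain ⟨M, hM, hb, hb'⟩ := hγ.exists_bound ξ₀
  obtain ⟨K, U, hU, hK⟩ := hf.exists_lipschitzOnWith
  have hev : ∀ᶠ ξ in 𝓝 ξ₀, ContDiffAt ℝ 1 f ξ ∧ ‖fderiv ℝ f ξ‖ ≤ ‖fderiv ℝ f ξ₀‖ + 1 ∧ ξ ∈ U := by
    refine (hf.eventually (by simp)).and (Eventually.and ?_ hU)
    have hc : ContinuousAt (fun ξ => ‖fderiv ℝ f ξ‖) ξ₀ :=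
      (hf.continuousAt_fderiv one_ne_zero).norm
    filter_upwards [hc.eventually_lt continuousAt_const (lt_add_one _)] with ξ hξ using hξ.le
  refine ⟨max (K * M) ((‖fderiv ℝ f ξ₀‖ + 1) * M), by positivity, ?_⟩
  filter_upwards [hγ.eventually_shrink hev, self_mem_nhdsWithin] with s hs (hs0 : 0 < s)
  refine ⟨contDiff_iff_contDiffAt.2 fun t => (hs t).1.comp t (hγ.contDiff_shrink ξ₀ s).contDiffAt,
    fun t => ?_, fun t ht => ?_⟩
  · have h1 := hK.dist_le_mul _ (hs t).2.2 _ (mem_of_mem_nhds hU)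
    rw [dist_eq_norm, dist_eq_norm, shrink, add_sub_cancel_left, norm_smul,
      Real.norm_of_nonneg hs0.le] at h1
    calc _ ≤ K * (s * ‖γ t - ξ₀‖) := h1
      _ ≤ K * (s * M) := by gcongr; exact hb t
      _ = K * M * s := by ring
      _ ≤ _ := by gcongr; exact le_max_left _ _
  · have h1 := ((hs t).1.differentiableAt one_ne_zero).hasFDerivAt.comp_hasDerivAt t
      (hγ.hasDerivAt_shrink ξ₀ s t)
    rw [show (fun t => f (shrink ξ₀ γ s t)) = f ∘ shrink ξ₀ γ s from rfl, h1.deriv]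
    calc _ ≤ ‖fderiv ℝ f (shrink ξ₀ γ s t)‖ * ‖s • deriv γ t‖ := ContinuousLinearMap.le_opNorm _ _
      _ ≤ (‖fderiv ℝ f ξ₀‖ + 1) * (s * M) := by
          rw [norm_smul, Real.norm_of_nonneg hs0.le]
          gcongr
          · exact (hs t).2.1
          · exact hb' t ht
      _ = (‖fderiv ℝ f ξ₀‖ + 1) * M * s := by ring
      _ ≤ _ := by gcongr; exact le_max_right _ _

/-- A linear image of an encircling Jordan curve has odd winding number. -/
lemma no_periodic_sqrt (hγ : IsSmoothJordanCurve γ) (henc : Encircles γ ξ₀) (L : Plane ≃L[ℝ] ℂ)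
    {h : ℝ → ℂ} (hc : Continuous h) (hp : Function.Periodic h 1)
    (hsq : ∀ t, h t ^ 2 = L (γ t - ξ₀)) : False := by
  obtain ⟨hoff, hb⟩ := henc
  let Ψ : Plane ≃ₜ ℂ := (Homeomorph.subRight ξ₀).trans L.toHomeomorph
  have hΨ : ∀ ξ, Ψ ξ = L (ξ - ξ₀) := fun _ => rfl
  have hr : range (fun t => L (γ t - ξ₀)) = Ψ '' range γ := by
    rw [← range_comp]; rfl
  refine no_periodic_sqrt_of_encircles (Γ := fun t => L (γ t - ξ₀))
    (fun t => by simp only [hγ.periodic t]) (fun t ht u hu e => hγ.injOn ht hu ?_) (fun t e => ?_)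
    ?_ hc hp hsq
  · exact Ψ.injective e
  · have h1 : γ t - ξ₀ = 0 := (map_eq_zero_iff L L.injective).1 e
    exact hoff ⟨t, sub_eq_zero.1 h1⟩
  · have h1 : Ψ ξ₀ = 0 := by rw [hΨ, sub_self, map_zero]
    rw [hr, ← Homeomorph.image_compl, ← h1, ← Ψ.image_connectedComponentIn hoff]
    have h2 : Ψ '' connectedComponentIn (range γ)ᶜ ξ₀ =
        L '' ((fun ξ => ξ - ξ₀) '' connectedComponentIn (range γ)ᶜ ξ₀) := by
      rw [← image_comp]; rfl
    rw [h2]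
    refine (L : Plane →L[ℝ] ℂ).lipschitz.isBounded_image ?_
    have h3 : LipschitzWith 1 fun ξ : Plane => ξ - ξ₀ :=
      LipschitzWith.of_dist_le_mul fun x y => by simp
    exact h3.isBounded_image hb

end IsSmoothJordanCurve

variable {A : Plane → Matrix (Fin n) (Fin n) ℂ} {m : ℕ} {T : Plane → Matrix (Fin n) (Fin 2) ℂ}
  {S : Plane → Matrix (Fin 2) (Fin n) ℂ} {E : Plane → Matrix (Fin 2) (Fin 2) ℂ}
  {L : Plane ≃L[ℝ] ℂ} {l : Fin m → ℂ}

namespace IsCuspFrame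

lemma contDiffAt_disc (hF : IsCuspFrame A ξ₀ T S E L l) :
    ContDiffAt ℝ 1 (fun ξ => disc2 (E ξ)) ξ₀ := by
  have h := hF.contDiffAt_E
  exact (((h 0 0).sub (h 1 1)).pow 2).add ((contDiffAt_const.mul (h 0 1)).mul (h 1 0))

/-- The first-order expansion of `Δ` at `ξ₀`, uniform along the loop: the remainder is at most half
of the least size of the linear term, so it cannot alter the winding. -/
lemma eventually_disc_near (hF : IsCuspFrame A ξ₀ T S E L l) (hγ : IsSmoothJordanCurve γ)
    (henc : Encircles γ ξ₀) :
    ∃ c > 0, (∀ t, c ≤ ‖L (γ t - ξ₀)‖) ∧ ∀ᶠ s in 𝓝[>] (0 : ℝ), ∀ t,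
      ‖disc2 (E (shrink ξ₀ γ s t)) - s * L (γ t - ξ₀)‖ ≤ s * c / 2 := by
  obtain ⟨M, hM, hb, -⟩ := hγ.exists_bound ξ₀
  have hne : ∀ t, L (γ t - ξ₀) ≠ 0 := fun t e =>
    henc.1 ⟨t, sub_eq_zero.1 ((map_eq_zero_iff L L.injective).1 e)⟩
  have hcont := hγ.contDiff.continuous
  obtain ⟨⟨t₀, ht₀⟩, -⟩ := exists_norm_bounds (h := fun t => L (γ t - ξ₀))
    (by fun_prop) (fun t => by simp only [hγ.periodic t])
  have hc : 0 < ‖L (γ t₀ - ξ₀)‖ := norm_pos_iff.2 (hne t₀)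
  refine ⟨‖L (γ t₀ - ξ₀)‖, hc, ht₀, ?_⟩
  set c := ‖L (γ t₀ - ξ₀)‖
  have hlo := hF.hasFDerivAt.isLittleO.def (c := c / (2 * M)) (by positivity)
  filter_upwards [hγ.eventually_shrink hlo, self_mem_nhdsWithin] with s hs (hs0 : 0 < s) t
  have h1 := hs t
  rw [hF.disc_eq_zero, sub_zero, shrink, add_sub_cancel_left, map_smul, norm_smul,
    Real.norm_of_nonneg hs0.le] at h1
  calc _ ≤ c / (2 * M) * (s * ‖γ t - ξ₀‖) := h1
    _ ≤ c / (2 * M) * (s * M) := by gcongr; exact hb t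
    _ = s * c / 2 := by field_simp

/-- On small loops the discriminant of the degenerating block has a square root which changes
sign along the loop. -/
lemma exists_antiperiodic_sqrt (hF : IsCuspFrame A ξ₀ T S E L l) (hγ : IsSmoothJordanCurve γ)
    (henc : Encircles γ ξ₀) :
    ∃ c > 0, ∃ C > 0, ∀ᶠ s in 𝓝[>] (0 : ℝ), ∃ r : ℝ → ℂ, ContDiff ℝ 1 r ∧
      (∀ t, r t ^ 2 = disc2 (E (shrink ξ₀ γ s t)) / 4) ∧ (∀ t, r (t + 1) = -r t) ∧
      ∀ t, c * √s ≤ ‖r t‖ ∧ ‖r t‖ ≤ C * √s := by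
  obtain ⟨c, hc, hcL, hnear⟩ := hF.eventually_disc_near hγ henc
  obtain ⟨C, hC, hbound⟩ := hγ.exists_comp_shrink_bound hF.contDiffAt_disc
  -- These constants come from `‖r‖ ^ 2 = ‖Δ‖ / 4` and `s * c / 2 ≤ ‖Δ‖ ≤ C * s`.
  refine ⟨√(c / 8), by positivity, √(C / 4), by positivity, ?_⟩
  filter_upwards [hnear, hbound, self_mem_nhdsWithin] with s hs hs' (hs0 : 0 < s)
  obtain ⟨hD1, hD2, -⟩ := hs'
  set D : ℝ → ℂ := fun t => disc2 (E (shrink ξ₀ γ s t)) with hD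
  have hlow : ∀ t, s * c / 2 ≤ ‖D t‖ := by
    intro t
    have h1 : ‖(s : ℂ) * L (γ t - ξ₀)‖ = s * ‖L (γ t - ξ₀)‖ := by
      rw [norm_mul, Complex.norm_real, Real.norm_of_nonneg hs0.le]
    have h2 : s * c ≤ s * ‖L (γ t - ξ₀)‖ := mul_le_mul_of_nonneg_left (hcL t) hs0.le
    have h3 : ‖(s : ℂ) * L (γ t - ξ₀)‖ ≤ ‖D t‖ + ‖D t - s * L (γ t - ξ₀)‖ := by
      have := norm_sub_le (D t) (D t - s * L (γ t - ξ₀))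
      rwa [sub_sub_cancel] at this
    have h4 : ‖D t - s * L (γ t - ξ₀)‖ ≤ s * c / 2 := hs t
    linarith
  have hD0 : ∀ t, D t ≠ 0 := fun t e => by
    have := hlow t
    rw [e, norm_zero] at this
    have : 0 < s * c / 2 := by positivity
    linarith
  obtain ⟨g, hg, -, -, hexp⟩ := contDiff_logDeriv_integral hD1 hD0
  obtain ⟨w, hw⟩ := IsAlgClosed.exists_pow_nat_eq (D 0 / 4) two_pos
  let r : ℝ → ℂ := fun t => w * Complex.exp (g t / 2)
  have hr : ContDiff ℝ 1 r := contDiff_const.mul (hg.div_const 2).cexp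
  have hr2 : ∀ t, r t ^ 2 = D t / 4 := by
    intro t
    have h2 : Complex.exp (g t / 2) ^ 2 = Complex.exp (g t) := by
      rw [← Complex.exp_nat_mul]; congr 1; push_cast; ring
    rw [mul_pow, hw, h2, hexp t]; ring
  have hDp : ∀ t, D (t + 1) = D t := fun t => by simp only [hD, hγ.shrink_add_one]
  have hr0 : ∀ t, r t ≠ 0 := fun t e => hD0 t (by
    have := hr2 t
    rw [e] at this
    linear_combination -4 * this)
  have hpm : (∀ t, r (t + 1) = r t) ∨ ∀ t, r (t + 1) = -r t := by
    have hcont : ∀ j : Fin 2, Continuous fun t => ![r t, -r t] j :=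
      Fin.forall_fin_two.2 ⟨hr.continuous, hr.continuous.neg⟩
    have hinj : ∀ t, Function.Injective ![r t, -r t] := by
      intro t i j hij
      have h1 : r t ≠ -r t := fun e => hr0 t (self_eq_neg.1 e)
      fin_cases i <;> fin_cases j <;> first | rfl | exact absurd hij h1 | exact absurd hij.symm h1
    have hval : ∀ t, ∃ j, ![r t, -r t] j = r (t + 1) := by
      intro t
      have h1 : r (t + 1) ^ 2 = r t ^ 2 := by rw [hr2, hr2, hDp]
      rcases sq_eq_sq_iff_eq_or_eq_neg.1 h1 with h2 | h2
      · exact ⟨0, h2.symm⟩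
      · exact ⟨1, h2.symm⟩
    rcases Fin.exists_fin_two.1 (exists_label_of_path hcont hinj
      (hr.continuous.comp (continuous_id.add continuous_const)) hval) with h | h
    · exact .inl fun t => (h t).symm
    · exact .inr fun t => (h t).symm
  refine ⟨r, hr, hr2, hpm.resolve_left fun hper => ?_, fun t => ⟨?_, ?_⟩⟩
  · have hs0' : (s : ℂ) ≠ 0 := by exact_mod_cast hs0.ne'
    have hL0 : ∀ t, L (γ t - ξ₀) ≠ 0 := fun t e => by
      have := hcL t
      rw [e, norm_zero] at this
      linarith
    -- `1 + f` is the ratio of `Δ` to its linear part and has a principal square root. Dividing a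
    -- periodic `r` by that root and rescaling by `v`, with `v ^ 2 = 4 / s`, would give a periodic
    -- square root of `L (γ - ξ₀)`.
    set f : ℝ → ℂ := fun t => (D t - s * L (γ t - ξ₀)) / (s * L (γ t - ξ₀)) with hf
    have hfn : ∀ t, ‖f t‖ < 1 := by
      intro t
      have h1 : s * c ≤ s * ‖L (γ t - ξ₀)‖ := mul_le_mul_of_nonneg_left (hcL t) hs0.le
      have h2 : 0 < s * c := by positivity
      rw [hf, norm_div, norm_mul, Complex.norm_real, Real.norm_of_nonneg hs0.le,
        div_lt_one (by linarith)]
      have h4 : ‖D t - s * L (γ t - ξ₀)‖ ≤ s * c / 2 := hs t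
      linarith
    have hcont := hγ.contDiff.continuous
    have hfc : Continuous f := by
      refine Continuous.div (hD1.continuous.sub (by fun_prop)) (by fun_prop) fun t =>
        mul_ne_zero hs0' (hL0 t)
    have hf1 : ∀ t, 1 + f t = D t / (s * L (γ t - ξ₀)) := by
      intro t
      have := hL0 t
      rw [hf]; field_simp; ring
    obtain ⟨v, hv⟩ := IsAlgClosed.exists_pow_nat_eq (4 / (s : ℂ)) two_pos
    refine hγ.no_periodic_sqrt henc L
      (h := fun t => v * r t * Complex.exp (-(Complex.log (1 + f t) / 2))) ?_ ?_ ?_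
    · have := log_one_add_continuous hfc hfn
      have := hr.continuous
      fun_prop
    · intro t
      simp only [hper t, hf, hDp t, hγ.periodic t]
    · intro t
      have h2 : Complex.exp (-(Complex.log (1 + f t) / 2)) ^ 2 = (1 + f t)⁻¹ := by
        rw [← Complex.exp_nat_mul]
        have : ((2 : ℕ) : ℂ) * -(Complex.log (1 + f t) / 2) = -Complex.log (1 + f t) := by
          push_cast; ring
        rw [this, Complex.exp_neg, Complex.exp_log]
        exact Complex.slitPlane_ne_zero (Complex.mem_slitPlane_of_norm_lt_one (hfn t))
      rw [mul_pow, mul_pow, hv, hr2, h2, hf1]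
      have h3 := hL0 t
      have h4 := hD0 t
      field_simp
  · have h1 : ‖r t‖ ^ 2 = ‖D t‖ / 4 := by rw [← norm_pow, hr2, norm_div]; norm_num
    rw [← Real.sqrt_mul (by positivity), ← Real.sqrt_sq (norm_nonneg (r t)), h1]
    exact Real.sqrt_le_sqrt (by linarith [hlow t])
  · have h1 : ‖r t‖ ^ 2 = ‖D t‖ / 4 := by rw [← norm_pow, hr2, norm_div]; norm_num
    have h2 : ‖D t‖ ≤ C * s := by simpa [hF.disc_eq_zero] using hD2 t
    rw [← Real.sqrt_mul (by positivity), ← Real.sqrt_sq (norm_nonneg (r t)), h1]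
    exact Real.sqrt_le_sqrt (by linarith)

end IsCuspFrame

end SmallLoops

/-! ### Permutation of the eigenvalues around a loop -/

section Monodromy

open Set Filter Matrix

/-- Right eigenvector of a `2 × 2` matrix for the eigenvalue `tr / 2 + ρ`. -/
noncomputable def rightVec (M : Matrix (Fin 2) (Fin 2) ℂ) (ρ : ℂ) : Fin 2 → ℂ :=
  ![M 0 1, (M 1 1 - M 0 0) / 2 + ρ]

/-- Left eigenvector of a `2 × 2` matrix for the eigenvalue `tr / 2 + ρ`. -/
noncomputable def leftVec (M : Matrix (Fin 2) (Fin 2) ℂ) (ρ : ℂ) : Fin 2 → ℂ :=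
  ![(M 0 0 - M 1 1) / 2 + ρ, M 0 1]

/-- Half of the trace of a `2 × 2` matrix. -/
noncomputable def halfTrace (M : Matrix (Fin 2) (Fin 2) ℂ) : ℂ := (M 0 0 + M 1 1) / 2

lemma mulVec_rightVec {M : Matrix (Fin 2) (Fin 2) ℂ} {ρ : ℂ} (h : ρ ^ 2 = disc2 M / 4) :
    M *ᵥ rightVec M ρ = (halfTrace M + ρ) • rightVec M ρ := by
  rw [disc2] at h
  funext i
  fin_cases i
  · simp [rightVec, halfTrace, mulVec, dotProduct, Fin.sum_univ_two]; ring
  · simp [rightVec, halfTrace, mulVec, dotProduct, Fin.sum_univ_two]; linear_combination -h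

lemma leftVec_vecMul {M : Matrix (Fin 2) (Fin 2) ℂ} {ρ : ℂ} (h : ρ ^ 2 = disc2 M / 4) :
    leftVec M ρ ᵥ* M = (halfTrace M + ρ) • leftVec M ρ := by
  rw [disc2] at h
  funext i
  fin_cases i
  · simp [leftVec, halfTrace, vecMul, dotProduct, Fin.sum_univ_two]; linear_combination -h
  · simp [leftVec, halfTrace, vecMul, dotProduct, Fin.sum_univ_two]; ring

/-- Left and right eigenvectors become orthogonal at the cusp, to first order in `ρ`. This vanishing
produces the term `r' / (2 r)` behind the quarter turn. -/
lemma leftVec_dotProduct_rightVec (M : Matrix (Fin 2) (Fin 2) ℂ) (ρ : ℂ) :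
    leftVec M ρ ⬝ᵥ rightVec M ρ = 2 * M 0 1 * ρ := by
  simp [leftVec, rightVec, dotProduct, Fin.sum_univ_two]; ring

variable {n : ℕ} {γ : ℝ → Plane} {ξ₀ : Plane} {A : Plane → Matrix (Fin n) (Fin n) ℂ} {m : ℕ}
  {T : Plane → Matrix (Fin n) (Fin 2) ℂ}
  {S : Plane → Matrix (Fin 2) (Fin n) ℂ} {E : Plane → Matrix (Fin 2) (Fin 2) ℂ}
  {L : Plane ≃L[ℝ] ℂ} {l : Fin m → ℂ}

namespace IsCuspFrame

lemma eventually_eigenvectors (hF : IsCuspFrame A ξ₀ T S E L l) :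
    ∀ᶠ ξ in 𝓝 ξ₀, E ξ 0 1 ≠ 0 ∧ S ξ * T ξ = 1 ∧ ∀ ρ : ℂ, ρ ^ 2 = disc2 (E ξ) / 4 →
      A ξ *ᵥ (T ξ *ᵥ rightVec (E ξ) ρ) =
        (halfTrace (E ξ) + ρ) • (T ξ *ᵥ rightVec (E ξ) ρ) ∧
      (leftVec (E ξ) ρ ᵥ* S ξ) ᵥ* A ξ = (halfTrace (E ξ) + ρ) • (leftVec (E ξ) ρ ᵥ* S ξ) ∧
      T ξ *ᵥ rightVec (E ξ) ρ ≠ 0 ∧ leftVec (E ξ) ρ ᵥ* S ξ ≠ 0 := by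
  filter_upwards [hF.split, (hF.contDiffAt_E 0 1).continuousAt.eventually_ne hF.upper_ne_zero]
    with ξ ⟨h1, h2, h3⟩ hb
  refine ⟨hb, h1, fun ρ hρ => ⟨?_, ?_, fun h0 => hb ?_, fun h0 => hb ?_⟩⟩
  · rw [mulVec_mulVec, h2, ← mulVec_mulVec, mulVec_rightVec hρ, mulVec_smul]
  · rw [vecMul_vecMul, h3, ← vecMul_vecMul, leftVec_vecMul hρ, smul_vecMul]
  · have : S ξ *ᵥ (T ξ *ᵥ rightVec (E ξ) ρ) = rightVec (E ξ) ρ := by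
      rw [mulVec_mulVec, h1, one_mulVec]
    rw [h0, mulVec_zero] at this
    exact (congrFun this 0).symm
  · have : (leftVec (E ξ) ρ ᵥ* S ξ) ᵥ* T ξ = leftVec (E ξ) ρ := by
      rw [vecMul_vecMul, h1, vecMul_one]
    rw [h0, zero_vecMul] at this
    exact (congrFun this 1).symm

lemma contDiffAt_halfTrace (hF : IsCuspFrame A ξ₀ T S E L l) :
    ContDiffAt ℝ 1 (fun ξ => halfTrace (E ξ)) ξ₀ :=
  ((hF.contDiffAt_E 0 0).add (hF.contDiffAt_E 1 1)).div_const 2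

/-- On small loops, two eigenvalues belong to the degenerating block and the others continue the
simple eigenvalues at `ξ₀`. -/
theorem eventually_exists_labels (hF : IsCuspFrame A ξ₀ T S E L l) (hγ : IsSmoothJordanCurve γ)
    {μ : Fin m → Plane → ℂ} (hμ : ∀ i, ContDiffAt ℝ 1 (μ i) ξ₀) (hμ0 : ∀ i, μ i ξ₀ = l i)
    (hroot : ∀ i, ∀ᶠ ξ in 𝓝 ξ₀, (A ξ).charpoly.IsRoot (μ i ξ)) :
    ∀ᶠ s in 𝓝[>] (0 : ℝ), ∀ r : ℝ → ℂ, Continuous r →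
      (∀ t, r t ^ 2 = disc2 (E (shrink ξ₀ γ s t)) / 4) → (∀ t, r t ≠ 0) →
      ∀ lam : ℝ → Fin n → ℂ, (∀ j, Continuous fun t => lam t j) →
      (∀ t, IsEigenvalueLabelling (A (shrink ξ₀ γ s t)) (lam t)) →
      ∃ p q, p ≠ q ∧ (∀ t, lam t p = halfTrace (E (shrink ξ₀ γ s t)) + r t) ∧
        (∀ t, lam t q = halfTrace (E (shrink ξ₀ γ s t)) - r t) ∧
        ∀ j, j ≠ p → j ≠ q → ∃ i, ∀ t, lam t j = μ i (shrink ξ₀ γ s t) := by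
  -- Squaring states that `μ i` avoids both eigenvalues of the block without reference to the root
  -- `r`, so it is an open condition on `ξ`.
  have hsep : ∀ᶠ ξ in 𝓝 ξ₀, ∀ i, (μ i ξ - halfTrace (E ξ)) ^ 2 ≠ disc2 (E ξ) / 4 := by
    refine eventually_all.2 fun i => ?_
    have hc : ContinuousAt (fun ξ => (μ i ξ - halfTrace (E ξ)) ^ 2 - disc2 (E ξ) / 4) ξ₀ :=
      (((hμ i).sub hF.contDiffAt_halfTrace).pow 2).continuousAt.sub
        (hF.contDiffAt_disc.div_const 4).continuousAt
    filter_upwards [hc.eventually_ne (y := 0) (by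
      rw [hF.disc_eq_zero, hμ0, zero_div, sub_zero]
      exact pow_ne_zero 2 (sub_ne_zero.2 (hF.ne_trace i)))] with ξ hξ
    exact sub_ne_zero.1 hξ
  have hdist : ∀ᶠ ξ in 𝓝 ξ₀, ∀ i j, i ≠ j → μ i ξ ≠ μ j ξ := by
    refine eventually_all.2 fun i => eventually_all.2 fun j => ?_
    by_cases hij : i = j
    · simp [hij]
    have hc := ((hμ i).sub (hμ j)).continuousAt
    filter_upwards [hc.eventually_ne (y := 0) (by
      rw [hμ0, hμ0]; exact sub_ne_zero.2 fun e => hij (hF.injective e))] with ξ hξ _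
    exact sub_ne_zero.1 hξ
  have hcont : ∀ᶠ s in 𝓝[>] (0 : ℝ), ∀ i, Continuous fun t => μ i (shrink ξ₀ γ s t) := by
    refine eventually_all.2 fun i => ?_
    obtain ⟨C, -, hC⟩ := hγ.exists_comp_shrink_bound (hμ i)
    filter_upwards [hC] with s hs using hs.1.continuous
  obtain ⟨C, -, htr⟩ := hγ.exists_comp_shrink_bound hF.contDiffAt_halfTrace
  filter_upwards [hγ.eventually_shrink hsep, hγ.eventually_shrink hdist, hcont, htr,
    hγ.eventually_shrink (eventually_all.2 hroot), hγ.eventually_shrink hF.eventually_eigenvectors]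
    with s hsep hdist hμc htr hroot hvec r hr hr2 hr0 lam hlam hlab
  set ζ : ℝ → Plane := shrink ξ₀ γ s
  let κ : ℝ → Fin 2 ⊕ Fin m → ℂ := fun t => Sum.elim
    ![halfTrace (E (ζ t)) + r t, halfTrace (E (ζ t)) - r t] (fun i => μ i (ζ t))
  have hκc : ∀ a, Continuous fun t => κ t a := by
    have htc := htr.1.continuous
    rintro (c | i)
    · revert c
      exact Fin.forall_fin_two.2 ⟨htc.add hr, htc.sub hr⟩
    · exact hμc i
  have hκroot : ∀ t a, (A (ζ t)).charpoly.IsRoot (κ t a) := by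
    intro t
    have hv := (hvec t).2.2
    rintro (c | i)
    · revert c
      refine Fin.forall_fin_two.2 ⟨?_, ?_⟩
      · obtain ⟨h1, -, h2, -⟩ := hv (r t) (hr2 t)
        exact isRoot_of_eigenvector h2 h1
      · obtain ⟨h1, -, h2, -⟩ := hv (-r t) (by rw [neg_sq, hr2])
        rw [← sub_eq_add_neg] at h1
        exact isRoot_of_eigenvector h2 h1
    · exact hroot t i
  have hκinj : Function.Injective (κ 0) := by
    have h01 : halfTrace (E (ζ 0)) + r 0 ≠ halfTrace (E (ζ 0)) - r 0 := fun e =>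
      hr0 0 (self_eq_neg.1 (by linear_combination e))
    have hci : ∀ c i, κ 0 (.inl c) ≠ κ 0 (.inr i) := by
      intro c i
      revert c
      refine Fin.forall_fin_two.2 ⟨fun e => hsep 0 i ?_, fun e => hsep 0 i ?_⟩
      · change halfTrace (E (ζ 0)) + r 0 = μ i (ζ 0) at e
        rw [← e, ← hr2]; ring
      · change halfTrace (E (ζ 0)) - r 0 = μ i (ζ 0) at e
        rw [← e, ← hr2]; ring
    rintro (c | i) (d | j) hab
    · fin_cases c <;> fin_cases d <;> first | rfl | exact absurd hab h01 | exact absurd hab.symm h01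
    · exact absurd hab (hci c j)
    · exact absurd hab.symm (hci d i)
    · by_contra hne
      exact hdist 0 i j (fun e => hne (by rw [e])) hab
  -- Each of the `n` explicit eigenvalue paths keeps a label; distinctness at time `0` makes the
  -- labels distinct, so by counting they exhaust all.
  choose π hπ using fun a => exists_label_of_path hlam (fun t => (hlab t).1) (hκc a)
    (fun t => ((hlab t).2 _).1 (hκroot t a))
  have hπinj : Function.Injective π := fun a b hab => hκinj (by rw [← hπ a 0, ← hπ b 0, hab])
  have hπbij : Function.Bijective π :=
    (Fintype.bijective_iff_injective_and_card π).2 ⟨hπinj, by simp [hF.card_eq]⟩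
  refine ⟨π (.inl 0), π (.inl 1), fun e => by simpa using hπinj e, hπ (.inl 0), hπ (.inl 1),
    fun j hj0 hj1 => ?_⟩
  obtain ⟨a, rfl⟩ := hπbij.2 j
  rcases a with c | i
  · revert c
    exact Fin.forall_fin_two.2 ⟨fun h _ => absurd rfl h, fun _ h => absurd rfl h⟩
  · exact ⟨i, hπ (.inr i)⟩

lemma exists_local_eigenvalues (hF : IsCuspFrame A ξ₀ T S E L l) :
    ∃ (μ : Fin m → Plane → ℂ) (u y : Fin m → Plane → Fin n → ℂ),
      (∀ i, ContDiffAt ℝ 1 (μ i) ξ₀) ∧ (∀ i, ContDiffAt ℝ 1 (u i) ξ₀) ∧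
      (∀ i, ContDiffAt ℝ 1 (y i) ξ₀) ∧ (∀ i, μ i ξ₀ = l i) ∧
      (∀ i, y i ξ₀ ⬝ᵥ u i ξ₀ ≠ 0) ∧
      ∀ i, ∀ᶠ ξ in 𝓝 ξ₀, A ξ *ᵥ u i ξ = μ i ξ • u i ξ ∧ y i ξ ᵥ* A ξ = μ i ξ • y i ξ := by
  choose μ u y h1 h2 h3 h4 h5 h6 using fun i =>
    exists_local_eigenpair hF.contDiffAt_A (hF.isRoot i) (hF.derivative_ne_zero i)
  exact ⟨μ, u, y, h1, h2, h3, h4, h5, h6⟩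

lemma eventually_isRoot {u y : Plane → Fin n → ℂ} {μ : Plane → ℂ}
    (hu : ContDiffAt ℝ 1 u ξ₀) (huy : y ξ₀ ⬝ᵥ u ξ₀ ≠ 0)
    (hA : ∀ᶠ ξ in 𝓝 ξ₀, A ξ *ᵥ u ξ = μ ξ • u ξ ∧ y ξ ᵥ* A ξ = μ ξ • y ξ) :
    ∀ᶠ ξ in 𝓝 ξ₀, (A ξ).charpoly.IsRoot (μ ξ) := by
  have hu0 : u ξ₀ ≠ 0 := fun e => huy (by rw [e, dotProduct_zero])
  filter_upwards [hA, hu.continuousAt.eventually_ne hu0] with ξ h1 h2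
  exact isRoot_of_eigenvector h2 h1.1

/-- Monodromy of the eigenvalues on small loops. -/
lemma eventually_swap (hF : IsCuspFrame A ξ₀ T S E L l) (hγ : IsSmoothJordanCurve γ)
    (henc : Encircles γ ξ₀) :
    ∀ᶠ s in 𝓝[>] (0 : ℝ), ∀ lam : ℝ → Fin n → ℂ, (∀ j, Continuous fun t => lam t j) →
      (∀ t, IsEigenvalueLabelling (A (shrink ξ₀ γ s t)) (lam t)) →
      ∃ p q, p ≠ q ∧ ∀ t j, lam (t + 1) j = lam t (Equiv.swap p q j) := by
  obtain ⟨μ, u, y, hμ, hu, -, hμ0, huy, hA⟩ := hF.exists_local_eigenvalues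
  obtain ⟨c, hc, C, hC, hsqrt⟩ := hF.exists_antiperiodic_sqrt hγ henc
  filter_upwards [hsqrt, hF.eventually_exists_labels hγ hμ hμ0
    fun i => eventually_isRoot (hu i) (huy i) (hA i), self_mem_nhdsWithin]
    with s ⟨r, hr, hr2, hanti, hbd⟩ hs (hs0 : 0 < s) lam hlam hlab
  have hr0 : ∀ t, r t ≠ 0 := fun t e => by
    have h1 := (hbd t).1
    rw [e, norm_zero] at h1
    have : 0 < c * √s := by positivity
    linarith
  obtain ⟨p, q, hpq, hp, hq, hj⟩ := hs r hr.continuous hr2 hr0 lam hlam hlab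
  refine ⟨p, q, hpq, fun t j => ?_⟩
  by_cases hjp : j = p
  · rw [hjp, Equiv.swap_apply_left, hp, hq, hγ.shrink_add_one, hanti, sub_eq_add_neg]
  by_cases hjq : j = q
  · rw [hjq, Equiv.swap_apply_right, hp, hq, hγ.shrink_add_one, hanti, sub_neg_eq_add]
  rw [Equiv.swap_apply_of_ne_of_ne hjp hjq]
  obtain ⟨i, hi⟩ := hj j hjp hjq
  rw [hi, hi, hγ.shrink_add_one]

end IsCuspFrame

lemma shrink_mem {Ω : Set Plane} (hΩ : Convex ℝ Ω) (hξ₀ : ξ₀ ∈ Ω) (hγΩ : ∀ t, γ t ∈ Ω) {s : ℝ}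
    (hs : s ∈ Ioc (0 : ℝ) 1) (t : ℝ) : shrink ξ₀ γ s t ∈ Ω :=
  hΩ.add_smul_sub_mem hξ₀ (hγΩ t) ⟨hs.1.le, hs.2⟩

lemma shrink_ne (henc : Encircles γ ξ₀) {s : ℝ} (hs : 0 < s) (t : ℝ) :
    shrink ξ₀ γ s t ≠ ξ₀ := by
  rw [shrink, Ne, add_eq_left, smul_eq_zero, not_or, sub_eq_zero]
  exact ⟨hs.ne', fun e => henc.1 ⟨t, e⟩⟩

/-- Monodromy of the eigenvalues on a loop around a generic cuspidal point. -/
theorem exists_swap_of_encircles {Ω : Set Plane} (hΩc : Convex ℝ Ω) {k : ℕ∞}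
    (hA : MatContDiffOn k A Ω) (hξ₀ : ξ₀ ∈ Ω)
    (hsimple : ∀ ξ ∈ Ω, ξ ≠ ξ₀ → HasDistinctEigenvalues (A ξ)) (hγ : IsSmoothJordanCurve γ)
    (hγΩ : ∀ t, γ t ∈ Ω) (henc : Encircles γ ξ₀) (hF : IsCuspFrame A ξ₀ T S E L l)
    {lam : ℝ → Fin n → ℂ} (hlam : ∀ j, Continuous fun t => lam t j)
    (hlab : ∀ t, IsEigenvalueLabelling (A (γ t)) (lam t)) :
    ∃ p q, p ≠ q ∧ ∀ t j, lam (t + 1) j = lam t (Equiv.swap p q j) := by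
  obtain ⟨s₀, hsmall, hs₀⟩ := ((hF.eventually_swap hγ henc).and
    (Ioc_mem_nhdsGT (zero_lt_one' ℝ))).exists
  -- Clamping the scale to `[s₀, 1]` makes the homotopy a map from all of `ℝ × ℝ`, a simply
  -- connected space, that avoids `ξ₀`.
  let c : ℝ → ℝ := fun σ => max s₀ (min σ 1)
  have hc : ∀ σ, c σ ∈ Ioc (0 : ℝ) 1 := fun σ =>
    ⟨hs₀.1.trans_le (le_max_left _ _), max_le hs₀.2 (min_le_right _ _)⟩
  let H : ℝ × ℝ → Plane := fun x => shrink ξ₀ γ (c x.1) x.2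
  have hγc := hγ.contDiff.continuous
  have hH : Continuous H := by
    simp only [H, shrink, c]
    fun_prop
  have hHΩ : ∀ x, H x ∈ Ω := fun x => shrink_mem hΩc hξ₀ hγΩ (hc x.1) x.2
  have hHne : ∀ x, H x ≠ ξ₀ := fun x => shrink_ne henc (hc x.1).1 x.2
  have hHp : ∀ x : ℝ × ℝ, H (x.1, x.2 + 1) = H x := fun x => hγ.shrink_add_one ξ₀ _ _
  obtain ⟨Λ, hΛc, hΛ⟩ := exists_continuous_labelling (B := fun x => A (H x))
    (fun i j => (hA i j).continuousOn.comp_continuous hH hHΩ)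
    (fun x => hsimple _ (hHΩ x) (hHne x))
  -- A shift by one period permutes the labels by a `σ` that does not depend on scale or time, so it
  -- can be read off on the small loop.
  choose σ hσ using fun j => exists_label_of_path hΛc (fun x => (hΛ x).1)
    (μ := fun x : ℝ × ℝ => Λ (x.1, x.2 + 1) j)
    ((hΛc j).comp (continuous_fst.prodMk (continuous_snd.add continuous_const)))
    (fun x => ((hΛ x).2 _).1 (by
      rw [← hHp x]; exact ((hΛ (x.1, x.2 + 1)).2 _).2 ⟨j, rfl⟩))
  have hcs : c s₀ = s₀ := by simp [c, hs₀.2]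
  have hc1 : c 1 = 1 := by simp [c, hs₀.2]
  obtain ⟨p, q, hpq, hswap⟩ := hsmall (fun t => Λ (s₀, t))
    (fun j => (hΛc j).comp (by fun_prop))
    (fun t => by
      have := hΛ (s₀, t)
      simp only [H, hcs] at this
      exact this)
  have hσswap : ∀ j, σ j = Equiv.swap p q j := fun j =>
    (hΛ (s₀, 0)).1 ((hσ j (s₀, 0)).trans (hswap 0 j))
  have hH1 : ∀ t, H (1, t) = γ t := fun t => by simp [H, hc1, shrink]
  have hlab1 : ∀ t, IsEigenvalueLabelling (A (γ t)) (Λ (1, t)) := fun t => by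
    have := hΛ (1, t)
    rwa [hH1] at this
  choose κ hκ using fun j => exists_label_of_path (lam := fun t => Λ (1, t))
    (fun j => (hΛc j).comp (by fun_prop)) (fun t => (hlab1 t).1) (hlam j)
    (fun t => ((hlab1 t).2 _).1 (((hlab t).2 _).2 ⟨j, rfl⟩))
  have hκinj : Function.Injective κ := fun i j hij => (hlab 0).1 (by rw [← hκ, ← hκ, hij])
  -- `e` translates the given labels into those of the homotopy; a conjugate of a transposition is
  -- again a transposition.
  let e : Equiv.Perm (Fin n) := Equiv.ofBijective κ (Finite.injective_iff_bijective.1 hκinj)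
  refine ⟨e.symm p, e.symm q, fun h => hpq (e.symm.injective h), fun t j => ?_⟩
  have h1 : κ (Equiv.swap (e.symm p) (e.symm q) j) = Equiv.swap p q (κ j) := by
    have : e (Equiv.swap (e.symm p) (e.symm q) j) = Equiv.swap p q (e j) := by
      rw [e.injective.map_swap, e.apply_symm_apply, e.apply_symm_apply]
    exact this
  rw [← hκ, ← hκ, h1, ← hσswap]
  exact (hσ (κ j) (1, t)).symm

end Monodromy

/-! ### Phase of simple eigenvalues and the algebra of the quarter turn -/

section Asymptotics

open Set Filter Matrix

variable {n : ℕ}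

lemma norm_dotProduct_le (x y : Fin n → ℂ) : ‖x ⬝ᵥ y‖ ≤ n * (‖x‖ * ‖y‖) := by
  calc ‖x ⬝ᵥ y‖ ≤ ∑ i, ‖x i * y i‖ := norm_sum_le _ _
    _ ≤ ∑ _i : Fin n, ‖x‖ * ‖y‖ := Finset.sum_le_sum fun i _ => by
        rw [norm_mul]
        exact mul_le_mul (norm_le_pi_norm x i) (norm_le_pi_norm y i) (norm_nonneg _)
          (norm_nonneg _)
    _ = n * (‖x‖ * ‖y‖) := by simp

lemma exists_int_of_smul_exp_eq_one {R β a : ℝ} (hR : 0 < R)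
    (h : (R : ℂ) * Complex.exp (Complex.I * β) * Complex.exp (Complex.I * a) = 1) :
    ∃ m : ℤ, a - m * (2 * Real.pi) = -β := by
  have hR1 : R = 1 := by
    have := congrArg norm h
    rw [norm_mul, norm_mul, mul_comm Complex.I, mul_comm Complex.I, Complex.norm_exp_ofReal_mul_I,
      Complex.norm_exp_ofReal_mul_I, Complex.norm_real, Real.norm_of_nonneg hR.le] at this
    simpa using this
  rw [hR1, Complex.ofReal_one, one_mul, ← Complex.exp_add, Complex.exp_eq_one_iff] at h
  obtain ⟨m, hm⟩ := h
  refine ⟨m, ?_⟩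
  have h2 : Complex.I * ((β + a : ℝ) : ℂ) = Complex.I * ((m * (2 * Real.pi) : ℝ) : ℂ) := by
    push_cast; linear_combination hm
  have h3 : β + a = m * (2 * Real.pi) := by exact_mod_cast mul_left_cancel₀ Complex.I_ne_zero h2
  linarith

lemma IsTransportedEigendecomposition.isEigenvalueLabelling {k : ℕ∞}
    {B V : ℝ → Matrix (Fin n) (Fin n) ℂ} {lam : ℝ → Fin n → ℂ}
    (h : IsTransportedEigendecomposition k B V lam) {t : ℝ} (hd : HasDistinctEigenvalues (B t)) :
    IsEigenvalueLabelling (B t) (lam t) :=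
  isEigenvalueLabelling_of_decomp (h.isUnit t) (h.decomp t) hd

variable {γ : ℝ → Plane} {ξ₀ : Plane} {A : Plane → Matrix (Fin n) (Fin n) ℂ} {k : ℕ∞}

/-- The phase acquired on a small loop by the eigenvector of an eigenvalue which stays simple. -/
theorem exists_phase_bound_of_simple (hγ : IsSmoothJordanCurve γ) (hk : 1 ≤ k)
    {μ : Plane → ℂ} {u y : Plane → Fin n → ℂ} (hu : ContDiffAt ℝ 1 u ξ₀)
    (hy : ContDiffAt ℝ 1 y ξ₀) (huy : y ξ₀ ⬝ᵥ u ξ₀ ≠ 0)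
    (hA : ∀ᶠ ξ in 𝓝 ξ₀, A ξ *ᵥ u ξ = μ ξ • u ξ ∧ y ξ ᵥ* A ξ = μ ξ • y ξ) :
    ∃ C > 0, ∀ᶠ s in 𝓝[>] (0 : ℝ), ∀ (V : ℝ → Matrix (Fin n) (Fin n) ℂ) (lam : ℝ → Fin n → ℂ),
      IsTransportedEigendecomposition k (fun t => A (shrink ξ₀ γ s t)) V lam →
      (∀ t, Function.Injective (lam t)) → ∀ (j : Fin n) (a : ℝ),
      (∀ t, lam t j = μ (shrink ξ₀ γ s t)) →
      ((fun i => V 1 i j) = Complex.exp (Complex.I * (a : ℂ)) • fun i => V 0 i j) →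
      ∃ p : ℤ, |a - p * (2 * Real.pi)| ≤ C * s := by
  obtain ⟨C, hC, hbound⟩ := hγ.exists_comp_shrink_bound hu
  have hdpos : 0 < ‖y ξ₀ ⬝ᵥ u ξ₀‖ := norm_pos_iff.2 huy
  set d := ‖y ξ₀ ⬝ᵥ u ξ₀‖
  have hdc : ContinuousAt (fun ξ => ‖y ξ ⬝ᵥ u ξ‖) ξ₀ := by
    have h1 := hy.continuousAt
    have h2 := hu.continuousAt
    have : ContinuousAt (fun ξ => y ξ ⬝ᵥ u ξ) ξ₀ := by
      simp only [dotProduct]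
      exact tendsto_finsetSum _ fun i _ =>
        ((continuousAt_pi.1 h1 i).mul (continuousAt_pi.1 h2 i))
    exact this.norm
  have hev : ∀ᶠ ξ in 𝓝 ξ₀, d / 2 < ‖y ξ ⬝ᵥ u ξ‖ ∧ ‖y ξ‖ ≤ ‖y ξ₀‖ + 1 := by
    refine (hdc.eventually_const_lt (half_lt_self hdpos)).and ?_
    filter_upwards [hy.continuousAt.norm.eventually_lt continuousAt_const (lt_add_one _)]
      with ξ hξ using hξ.le
  refine ⟨n * ((‖y ξ₀‖ + 1) * C) / (d / 2) + 1, by positivity, ?_⟩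
  filter_upwards [hbound, hγ.eventually_shrink hev, hγ.eventually_shrink hA, self_mem_nhdsWithin]
    with s ⟨hs1, _, hs2⟩ hs3 hs4 (hs0 : 0 < s) V lam hV hinj j a hj ha
  set ζ := shrink ξ₀ γ s with hζ
  have hne : ∀ t, y (ζ t) ⬝ᵥ u (ζ t) ≠ 0 := fun t e => by
    have := (hs3 t).1
    rw [e, norm_zero] at this
    linarith
  obtain ⟨z, hz, hz0, hxz, -, him⟩ := hV.exists_gauge hk hinj (j := j) (x := fun t => u (ζ t))
    (y := fun t => y (ζ t)) hs1 (fun t e => hne t (by simp only [e, dotProduct_zero]))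
    (fun t e => hne t (by simp only [e, zero_dotProduct])) (fun t => by rw [hj]; exact (hs4 t).1)
    (fun t => by rw [hj]; exact (hs4 t).2)
  obtain ⟨R, β, hR, hβ, e⟩ := exists_phase_of_im_logDeriv_le hz hz0
    (ε := n * ((‖y ξ₀‖ + 1) * C) / (d / 2) * s) (t := 1) (fun τ hτ => by
      rw [uIcc_of_le zero_le_one] at hτ
      rw [him]
      refine (Complex.abs_im_le_norm _).trans ?_
      rw [norm_div, div_mul_eq_mul_div]
      refine div_le_div₀ (by positivity) ?_ (by positivity) (hs3 τ).1.le
      refine (norm_dotProduct_le _ _).trans ?_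
      calc n * (‖y (ζ τ)‖ * ‖deriv (fun t => u (ζ t)) τ‖)
          ≤ n * ((‖y ξ₀‖ + 1) * (C * s)) := by
            gcongr
            · exact (hs3 τ).2
            · exact hs2 τ hτ
        _ = _ := by ring)
  have hper : ζ 1 = ζ 0 := by have := hγ.shrink_add_one ξ₀ s 0; rwa [zero_add] at this
  -- `u` is a function on the plane, so it returns to itself: the change of gauge `z` exactly
  -- compensates the phase `a`.
  have h1 : z 1 • (Complex.exp (Complex.I * (a : ℂ)) • fun i => V 0 i j) =
      z 0 • fun i => V 0 i j := by
    rw [← ha, ← hxz, ← hxz, hper]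
  rw [smul_smul] at h1
  have h2 : z 1 * Complex.exp (Complex.I * (a : ℂ)) = z 0 :=
    smul_left_injective ℂ (hV.col_ne_zero 0 j) h1
  rw [e, mul_assoc] at h2
  have h3 := mul_left_cancel₀ (hz0 0) (h2.trans (mul_one _).symm)
  obtain ⟨p, hp⟩ := exists_int_of_smul_exp_eq_one hR h3
  refine ⟨p, ?_⟩
  rw [hp, abs_neg]
  rw [abs_one, mul_one] at hβ
  nlinarith

/-- Measure `a` from the nearest zero of the cosine and use `2 / π * |x| ≤ |sin x|` for `|x| ≤ π /
2`. -/
lemma exists_int_of_abs_cos_le {a ε : ℝ} (h : |Real.cos a| ≤ ε) :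
    ∃ m : ℤ, |a - (Real.pi / 2 + m * Real.pi)| ≤ Real.pi / 2 * ε := by
  have hπ := Real.pi_pos
  refine ⟨round ((a - Real.pi / 2) / Real.pi), ?_⟩
  set m := round ((a - Real.pi / 2) / Real.pi)
  set x := a - (Real.pi / 2 + m * Real.pi) with hx
  have h1 : |x| ≤ Real.pi / 2 := by
    have h2 := abs_sub_round ((a - Real.pi / 2) / Real.pi)
    have h3 : x = ((a - Real.pi / 2) / Real.pi - m) * Real.pi := by
      rw [hx]; field_simp; ring
    rw [h3, abs_mul, abs_of_pos hπ]
    calc _ ≤ 1 / 2 * Real.pi := by gcongr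
      _ = _ := by ring
  have h4 : |Real.sin x| = |Real.cos a| := by
    have : a = x + Real.pi / 2 + m * Real.pi := by rw [hx]; ring
    rw [this, Real.cos_add_int_mul_pi, Real.cos_add_pi_div_two, abs_mul, abs_neg, abs_zpow,
      abs_neg, abs_one, _root_.one_zpow, one_mul]
  have h5 := Real.mul_abs_le_abs_sin h1
  rw [h4] at h5
  have h6 : 2 / Real.pi * |x| ≤ ε := h5.trans h
  calc |x| = Real.pi / 2 * (2 / Real.pi * |x|) := by field_simp
    _ ≤ _ := by gcongr

/-- Two nearby vectors have a normalized inner product close to one. -/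
lemma norm_inner_div_sub_one_le {F : Type*} [NormedAddCommGroup F] [InnerProductSpace ℂ F]
    {x y : F} (hx : x ≠ 0) (hy : y ≠ 0) :
    ‖inner ℂ x y / (‖x‖ * ‖y‖ : ℂ) - 1‖ ≤ 2 * ‖x - y‖ / ‖y‖ := by
  have hx' := norm_pos_iff.2 hx
  have hy' := norm_pos_iff.2 hy
  have hxc : (‖x‖ : ℂ) ≠ 0 := by exact_mod_cast hx'.ne'
  have hyc : (‖y‖ : ℂ) ≠ 0 := by exact_mod_cast hy'.ne'
  have h1 : inner ℂ x y / (‖x‖ * ‖y‖ : ℂ) - 1 =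
      (inner ℂ x (y - x) + ‖x‖ * ((‖x‖ - ‖y‖ : ℝ) : ℂ)) / (‖x‖ * ‖y‖ : ℂ) := by
    rw [inner_sub_right, inner_self_eq_norm_sq_to_K]
    field_simp
    push_cast
    simp only [Complex.coe_algebraMap]
    ring
  rw [h1, norm_div, norm_mul, Complex.norm_real, Complex.norm_real, norm_norm, norm_norm,
    div_le_div_iff₀ (by positivity) hy']
  have h2 : ‖inner ℂ x (y - x) + ‖x‖ * ((‖x‖ - ‖y‖ : ℝ) : ℂ)‖ ≤ 2 * ‖x - y‖ * ‖x‖ := by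
    refine (norm_add_le _ _).trans ?_
    have h3 := norm_inner_le_norm (𝕜 := ℂ) x (y - x)
    rw [norm_sub_rev y x] at h3
    rw [norm_mul, Complex.norm_real, Complex.norm_real, norm_norm, Real.norm_eq_abs]
    have h4 := mul_le_mul_of_nonneg_left (abs_norm_sub_norm_le x y) hx'.le
    linarith
  calc _ ≤ 2 * ‖x - y‖ * ‖x‖ * ‖y‖ := by gcongr
    _ = _ := by ring

/-- The algebra behind the quarter turn: `θ` and `w` are normalized inner products of the two
swapped eigenvectors in two gauges. -/
lemma abs_cos_le_of_sq_eq {a β δ η : ℝ} {θ w : ℂ}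
    (h : (Complex.exp (Complex.I * a) * θ) ^ 2 = -(Complex.exp (-(Complex.I * β)) * w ^ 2))
    (hβ : |β| ≤ δ) (hw : ‖w - 1‖ ≤ δ) (hδ : δ ≤ 1 / 2) (hη : |θ.im| ≤ η) :
    |Real.cos a| ≤ 6 * δ + 4 * η := by
  have hδ0 : 0 ≤ δ := (abs_nonneg _).trans hβ
  -- Hence `e^{ia} θ = ± i e^{-iβ/2} w` with `e^{-iβ/2} w` close to `1`, so `e^{ia} θ` has small
  -- real part. As `θ` is nearly real and `‖θ‖ = ‖w‖ ≥ 1 / 2`, this makes `cos a` small.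
  have h1 : (Complex.exp (Complex.I * a) * θ) ^ 2 =
      (Complex.I * (Complex.exp (Complex.I * (-(β / 2) : ℝ)) * w)) ^ 2 := by
    rw [h, mul_pow, mul_pow, Complex.I_sq, ← Complex.exp_nat_mul]
    have : ((2 : ℕ) : ℂ) * (Complex.I * (-(β / 2) : ℝ)) = -(Complex.I * β) := by push_cast; ring
    rw [this]; ring
  have hn : ∀ x : ℝ, ‖Complex.exp (Complex.I * x)‖ = 1 := fun x => by
    rw [mul_comm, Complex.norm_exp_ofReal_mul_I]
  set f := Complex.exp (Complex.I * (-(β / 2) : ℝ)) with hf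
  have hfim : |(f * w).im| ≤ 2 * δ := by
    have h2 : f * w = f * (w - 1) + (f - 1) + 1 := by ring
    have h3 : ‖f - 1‖ ≤ δ := by
      refine (Real.norm_exp_I_mul_ofReal_sub_one_le).trans ?_
      rw [Real.norm_eq_abs, abs_neg, abs_div, abs_two]
      linarith [abs_nonneg β]
    rw [h2, Complex.add_im, Complex.one_im, add_zero]
    refine (Complex.abs_im_le_norm _).trans ((norm_add_le _ _).trans ?_)
    rw [norm_mul, hf, hn, ← hf]
    linarith
  have hre : |(Complex.exp (Complex.I * a) * θ).re| ≤ 2 * δ := by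
    rcases sq_eq_sq_iff_eq_or_eq_neg.1 h1 with e | e
    · rw [e, Complex.I_mul_re, abs_neg]; exact hfim
    · rw [e, Complex.neg_re, Complex.I_mul_re, abs_neg, abs_neg]; exact hfim
  have hθn : ‖θ‖ = ‖w‖ := by
    have := congrArg norm h1
    rw [norm_pow, norm_pow, norm_mul, norm_mul, norm_mul, hn, hf, hn, Complex.norm_I] at this
    simpa using this
  have hw2 : 1 / 2 ≤ ‖w‖ := by
    have := norm_sub_norm_le 1 (1 - w)
    rw [sub_sub_cancel, norm_one, norm_sub_rev] at this
    linarith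
  have hexp : Complex.exp (Complex.I * a) = ⟨Real.cos a, Real.sin a⟩ := by
    rw [mul_comm, Complex.exp_mul_I]
    apply Complex.ext <;> simp [Complex.cos_ofReal_re, Complex.sin_ofReal_re]
  have hre2 : |Real.cos a * θ.re| ≤ 2 * δ + η := by
    have h2 : Real.cos a * θ.re =
        (Complex.exp (Complex.I * a) * θ).re + Real.sin a * θ.im := by
      rw [hexp, Complex.mul_re]; ring
    rw [h2]
    refine (abs_add_le _ _).trans (add_le_add hre ?_)
    rw [abs_mul]
    calc |Real.sin a| * |θ.im| ≤ 1 * η :=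
          mul_le_mul (Real.abs_sin_le_one a) hη (abs_nonneg _) zero_le_one
      _ = η := one_mul η
  have h5 : |Real.cos a| * ‖θ‖ ≤ |Real.cos a| * (|θ.re| + |θ.im|) :=
    mul_le_mul_of_nonneg_left (Complex.norm_le_abs_re_add_abs_im θ) (abs_nonneg _)
  rw [abs_mul] at hre2
  have h6 : |Real.cos a| * |θ.im| ≤ 1 * η :=
    mul_le_mul (Real.abs_cos_le_one a) hη (abs_nonneg _) zero_le_one
  have h7 : |Real.cos a| * (1 / 2) ≤ |Real.cos a| * ‖θ‖ := by
    rw [hθn]; exact mul_le_mul_of_nonneg_left hw2 (abs_nonneg _)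
  have hη0 : 0 ≤ η := (abs_nonneg _).trans hη
  nlinarith

end Asymptotics

/-! ### Transport of an eigenvector with a square-root singularity -/

section SwapPhase

open Set Filter Matrix

variable {n : ℕ}

/-- Comparison of the gauges of two vectors `X = z • P` and `Y = (w * exp (I a)) • Q`, when
`w ^ 2 / z ^ 2` is close to a negative number and `X` is close to `Y`. -/
lemma abs_cos_le_of_gauge {F : Type*} [NormedAddCommGroup F] [InnerProductSpace ℂ F]
    {P Q X Y : F} {z w : ℂ} {R β a δ : ℝ} (hz : z ≠ 0) (hw : w ≠ 0) (hP : P ≠ 0) (hQ : Q ≠ 0)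
    (hX : X = z • P) (hY : Y = (w * Complex.exp (Complex.I * a)) • Q) (hR : 0 < R)
    (hwz : w ^ 2 = -(z ^ 2 * (R * Complex.exp (Complex.I * β)))) (hβ : |β| ≤ δ)
    (hXY : 2 * ‖X - Y‖ ≤ δ * ‖Y‖) (hδ : δ ≤ 1 / 2) :
    |Real.cos a| ≤ 6 * δ + 4 * |(inner ℂ P Q).im / (‖P‖ * ‖Q‖)| := by
  have hn : ∀ x : ℝ, ‖Complex.exp (Complex.I * x)‖ = 1 := fun x => by
    rw [mul_comm, Complex.norm_exp_ofReal_mul_I]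
  have hea : Complex.exp (Complex.I * a) ≠ 0 := Complex.exp_ne_zero _
  have hX0 : X ≠ 0 := by rw [hX]; exact smul_ne_zero hz hP
  have hY0 : Y ≠ 0 := by rw [hY]; exact smul_ne_zero (mul_ne_zero hw hea) hQ
  have hnX : ‖X‖ = ‖z‖ * ‖P‖ := by rw [hX, norm_smul]
  have hnY : ‖Y‖ = ‖w‖ * ‖Q‖ := by rw [hY, norm_smul, norm_mul, hn, mul_one]
  have hPc : (‖P‖ : ℂ) ≠ 0 := by exact_mod_cast norm_ne_zero_iff.2 hP
  have hQc : (‖Q‖ : ℂ) ≠ 0 := by exact_mod_cast norm_ne_zero_iff.2 hQ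
  have hzc : (‖z‖ : ℂ) ≠ 0 := by exact_mod_cast norm_ne_zero_iff.2 hz
  have hwc : (‖w‖ : ℂ) ≠ 0 := by exact_mod_cast norm_ne_zero_iff.2 hw
  have hRc : (R : ℂ) ≠ 0 := by exact_mod_cast hR.ne'
  have hnw : (‖w‖ : ℂ) ^ 2 = (‖z‖ : ℂ) ^ 2 * R := by
    have := congrArg norm hwz
    rw [norm_neg, norm_pow, norm_mul, norm_mul, hn, norm_pow, Complex.norm_real,
      Real.norm_of_nonneg hR.le, mul_one] at this
    exact_mod_cast this
  -- The normalized product of `X` and `Y` is `e^{ia}` times that of `P` and `Q`, times the unit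
  -- number `conj z * w / (‖z‖ ‖w‖)`, whose square is `-e^{iβ}` by `hwz`.
  have hin : inner ℂ X Y =
      (starRingEnd ℂ) z * (w * Complex.exp (Complex.I * a)) * inner ℂ P Q := by
    rw [hX, hY, inner_smul_left, inner_smul_right]; ring
  have hcz : z * (starRingEnd ℂ) z = (‖z‖ : ℂ) ^ 2 := Complex.mul_conj' z
  refine abs_cos_le_of_sq_eq (θ := inner ℂ P Q / (‖P‖ * ‖Q‖ : ℂ))
    (w := inner ℂ X Y / (‖X‖ * ‖Y‖ : ℂ)) (β := β) ?_ hβ ?_ hδ ?_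
  · rw [hin, hnX, hnY, Complex.exp_neg]
    have he : Complex.exp (Complex.I * β) ≠ 0 := Complex.exp_ne_zero _
    push_cast
    simp only [div_pow, mul_pow]
    rw [hwz, hnw, ← hcz]
    have hcz0 : (starRingEnd ℂ) z ≠ 0 := by
      intro e; rw [e, mul_zero] at hcz; exact pow_ne_zero 2 hzc hcz.symm
    field_simp
  · exact (norm_inner_div_sub_one_le hX0 hY0).trans
      ((div_le_iff₀ (norm_pos_iff.2 hY0)).2 hXY)
  · have : inner ℂ P Q / (‖P‖ * ‖Q‖ : ℂ) = inner ℂ P Q / ((‖P‖ * ‖Q‖ : ℝ) : ℂ) := by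
      push_cast; rfl
    rw [this, Complex.div_ofReal_im]

variable {k : ℕ∞} {B V : ℝ → Matrix (Fin n) (Fin n) ℂ} {lam : ℝ → Fin n → ℂ}

/-- Parallel transport of an eigenvector `x₀ + r x₁` along a loop on which `r` changes sign. -/
theorem IsTransportedEigendecomposition.exists_gauge_sq
    (h : IsTransportedEigendecomposition k B V lam) (hk : 1 ≤ k) (hinj : ∀ t, Function.Injective (lam t)) {j : Fin n}
    {x₀ x₁ y : ℝ → Fin n → ℂ} {r b : ℝ → ℂ} {ε : ℝ} (hx₀ : ContDiff ℝ 1 x₀)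
    (hx₁ : ContDiff ℝ 1 x₁) (hr : ContDiff ℝ 1 r) (hr0 : ∀ t, r t ≠ 0) (hb0 : ∀ t, b t ≠ 0)
    (hyx : ∀ t, y t ⬝ᵥ (x₀ t + r t • x₁ t) = 2 * b t * r t) (hyx₁ : ∀ t, y t ⬝ᵥ x₁ t = b t)
    (hBx : ∀ t, (B t).mulVec (x₀ t + r t • x₁ t) = lam t j • (x₀ t + r t • x₁ t))
    (hBy : ∀ t, (B t).vecMul (y t) = lam t j • y t)
    (hε : ∀ t ∈ Icc (0 : ℝ) 1,
      ‖y t ⬝ᵥ (deriv x₀ t + r t • deriv x₁ t)‖ ≤ ε * (‖b t‖ * ‖r t‖))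
    (hr1 : r 1 = -r 0) :
    ∃ (z w : ℂ) (R β : ℝ), z ≠ 0 ∧ w ≠ 0 ∧ (x₀ 0 + r 0 • x₁ 0 = z • fun i => V 0 i j) ∧
      (x₀ 1 + r 1 • x₁ 1 = w • fun i => V 1 i j) ∧ 0 < R ∧ |β| ≤ ε ∧
      w ^ 2 = -(z ^ 2 * (R * Complex.exp (Complex.I * β))) := by
  have hne : ∀ t, y t ⬝ᵥ (x₀ t + r t • x₁ t) ≠ 0 := fun t => by
    rw [hyx]; exact mul_ne_zero (mul_ne_zero two_ne_zero (hb0 t)) (hr0 t)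
  obtain ⟨z, hz, hz0, hxz, -, him⟩ := h.exists_gauge hk hinj (j := j)
    (x := fun t => x₀ t + r t • x₁ t) (y := y) (hx₀.add (hr.smul hx₁))
    (fun t e => hne t ((congrArg (y t ⬝ᵥ ·) e).trans (dotProduct_zero _)))
    (fun t e => hne t (by rw [e, zero_dotProduct])) hBx hBy
  -- The part `r' x₁` of `x'` contributes `r' b / (2 b r)` to `z' / z`, up to a real term, and may
  -- be unbounded in ratio to the rest. Passing to `z ^ 2 / r` cancels it exactly, leaving only the
  -- part controlled by `hε`.
  have hG : ContDiff ℝ 1 (fun t => z t ^ 2 / r t) := by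
    simp only [div_eq_mul_inv]
    exact (hz.pow 2).mul (hr.inv hr0)
  have hG0 : ∀ t, z t ^ 2 / r t ≠ 0 := fun t => div_ne_zero (pow_ne_zero 2 (hz0 t)) (hr0 t)
  have hlog : ∀ t, (deriv (fun t => z t ^ 2 / r t) t / (z t ^ 2 / r t)).im =
      ((y t ⬝ᵥ (deriv x₀ t + r t • deriv x₁ t)) / (b t * r t)).im := by
    intro t
    have hzd := (hz.differentiable one_ne_zero t).hasDerivAt
    have hrd := (hr.differentiable one_ne_zero t).hasDerivAt
    have h1 : deriv (fun t => z t ^ 2 / r t) t / (z t ^ 2 / r t) =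
        (2 : ℝ) * (deriv z t / z t) - deriv r t / r t := by
      rw [show (fun t => z t ^ 2 / r t) = z ^ 2 / r from rfl, ((hzd.pow 2).div hrd (hr0 t)).deriv]
      have := hz0 t
      have := hr0 t
      simp only [Pi.pow_apply]
      push_cast
      field_simp
    have h2 : deriv (fun t => x₀ t + r t • x₁ t) t =
        deriv r t • x₁ t + (deriv x₀ t + r t • deriv x₁ t) := by
      have hd := (hx₀.differentiable one_ne_zero t).hasDerivAt.add
        (hrd.smul (hx₁.differentiable one_ne_zero t).hasDerivAt)
      rw [show (fun t => x₀ t + r t • x₁ t) = x₀ + r • x₁ from rfl, hd.deriv]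
      abel
    have h3 := him t
    rw [h2, hyx, dotProduct_add, dotProduct_smul, hyx₁, smul_eq_mul] at h3
    have h4 : (deriv r t * b t + y t ⬝ᵥ (deriv x₀ t + r t • deriv x₁ t)) / (2 * b t * r t) =
        ((1 / 2 : ℝ) : ℂ) * (deriv r t / r t) +
          ((1 / 2 : ℝ) : ℂ) * ((y t ⬝ᵥ (deriv x₀ t + r t • deriv x₁ t)) / (b t * r t)) := by
      have := hb0 t
      have := hr0 t
      push_cast
      field_simp
    rw [h4, Complex.add_im, Complex.im_ofReal_mul, Complex.im_ofReal_mul] at h3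
    rw [h1, Complex.sub_im, Complex.im_ofReal_mul, h3]
    ring
  obtain ⟨R, β, hR, hβ, e⟩ := exists_phase_of_im_logDeriv_le hG hG0 (ε := ε) (t := 1)
    (fun τ hτ => by
      rw [uIcc_of_le zero_le_one] at hτ
      rw [hlog]
      refine (Complex.abs_im_le_norm _).trans ?_
      rw [norm_div, norm_mul]
      exact (div_le_iff₀ (mul_pos (norm_pos_iff.2 (hb0 τ)) (norm_pos_iff.2 (hr0 τ)))).2 (hε τ hτ))
  rw [abs_one, mul_one] at hβ
  refine ⟨z 0, z 1, R, β, hz0 0, hz0 1, hxz 0, hxz 1, hR, hβ, ?_⟩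
  have := hr0 0
  rw [hr1] at e
  field_simp at e
  linear_combination -e

end SwapPhase

/-! ### Phases of the exchanged eigenvectors -/

section CuspPhase

open Set Filter Matrix

variable {n : ℕ} {γ : ℝ → Plane} {ξ₀ : Plane} {A : Plane → Matrix (Fin n) (Fin n) ℂ} {m : ℕ}
  {T : Plane → Matrix (Fin n) (Fin 2) ℂ}
  {S : Plane → Matrix (Fin 2) (Fin n) ℂ} {E : Plane → Matrix (Fin 2) (Fin 2) ℂ}
  {L : Plane ≃L[ℝ] ℂ} {l : Fin m → ℂ}

/-- The eigenvector is affine in `ρ`; its coefficients are `C¹` at `ξ₀`, and the singular dependence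
is confined to the root. -/
lemma mulVec_rightVec_eq_add_smul (N : Matrix (Fin n) (Fin 2) ℂ) (M : Matrix (Fin 2) (Fin 2) ℂ)
    (ρ : ℂ) : N *ᵥ rightVec M ρ = N *ᵥ rightVec M 0 + ρ • fun i => N i 1 := by
  funext i
  simp [rightVec, mulVec, dotProduct, Fin.sum_univ_two]
  ring

lemma leftVec_vecMul_eq_add_smul (N : Matrix (Fin 2) (Fin n) ℂ) (M : Matrix (Fin 2) (Fin 2) ℂ)
    (ρ : ℂ) : leftVec M ρ ᵥ* N = leftVec M 0 ᵥ* N + ρ • N 0 := by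
  funext i
  simp [leftVec, vecMul, dotProduct, Fin.sum_univ_two]
  ring

lemma eventually_mul_sqrt_le (K : ℝ) {ε : ℝ} (hε : 0 < ε) : ∀ᶠ s in 𝓝[>] (0 : ℝ), K * √s ≤ ε := by
  have hc : Tendsto (fun s => K * √s) (𝓝[>] (0 : ℝ)) (𝓝 (K * √0)) :=
    ((continuous_const.mul Real.continuous_sqrt).tendsto 0).mono_left nhdsWithin_le_nhds
  rw [Real.sqrt_zero, mul_zero] at hc
  filter_upwards [hc.eventually_lt_const hε] with s hs using hs.le

namespace IsCuspFrame

lemma contDiffAt_mulVec_rightVec_zero (hF : IsCuspFrame A ξ₀ T S E L l) :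
    ContDiffAt ℝ 1 (fun ξ => T ξ *ᵥ rightVec (E ξ) 0) ξ₀ := by
  refine contDiffAt_pi.2 fun i => ?_
  simp only [mulVec, dotProduct, Fin.sum_univ_two, rightVec, cons_val_zero, cons_val_one, add_zero]
  exact ((hF.contDiffAt_T i 0).mul (hF.contDiffAt_E 0 1)).add ((hF.contDiffAt_T i 1).mul
    (((hF.contDiffAt_E 1 1).sub (hF.contDiffAt_E 0 0)).div_const 2))

lemma contDiffAt_leftVec_zero_vecMul (hF : IsCuspFrame A ξ₀ T S E L l) :
    ContDiffAt ℝ 1 (fun ξ => leftVec (E ξ) 0 ᵥ* S ξ) ξ₀ := by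
  refine contDiffAt_pi.2 fun i => ?_
  simp only [vecMul, dotProduct, Fin.sum_univ_two, leftVec, cons_val_zero, cons_val_one, add_zero]
  exact ((((hF.contDiffAt_E 0 0).sub (hF.contDiffAt_E 1 1)).div_const 2).mul
    (hF.contDiffAt_S 0 i)).add ((hF.contDiffAt_E 0 1).mul (hF.contDiffAt_S 1 i))

lemma eventually_norm_bounds (hF : IsCuspFrame A ξ₀ T S E L l) :
    ∃ M > 0, ∃ κ > 0, ∀ᶠ ξ in 𝓝 ξ₀, ‖leftVec (E ξ) 0 ᵥ* S ξ‖ ≤ M ∧ ‖S ξ 0‖ ≤ M ∧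
      ‖WithLp.toLp 2 (fun i => T ξ i 1)‖ ≤ M ∧ κ ≤ ‖E ξ 0 1‖ ∧
      κ ≤ ‖WithLp.toLp 2 (T ξ *ᵥ rightVec (E ξ) 0)‖ := by
  have hc1 := hF.contDiffAt_leftVec_zero_vecMul.continuousAt.norm
  have hc2 : ContinuousAt (fun ξ => ‖S ξ 0‖) ξ₀ :=
    (continuousAt_pi.2 fun i => (hF.contDiffAt_S 0 i).continuousAt).norm
  have hlp := PiLp.continuous_toLp 2 (fun _ : Fin n => ℂ)
  have hc3 : ContinuousAt (fun ξ => ‖WithLp.toLp 2 (fun i => T ξ i 1)‖) ξ₀ :=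
    (hlp.continuousAt.comp
      (continuousAt_pi.2 fun i => (hF.contDiffAt_T i 1).continuousAt)).norm
  have hc4 := (hF.contDiffAt_E 0 1).continuousAt.norm
  have hc5 : ContinuousAt (fun ξ => ‖WithLp.toLp 2 (T ξ *ᵥ rightVec (E ξ) 0)‖) ξ₀ :=
    (hlp.continuousAt.comp hF.contDiffAt_mulVec_rightVec_zero.continuousAt).norm
  have hE0 : 0 < ‖E ξ₀ 0 1‖ := norm_pos_iff.2 hF.upper_ne_zero
  -- At `ξ₀` the discriminant is zero, so `ρ = 0` is admissible and gives the merged, nonzero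
  -- eigenvector.
  have hX0 : 0 < ‖WithLp.toLp 2 (T ξ₀ *ᵥ rightVec (E ξ₀) 0)‖ := by
    refine norm_pos_iff.2 fun e => (hF.eventually_eigenvectors.self_of_nhds.2.2 0 ?_).2.2.1
      ((WithLp.toLp_eq_zero 2).1 e)
    rw [hF.disc_eq_zero]; norm_num
  set M := ‖leftVec (E ξ₀) 0 ᵥ* S ξ₀‖ + ‖S ξ₀ 0‖ + ‖WithLp.toLp 2 (fun i => T ξ₀ i 1)‖ + 1 with hM
  have h1 := norm_nonneg (leftVec (E ξ₀) 0 ᵥ* S ξ₀)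
  have h2 := norm_nonneg (S ξ₀ 0)
  have h3 := norm_nonneg (WithLp.toLp 2 (fun i => T ξ₀ i 1))
  refine ⟨M, by positivity, min (‖E ξ₀ 0 1‖ / 2) (‖WithLp.toLp 2 (T ξ₀ *ᵥ rightVec (E ξ₀) 0)‖ / 2),
    lt_min (half_pos hE0) (half_pos hX0), ?_⟩
  filter_upwards [hc1.eventually_lt_const (show _ < M by linarith),
    hc2.eventually_lt_const (show _ < M by linarith),
    hc3.eventually_lt_const (show _ < M by linarith),
    hc4.eventually_const_lt (half_lt_self hE0), hc5.eventually_const_lt (half_lt_self hX0)]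
    with ξ e1 e2 e3 e4 e5
  exact ⟨e1.le, e2.le, e3.le, (min_le_left _ _).trans e4.le, (min_le_right _ _).trans e5.le⟩

/-- The phase acquired by an eigenvector of the degenerating block on a small loop. -/
theorem exists_cos_phase_bound (hF : IsCuspFrame A ξ₀ T S E L l) (hγ : IsSmoothJordanCurve γ)
    {k : ℕ∞} (hk : 1 ≤ k) {c C : ℝ} (hc : 0 < c) (hC : 0 < C) :
    ∃ K > 0, ∀ᶠ s in 𝓝[>] (0 : ℝ), ∀ (V : ℝ → Matrix (Fin n) (Fin n) ℂ) (lam : ℝ → Fin n → ℂ),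
      IsTransportedEigendecomposition k (fun t => A (shrink ξ₀ γ s t)) V lam →
      (∀ t, Function.Injective (lam t)) → ∀ r : ℝ → ℂ, ContDiff ℝ 1 r →
      (∀ t, r t ^ 2 = disc2 (E (shrink ξ₀ γ s t)) / 4) → (∀ t, r (t + 1) = -r t) →
      (∀ t, c * √s ≤ ‖r t‖ ∧ ‖r t‖ ≤ C * √s) → ∀ (p q : Fin n) (a : ℝ),
      (∀ t, lam t p = halfTrace (E (shrink ξ₀ γ s t)) + r t) →
      ((fun i => V 1 i p) = Complex.exp (Complex.I * (a : ℂ)) • fun i => V 0 i q) →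
      |Real.cos a| ≤ K * √s + 4 * |(inner ℂ (colVec (V 0) p) (colVec (V 0) q)).im /
        (‖colVec (V 0) p‖ * ‖colVec (V 0) q‖)| := by
  obtain ⟨M, hM, κ, hκ, hbd⟩ := hF.eventually_norm_bounds
  obtain ⟨C₀, hC₀, hx₀⟩ := hγ.exists_comp_shrink_bound hF.contDiffAt_mulVec_rightVec_zero
  obtain ⟨C₁, hC₁, hx₁⟩ := hγ.exists_comp_shrink_bound
    (contDiffAt_pi.2 fun i => hF.contDiffAt_T i 1)
  -- `K₁ √s` bounds the phase drift: a numerator of order `s` over `‖b r‖ ≥ κ c √s`. `K₂ √s` bounds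
  -- the effect of the gap `2 r x₁` between the end vectors, relative to their norm, at least `κ /
  -- 2`.
  set K₁ := n * (2 * M * (C₀ + C₁)) / (κ * c) with hK₁
  set K₂ := 8 * C * M / κ with hK₂
  have hK₁0 : 0 ≤ K₁ := by positivity
  have hK₂0 : 0 ≤ K₂ := by positivity
  refine ⟨6 * (K₁ + K₂) + 1, by positivity, ?_⟩
  filter_upwards [hγ.eventually_shrink hbd, hγ.eventually_shrink hF.eventually_eigenvectors, hx₀,
    hx₁, self_mem_nhdsWithin, eventually_mul_sqrt_le (K₁ + K₂) (half_pos one_pos),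
    eventually_mul_sqrt_le C one_pos, eventually_mul_sqrt_le (C * M) (half_pos hκ)]
    with s hbd hvec ⟨hx₀, _, hx₀'⟩ ⟨hx₁, _, hx₁'⟩ (hs0 : 0 < s) hsmall hsC hsκ V lam hV hinj r hr
      hr2 hanti hrb p q a hp ha
  set ζ := shrink ξ₀ γ s with hζ
  have hs : 0 < √s := Real.sqrt_pos.2 hs0
  have hr0 : ∀ t, r t ≠ 0 := fun t e => by
    have h1 := (hrb t).1
    rw [e, norm_zero] at h1
    have : 0 < c * √s := by positivity
    linarith
  have hr1 : ∀ t, ‖r t‖ ≤ 1 := fun t => (hrb t).2.trans hsC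
  have hX : ∀ t, T (ζ t) *ᵥ rightVec (E (ζ t)) (r t) =
      T (ζ t) *ᵥ rightVec (E (ζ t)) 0 + r t • fun i => T (ζ t) i 1 :=
    fun t => mulVec_rightVec_eq_add_smul _ _ _
  have hST : ∀ t w, (leftVec (E (ζ t)) (r t) ᵥ* S (ζ t)) ⬝ᵥ (T (ζ t) *ᵥ w) =
      leftVec (E (ζ t)) (r t) ⬝ᵥ w := fun t w => by
    rw [← dotProduct_mulVec, mulVec_mulVec, (hvec t).2.1, one_mulVec]
  have hT1 : ∀ t, (fun i => T (ζ t) i 1) = T (ζ t) *ᵥ ![0, 1] := fun t => by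
    funext i
    simp [mulVec, dotProduct, Fin.sum_univ_two]
  have hynorm : ∀ t, ‖leftVec (E (ζ t)) (r t) ᵥ* S (ζ t)‖ ≤ 2 * M := fun t => by
    rw [leftVec_vecMul_eq_add_smul]
    refine (norm_add_le _ _).trans ?_
    rw [norm_smul]
    have := mul_le_mul (hr1 t) (hbd t).2.1 (norm_nonneg _) zero_le_one
    linarith [(hbd t).1]
  have hper : ζ 1 = ζ 0 := by have := hγ.shrink_add_one ξ₀ s 0; rwa [zero_add] at this
  have hr10 : r 1 = -r 0 := by have := hanti 0; rwa [zero_add] at this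
  obtain ⟨z, w, R, β, hz, hw, e0, e1, hR, hβ, hwz⟩ := hV.exists_gauge_sq hk hinj (j := p)
    (x₀ := fun t => T (ζ t) *ᵥ rightVec (E (ζ t)) 0) (x₁ := fun t i => T (ζ t) i 1)
    (y := fun t => leftVec (E (ζ t)) (r t) ᵥ* S (ζ t)) (r := r) (b := fun t => E (ζ t) 0 1)
    (ε := K₁ * √s) hx₀ hx₁ hr hr0 (fun t => (hvec t).1)
    (fun t => by
      change _ ⬝ᵥ (_ + r t • fun i => T (ζ t) i 1) = _
      rw [← hX, hST, leftVec_dotProduct_rightVec])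
    (fun t => by
      rw [hT1, hST]
      simp [leftVec, dotProduct, Fin.sum_univ_two])
    (fun t => by
      change (A (ζ t)) *ᵥ (_ + r t • fun i => T (ζ t) i 1) =
        lam t p • (_ + r t • fun i => T (ζ t) i 1)
      rw [← hX, hp]
      exact ((hvec t).2.2 _ (hr2 t)).1)
    (fun t => by
      rw [hp]
      exact ((hvec t).2.2 _ (hr2 t)).2.1)
    (fun t ht => by
      refine (norm_dotProduct_le _ _).trans ?_
      have h1 : ‖deriv (fun t => T (ζ t) *ᵥ rightVec (E (ζ t)) 0) t +
          r t • deriv (fun t i => T (ζ t) i 1) t‖ ≤ (C₀ + C₁) * s := by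
        refine (norm_add_le _ _).trans ?_
        rw [norm_smul]
        have := mul_le_mul (hr1 t) (hx₁' t ht) (norm_nonneg _) zero_le_one
        linarith [hx₀' t ht]
      have h2 : κ * (c * √s) ≤ ‖E (ζ t) 0 1‖ * ‖r t‖ :=
        mul_le_mul (hbd t).2.2.2.1 (hrb t).1 (by positivity) (norm_nonneg _)
      calc n * (‖leftVec (E (ζ t)) (r t) ᵥ* S (ζ t)‖ * _)
          ≤ n * ((2 * M) * ((C₀ + C₁) * s)) :=
            mul_le_mul_of_nonneg_left (mul_le_mul (hynorm t) h1 (norm_nonneg _) (by positivity))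
              (Nat.cast_nonneg n)
        _ = K₁ * √s * (κ * (c * √s)) := by
            rw [hK₁]
            field_simp
            rw [Real.sq_sqrt hs0.le]
        _ ≤ _ := mul_le_mul_of_nonneg_left h2 (by positivity))
    hr10
  set X₀ := WithLp.toLp 2 (T (ζ 0) *ᵥ rightVec (E (ζ 0)) 0) with hX₀
  set X₁ := WithLp.toLp 2 (fun i => T (ζ 0) i 1) with hX₁
  have hP : colVec (V 0) p ≠ 0 := norm_pos_iff.1 (hV.colVec_norm_pos 0 p)
  have hQ : colVec (V 0) q ≠ 0 := norm_pos_iff.1 (hV.colVec_norm_pos 0 q)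
  have hsplit : K₁ * √s ≤ (K₁ + K₂) * √s := by nlinarith
  have hb0 := hbd 0
  have hrX : ‖r 0 • X₁‖ ≤ C * M * √s := by
    rw [norm_smul]
    have := mul_le_mul (hrb 0).2 hb0.2.2.1 (norm_nonneg _) (by positivity)
    linarith
  have hYn : κ / 2 ≤ ‖X₀ - r 0 • X₁‖ := by
    have := norm_sub_norm_le X₀ (r 0 • X₁)
    linarith [hb0.2.2.2.2]
  -- `X` and `Y` are the eigenvector `x₀ + r x₁` at times `0` and `1`, where `r` has changed sign.
  -- The first is a multiple of `v_p(0)`, the second of `v_p(1) = e^{ia} v_q(0)`.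
  have hmain := abs_cos_le_of_gauge (P := colVec (V 0) p) (Q := colVec (V 0) q)
    (X := X₀ + r 0 • X₁) (Y := X₀ - r 0 • X₁) (a := a) (δ := (K₁ + K₂) * √s) hz hw hP hQ
    (congrArg (WithLp.toLp 2) e0)
    (by
      rw [hr10, ha, smul_smul] at e1
      simp only [hper] at e1
      rw [neg_smul, ← sub_eq_add_neg] at e1
      exact congrArg (WithLp.toLp 2) e1) hR hwz (hβ.trans hsplit)
    (by
      have h1 : X₀ + r 0 • X₁ - (X₀ - r 0 • X₁) = r 0 • X₁ + r 0 • X₁ := by abel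
      have h2 : ‖X₀ + r 0 • X₁ - (X₀ - r 0 • X₁)‖ ≤ 2 * (C * M * √s) := by
        rw [h1]
        linarith [norm_add_le (r 0 • X₁) (r 0 • X₁)]
      calc 2 * ‖X₀ + r 0 • X₁ - (X₀ - r 0 • X₁)‖ ≤ 2 * (2 * (C * M * √s)) := by linarith
        _ = K₂ * √s * (κ / 2) := by rw [hK₂]; field_simp; ring
        _ ≤ (K₁ + K₂) * √s * (κ / 2) := by gcongr; linarith
        _ ≤ _ := mul_le_mul_of_nonneg_left hYn (by positivity)) hsmall
  nlinarith

end IsCuspFrame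

end CuspPhase

/-! ### Uniform phase bounds and the theorem -/

section ShrinkingLoops

open Set Filter Matrix

variable {n : ℕ} {γ : ℝ → Plane} {ξ₀ : Plane} {A : Plane → Matrix (Fin n) (Fin n) ℂ} {m : ℕ}
  {T : Plane → Matrix (Fin n) (Fin 2) ℂ}
  {S : Plane → Matrix (Fin 2) (Fin n) ℂ} {E : Plane → Matrix (Fin 2) (Fin 2) ℂ}
  {L : Plane ≃L[ℝ] ℂ} {l : Fin m → ℂ} {k : ℕ∞}

lemma IsTransportedEigendecomposition.lam_eq_of_col_eq_smul {B V : ℝ → Matrix (Fin n) (Fin n) ℂ}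
    {lam : ℝ → Fin n → ℂ} (h : IsTransportedEigendecomposition k B V lam) {t t' : ℝ}
    (hB : B t' = B t) {i j : Fin n} {c : ℂ} (hc : c ≠ 0)
    (hV : (fun a => V t' a j) = c • fun a => V t a i) : lam t' j = lam t i := by
  have h1 := h.mulVec_col t' j
  rw [hV, hB, mulVec_smul, h.mulVec_col t i, smul_smul, smul_smul, mul_comm c] at h1
  exact (mul_right_cancel₀ hc (smul_left_injective ℂ (h.col_ne_zero t i) h1)).symm

/-- The phases acquired on small loops. -/
theorem IsCuspFrame.exists_phase_bounds (hF : IsCuspFrame A ξ₀ T S E L l)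
    (hγ : IsSmoothJordanCurve γ) (henc : Encircles γ ξ₀) (hk : 1 ≤ k) :
    ∃ K > 0, ∀ᶠ s in 𝓝[>] (0 : ℝ), ∀ (V : ℝ → Matrix (Fin n) (Fin n) ℂ) (lam : ℝ → Fin n → ℂ),
      IsTransportedEigendecomposition k (fun t => A (shrink ξ₀ γ s t)) V lam →
      (∀ t, IsEigenvalueLabelling (A (shrink ξ₀ γ s t)) (lam t)) →
      ∀ (p q : Fin n) (α : Fin n → ℝ), p ≠ q → (V 0)⁻¹ * V 1 = swapPhaseMatrix p q α →
      (∀ j, j = p ∨ j = q → |Real.cos (α j)| ≤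
        K * √s + 4 * |(inner ℂ (colVec (V 0) p) (colVec (V 0) q)).im /
          (‖colVec (V 0) p‖ * ‖colVec (V 0) q‖)|) ∧
      ∀ j, j ≠ p → j ≠ q → ∃ m : ℤ, |α j - m * (2 * Real.pi)| ≤ K * s := by
  obtain ⟨μ, u, y, hμ, hu, hy, hμ0, huy, hA⟩ := hF.exists_local_eigenvalues
  obtain ⟨c, hc, C, hC, hsqrt⟩ := hF.exists_antiperiodic_sqrt hγ henc
  obtain ⟨K₁, hK₁, hcos⟩ := hF.exists_cos_phase_bound hγ hk hc hC
  choose K₂ hK₂ hsimple using fun i =>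
    exists_phase_bound_of_simple hγ hk (hu i) (hy i) (huy i) (hA i)
  have hsum : ∀ i, K₂ i ≤ ∑ i, K₂ i := fun i =>
    Finset.single_le_sum (fun i _ => (hK₂ i).le) (Finset.mem_univ i)
  have hsum0 : 0 ≤ ∑ i, K₂ i := Finset.sum_nonneg fun i _ => (hK₂ i).le
  refine ⟨K₁ + ∑ i, K₂ i, by positivity, ?_⟩
  filter_upwards [hsqrt, hF.eventually_exists_labels hγ hμ hμ0
    fun i => eventually_isRoot (hu i) (huy i) (hA i), hcos, eventually_all.2 hsimple,
    self_mem_nhdsWithin]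
    with s ⟨r, hr, hr2, hanti, hbd⟩ hs hcos hsimple (hs0 : 0 < s) V lam hV hlab p q α hpq hα
  set ζ := shrink ξ₀ γ s with hζ
  have hinj : ∀ t, Function.Injective (lam t) := fun t => (hlab t).1
  have hlamc : ∀ j, Continuous fun t => lam t j := fun j => (hV.contDiff_lam j).continuous
  have hcol := (inv_mul_eq_swapPhaseMatrix_iff (hV.isUnit 0)).1 hα
  have hper : ζ 1 = ζ 0 := by have := hγ.shrink_add_one ξ₀ s 0; rwa [zero_add] at this
  have hlam1 : ∀ j, lam 1 j = lam 0 (Equiv.swap p q j) := fun j =>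
    hV.lam_eq_of_col_eq_smul (congrArg A hper) (Complex.exp_ne_zero _) (hcol j)
  have hs' : 0 < √s := Real.sqrt_pos.2 hs0
  have hr0 : ∀ t, r t ≠ 0 := fun t e => by
    have h1 := (hbd t).1
    rw [e, norm_zero] at h1
    have : 0 < c * √s := by positivity
    linarith
  -- The labels found from the block must be the given `p` and `q`, because one period exchanges
  -- them and the given swap fixes all others. Replacing `r` by `-r` if necessary puts `+r` at `p`.
  obtain ⟨r, hr, hr2, hanti, hbd, hp, hq, hother⟩ : ∃ r : ℝ → ℂ, ContDiff ℝ 1 r ∧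
      (∀ t, r t ^ 2 = disc2 (E (ζ t)) / 4) ∧ (∀ t, r (t + 1) = -r t) ∧
      (∀ t, c * √s ≤ ‖r t‖ ∧ ‖r t‖ ≤ C * √s) ∧ (∀ t, lam t p = halfTrace (E (ζ t)) + r t) ∧
      (∀ t, lam t q = halfTrace (E (ζ t)) - r t) ∧
      ∀ j, j ≠ p → j ≠ q → ∃ i, ∀ t, lam t j = μ i (ζ t) := by
    obtain ⟨p', q', hpq', hp', hq', hj'⟩ := hs r hr.continuous hr2 hr0 lam hlamc hlab
    have hr1 : r 1 = -r 0 := by have := hanti 0; rwa [zero_add] at this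
    have hsw : Equiv.swap p q p' = q' := hinj 0 (by
      rw [← hlam1, hp', hq', hper, hr1, sub_eq_add_neg])
    by_cases h1 : p' = p
    · rw [h1, Equiv.swap_apply_left] at hsw
      subst h1 hsw
      exact ⟨r, hr, hr2, hanti, hbd, hp', hq', hj'⟩
    by_cases h2 : p' = q
    · rw [h2, Equiv.swap_apply_right] at hsw
      subst h2 hsw
      exact ⟨fun t => -r t, hr.neg, fun t => by rw [neg_sq, hr2], fun t => congrArg Neg.neg (hanti t),
        fun t => by rw [norm_neg]; exact hbd t, fun t => by rw [hq', sub_eq_add_neg],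
        fun t => by rw [hp', sub_neg_eq_add], fun j a b => hj' j b a⟩
    rw [Equiv.swap_apply_of_ne_of_ne h1 h2] at hsw
    exact absurd hsw hpq'
  constructor
  · have hle : K₁ * √s ≤ (K₁ + ∑ i, K₂ i) * √s :=
      mul_le_mul_of_nonneg_right (by linarith) hs'.le
    rintro j (rfl | rfl)
    · have h1 := hcol j
      rw [Equiv.swap_apply_left] at h1
      have := hcos V lam hV hinj r hr hr2 hanti hbd j q (α j) hp h1
      linarith
    · have h1 := hcol j
      rw [Equiv.swap_apply_right] at h1
      -- For `q` the root `-r` is used; exchanging the factors of the inner product conjugates it,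
      -- which leaves the absolute imaginary part unchanged.
      have := hcos V lam hV hinj (fun t => -r t) hr.neg (fun t => by rw [neg_sq, hr2])
        (fun t => congrArg Neg.neg (hanti t)) (fun t => by rw [norm_neg]; exact hbd t) j p (α j)
        (fun t => by rw [hq, sub_eq_add_neg]) h1
      rw [← inner_conj_symm, Complex.conj_im, neg_div, abs_neg, mul_comm ‖colVec (V 0) j‖] at this
      linarith
  · intro j hjp hjq
    obtain ⟨i, hi⟩ := hother j hjp hjq
    have h1 := hcol j
    rw [Equiv.swap_apply_of_ne_of_ne hjp hjq] at h1
    obtain ⟨m, hm⟩ := hsimple i V lam hV hinj j (α j) hi h1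
    exact ⟨m, hm.trans (mul_le_mul_of_nonneg_right (by linarith [hsum i]) hs0.le)⟩

end ShrinkingLoops

theorem theorem3p10 {n : ℕ} (hn : 3 ≤ n) {k : ℕ∞} (hk : 1 ≤ k)
    {Ω : Set Plane} (hΩo : IsOpen Ω) (hΩc : Convex ℝ Ω)
    {A : Plane → Matrix (Fin n) (Fin n) ℂ} (hA : MatContDiffOn k A Ω)
    {ξ₀ : Plane} (hξ₀ : ξ₀ ∈ Ω) (hGCP : IsGCP k A Ω ξ₀)
    (hsimple : ∀ ξ ∈ Ω, ξ ≠ ξ₀ → HasDistinctEigenvalues (A ξ))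
    {γ : ℝ → Plane} (hγ : IsSmoothJordanCurve γ) (hγΩ : ∀ t, γ t ∈ Ω) (henc : Encircles γ ξ₀) :
    -- the single loop
    (∀ (V : ℝ → Matrix (Fin n) (Fin n) ℂ) (lam : ℝ → Fin n → ℂ),
      IsTransportedEigendecomposition k (fun t => A (γ t)) V lam →
      ∃ p q : Fin n, p ≠ q ∧
        (∀ t, lam (t + 1) p = lam t q ∧ lam (t + 1) q = lam t p) ∧
        (∀ t j, j ≠ p → j ≠ q → lam (t + 1) j = lam t j) ∧
        (‖colVec (V 0) p‖ = ‖colVec (V 0) q‖ →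
          ∃ α : Fin n → ℝ,
            (∀ t, (V t)⁻¹ * V (t + 1) = swapPhaseMatrix p q α) ∧
            ∃ m : ℤ, ∑ j, α j = Real.pi + m * (2 * Real.pi))) ∧
    -- the shrinking loops
    (∀ (V : ℝ → ℝ → Matrix (Fin n) (Fin n) ℂ) (lam : ℝ → ℝ → Fin n → ℂ)
      (p q : Fin n) (α : ℝ → Fin n → ℝ), p ≠ q →
      (∀ s ∈ Set.Ioc (0 : ℝ) 1,
        IsTransportedEigendecomposition k (fun t => A (shrink ξ₀ γ s t)) (V s) (lam s)) →
      (∀ s ∈ Set.Ioc (0 : ℝ) 1, ∀ t,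
        (V s t)⁻¹ * V s (t + 1) = swapPhaseMatrix p q (α s)) →
      ((fun s => (inner ℂ (colVec (V s 0) p) (colVec (V s 0) q)).im /
          (‖colVec (V s 0) p‖ * ‖colVec (V s 0) q‖)) =O[𝓝[>] 0] (fun s => √s) →
        ∀ j, j = p ∨ j = q →
          ∃ m : ℝ → ℤ, (fun s => α s j - (Real.pi / 2 + m s * Real.pi)) =O[𝓝[>] 0]
            (fun s => √s)) ∧
      (∀ j, j ≠ p → j ≠ q →
        ∃ m : ℝ → ℤ, (fun s => α s j - m s * (2 * Real.pi)) =O[𝓝[>] 0] (fun s => s))) := by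
  obtain ⟨m, T, S, E, L, l, hF⟩ := hGCP.exists_cuspFrame hk hΩo hξ₀ hA
  constructor
  · intro V lam hV
    have hlab : ∀ t, IsEigenvalueLabelling (A (γ t)) (lam t) := fun t =>
      hV.isEigenvalueLabelling (hsimple _ (hγΩ t) fun e => henc.1 ⟨t, e⟩)
    obtain ⟨p, q, hpq, hswap⟩ := exists_swap_of_encircles hΩc hA hξ₀ hsimple hγ hγΩ henc hF
      (fun j => (hV.contDiff_lam j).continuous) hlab
    refine ⟨p, q, hpq, fun t => ⟨?_, ?_⟩, fun t j hjp hjq => ?_, fun hnorm =>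
      hV.exists_phases hk (fun t => (hlab t).1) (fun t => by rw [hγ.periodic]) hpq hswap hnorm⟩
    · rw [hswap, Equiv.swap_apply_left]
    · rw [hswap, Equiv.swap_apply_right]
    · rw [hswap, Equiv.swap_apply_of_ne_of_ne hjp hjq]
  · intro V lam p q α hpq hV hα
    obtain ⟨K, hK, hbounds⟩ := hF.exists_phase_bounds hγ henc hk
    have hev : ∀ᶠ s in 𝓝[>] (0 : ℝ), s ∈ Set.Ioc (0 : ℝ) 1 := Ioc_mem_nhdsGT zero_lt_one
    have hphase := hbounds.and hev
    constructor
    · intro hsmall j hj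
      obtain ⟨c, hc⟩ := hsmall.bound
      have hex : ∀ᶠ s in 𝓝[>] (0 : ℝ), ∃ m : ℤ, |α s j - (Real.pi / 2 + m * Real.pi)| ≤
          Real.pi / 2 * ((K + 4 * c) * √s) := by
        filter_upwards [hphase, hc] with s ⟨hs, hs1⟩ hcs
        have h1 := (hs (V s) (lam s) (hV s hs1) (fun t => (hV s hs1).isEigenvalueLabelling
          (hsimple _ (shrink_mem hΩc hξ₀ hγΩ hs1 t) (shrink_ne henc hs1.1 t))) p q (α s) hpq
          (by simpa only [zero_add] using hα s hs1 0)).1 j hj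
        rw [Real.norm_eq_abs, Real.norm_of_nonneg (Real.sqrt_nonneg s)] at hcs
        exact exists_int_of_abs_cos_le (h1.trans (by linarith))
      -- The integer is chosen separately for each small `s`.
      obtain ⟨m, hm⟩ := hex.choice
      refine ⟨m, IsBigO.of_bound (Real.pi / 2 * (K + 4 * c)) ?_⟩
      filter_upwards [hm] with s hs
      rw [Real.norm_eq_abs, Real.norm_of_nonneg (Real.sqrt_nonneg s), mul_assoc]
      exact hs
    · intro j hjp hjq
      have hex : ∀ᶠ s in 𝓝[>] (0 : ℝ), ∃ m : ℤ, |α s j - m * (2 * Real.pi)| ≤ K * s := by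
        filter_upwards [hphase] with s ⟨hs, hs1⟩
        exact (hs (V s) (lam s) (hV s hs1) (fun t => (hV s hs1).isEigenvalueLabelling
          (hsimple _ (shrink_mem hΩc hξ₀ hγΩ hs1 t) (shrink_ne henc hs1.1 t))) p q (α s) hpq
          (by simpa only [zero_add] using hα s hs1 0)).2 j hjp hjq
      obtain ⟨m, hm⟩ := hex.choice
      refine ⟨m, IsBigO.of_bound K ?_⟩
      filter_upwards [hm, hev] with s hs hs1
      rw [Real.norm_eq_abs, Real.norm_of_nonneg hs1.1.le]
      exact hs
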